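/- Computational model: a randomized real RAM whose memory consists of unbounded arrays of natural numbers and of real numbers. The operations $+,-,\times,\div$ on naturals and reals, $\sqrt{\cdot},\exp,\log,\cos$, rounding down, conversion of naturals to reals, storing a natural constant, indirect addressing, comparisons, and drawing a uniformly random integer from $\{0,\dots,v\}$ cost one step each. A program is a finite piece of code, independent of the input. A kernel $k:\mathbb{R}^d\times\mathbb{R}^d\to[0,1]$ is nice if it is positive definite (all matrices $(k(x_i,x_j))_{i,j}$ are symmetric positive semidefinite) and $k(x,x)=1$ for all $x$. Let $D\subseteq\{1,2,\dots\}$ be a set of dimensions (for instance a single one), and for $d\in D$ let $k_d$ be a kernel on $\mathbb{R}^d$. The family $(k_d)_{d\in D}$ admits an $O(dm/(\mu^p\epsilon^2))$ time KDE algorithm if there are two programs and a constant $C$ such that for all $d\in D$, $m\ge 1$, $x_1,\dots,x_m\in\mathbb{R}^d$, $\epsilon\in(0,1)$ and $\mu\in(0,1]$: the first program processes $x_1,\dots,x_m$ in at most $C\,dm/(\mu^p\epsilon^2)$ steps; after that, and after any finite sequence of earlier queries, the second program answers a query $y\in\mathbb{R}^d$ in at most $C\,d/(\mu^p\epsilon^2)$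 steps; and if $v=\frac1m\sum_i k_d(y,x_i)\ge\mu$, then with probability at least $2/3$ the answer $a$ satisfies $|a-v|\le\epsilon v$. Theorem. Let $p\ge 0$ and let $(k_d)_{d\in D}$ be nice kernels that admit an $O(dm/(\mu^p\epsilon^2))$ time KDE algorithm. For every $c\in\mathbb{N}$ there are a randomized program and a constant $C'$ such that, for all $d\in D$, $n\ge 2$, $x_1,\dots,x_n\in\mathbb{R}^d$ and $\epsilon\in(0,1)$, the program on input $(x_1,\dots,x_n,\epsilon)$ always halts within $$C'\cdot\frac{d\,n^{1+p}\,\log(n/\epsilon)^{2+p}}{\epsilon^{7+4p}}$$ steps, and with probability at least $1-n^{-c}$ it outputs a vector $z\in\mathbb{R}^n$ with $\|z\|_2=1$ and $z^TKz\ge(1-\epsilon)\lambda_1(K)$, where $K=(k_d(x_i,x_j))_{i,j}$ and $\lambda_1(K)$ is its largest eigenvalue. If $p<1$, then for fixed $d$ and $\epsilon$ this running time bound is subquadratic, i.e. $o(n^2)$ as $n\to\infty$. -/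

import Mathlib

open scoped ENNReal

noncomputable section

/-! ## A randomized unit-cost real RAM

Memory consists of arrays of natural numbers and arrays of real numbers.  A program is a finite
piece of syntax with natural number constants only; it names finitely many arrays, but the arrays
are unbounded and are indexed by computed natural numbers (indirect addressing).  Every
elementary instruction and every test costs one step. -/

namespace RealRAM

/-- The memory: `int a i` and `real a i` are the `i`-th cells of the `a`-th integer array and of
the `a`-th real array.  Entry `0` of an array also serves as a scalar variable. -/
structure Mem where
  int : ℕ → ℕ → ℕ
  real : ℕ → ℕ → ℝ

/-- An index into an array: a constant, or the current value of the integer variable `r`. -/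
inductive Idx where
  | const (i : ℕ)
  | var (r : ℕ)

/-- A reference to a cell of an (integer or real) array. -/
structure Ref where
  arr : ℕ
  idx : Idx

/-- Binary operations on natural numbers (`sub` is truncated; `div`, `mod` are with remainder). -/
inductive NatOp where
  | add | sub | mul | div | mod

/-- Binary operations on real numbers (division by zero returns zero). -/
inductive RealOp where
  | add | sub | mul | div

/-- Unary functions on real numbers (with Lean's total conventions outside their domains). -/
inductive RealFun where
  | sqrt | exp | log | cos

/-- Elementary instructions. -/
inductive Instr where
  /-- store a constant -/
  | setNat (dst : Ref) (c : ℕ)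
  /-- arithmetic on integer cells -/
  | natOp (op : NatOp) (dst a b : Ref)
  /-- arithmetic on real cells -/
  | realOp (op : RealOp) (dst a b : Ref)
  /-- a unary function on a real cell -/
  | realFun (f : RealFun) (dst a : Ref)
  /-- copy an integer cell to a real cell -/
  | cast (dst a : Ref)
  /-- round a real cell down to an integer cell (negative numbers give zero) -/
  | floor (dst a : Ref)
  /-- draw a uniformly random integer from `{0, …, v}`, where `v` is the content of `a` -/
  | rand (dst a : Ref)

/-- Tests: strict comparison of two integer cells or of two real cells. -/
inductive Test where
  | natLt (a b : Ref)
  | realLt (a b : Ref)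

/-- Programs. -/
inductive Cmd where
  | instr (i : Instr)
  | seq (c₁ c₂ : Cmd)
  | ite (b : Test) (c₁ c₂ : Cmd)
  | while (b : Test) (c : Cmd)

/-- The value of an index. -/
def Mem.index (M : Mem) : Idx → ℕ
  | .const i => i
  | .var r => M.int r 0

/-- The content of an integer cell. -/
def Mem.getInt (M : Mem) (a : Ref) : ℕ := M.int a.arr (M.index a.idx)

/-- The content of a real cell. -/
def Mem.getReal (M : Mem) (a : Ref) : ℝ := M.real a.arr (M.index a.idx)

/-- Overwrite an integer cell. -/
def Mem.setInt (M : Mem) (a : Ref) (v : ℕ) : Mem :=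
  ⟨Function.update M.int a.arr (Function.update (M.int a.arr) (M.index a.idx) v), M.real⟩

/-- Overwrite a real cell. -/
def Mem.setReal (M : Mem) (a : Ref) (v : ℝ) : Mem :=
  ⟨M.int, Function.update M.real a.arr (Function.update (M.real a.arr) (M.index a.idx) v)⟩

def NatOp.eval : NatOp → ℕ → ℕ → ℕ
  | .add, u, v => u + v
  | .sub, u, v => u - v
  | .mul, u, v => u * v
  | .div, u, v => u / v
  | .mod, u, v => u % v

def RealOp.eval : RealOp → ℝ → ℝ → ℝ
  | .add, u, v => u + v
  | .sub, u, v => u - v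
  | .mul, u, v => u * v
  | .div, u, v => u / v

def RealFun.eval : RealFun → ℝ → ℝ
  | .sqrt, u => Real.sqrt u
  | .exp, u => Real.exp u
  | .log, u => Real.log u
  | .cos, u => Real.cos u

/-- The effect of an elementary instruction: a probability distribution on memories, which is
a point mass except for `rand`. -/
def Instr.exec : Instr → Mem → PMF Mem
  | .setNat dst c, M => PMF.pure (M.setInt dst c)
  | .natOp op dst a b, M => PMF.pure (M.setInt dst (op.eval (M.getInt a) (M.getInt b)))
  | .realOp op dst a b, M => PMF.pure (M.setReal dst (op.eval (M.getReal a) (M.getReal b)))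
  | .realFun f dst a, M => PMF.pure (M.setReal dst (f.eval (M.getReal a)))
  | .cast dst a, M => PMF.pure (M.setReal dst (M.getInt a : ℝ))
  | .floor dst a, M => PMF.pure (M.setInt dst ⌊M.getReal a⌋₊)
  | .rand dst a, M =>
      (PMF.uniformOfFintype (Fin (M.getInt a + 1))).map (fun v => M.setInt dst (v : ℕ))

def Test.holds : Test → Mem → Prop
  | .natLt a b, M => M.getInt a < M.getInt b
  | .realLt a b, M => M.getReal a < M.getReal b

/-- A configuration: the stack of commands still to be executed, and the memory.  The machine has
halted when the stack is empty. -/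
abbrev Config := List Cmd × Mem

open Classical in
/-- One computation step. -/
def step : Config → PMF Config
  | ([], M) => PMF.pure ([], M)
  | (.instr i :: K, M) => (i.exec M).map (fun M' => (K, M'))
  | (.seq c₁ c₂ :: K, M) => PMF.pure (c₁ :: c₂ :: K, M)
  | (.ite b c₁ c₂ :: K, M) => PMF.pure (if b.holds M then c₁ :: K else c₂ :: K, M)
  | (.while b c :: K, M) => PMF.pure (if b.holds M then c :: .while b c :: K else K, M)

/-- The distribution of the configuration after `t` steps. -/
def steps : ℕ → Config → PMF Config
  | 0, s => PMF.pure s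
  | t + 1, s => (step s).bind (steps t)

/-- Started on the memory `M`, the program `c` halts within `t` steps, whatever the outcomes of
its random choices. -/
def Cmd.HaltsIn (c : Cmd) (M : Mem) (t : ℕ) : Prop :=
  ∀ s ∈ (steps t ([c], M)).support, s.1 = []

/-- The distribution of the memory after running the program `c` for `t` steps (a machine that
has halted stays as it is). -/
def Cmd.run (c : Cmd) (t : ℕ) (M : Mem) : PMF Mem :=
  (steps t ([c], M)).map Prod.snd

end RealRAM

open RealRAM

/-! ## Nice kernels -/

/-- The kernel matrix `K i j = k (x i) (x j)`. -/
def kernelMatrix {E : Type*} (k : E → E → ℝ) {n : ℕ} (x : Fin n → E) :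
    Matrix (Fin n) (Fin n) ℝ :=
  Matrix.of fun i j => k (x i) (x j)

/-- A nice kernel: values in `[0, 1]`, positive definite (all its kernel matrices are symmetric
positive semidefinite), and equal to `1` on the diagonal. -/
structure IsNiceKernel {E : Type*} (k : E → E → ℝ) : Prop where
  mem_Icc : ∀ x y, k x y ∈ Set.Icc (0 : ℝ) 1
  posDef : ∀ (n : ℕ) (x : Fin n → E), (kernelMatrix k x).PosSemidef
  diag : ∀ x, k x x = 1

/-- The largest eigenvalue of a real symmetric matrix. -/
def topEigenvalue {n : ℕ} (A : Matrix (Fin n) (Fin n) ℝ) : ℝ := sSup (spectrum ℝ A)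

/-! ## Fast kernel density evaluation -/

/-- The kernel density `(1 / m) ∑ i, k y (X i)`. -/
def kernelDensity {E : Type*} (k : E → E → ℝ) {m : ℕ} (X : Fin m → E) (y : E) : ℝ :=
  (1 / (m : ℝ)) * ∑ i, k y (X i)

/-- The points `x 0, …, x (n - 1)` of `ℝ^d`, stored one after the other in an array that is zero
elsewhere. -/
def flatten {n d : ℕ} (x : Fin n → Fin d → ℝ) (a : ℕ) : ℝ :=
  if h : a < n * d then
    x (finProdFinEquiv.symm ⟨a, h⟩).1 (finProdFinEquiv.symm ⟨a, h⟩).2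
  else 0

/-- The initial memory on an instance with `n` points in `ℝ^d` and real parameters `ε`, `μ`:
integer arrays `0`, `1` hold `n`, `d`; real array `0` holds `ε`, `μ`; real array `1` holds the
coordinates of the points; all other cells are zero. -/
def inputMem {n d : ℕ} (x : Fin n → Fin d → ℝ) (ε μ : ℝ) : Mem where
  int a i := if i = 0 then (if a = 0 then n else if a = 1 then d else 0) else 0
  real a i :=
    if a = 0 then (if i = 0 then ε else if i = 1 then μ else 0)
    else if a = 1 then flatten x i
    else 0

/-- Write the coordinates of a query point to the first `d` cells of real array `2`. -/
def writeQuery {d : ℕ} (y : Fin d → ℝ) (M : Mem) : Mem :=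
  { M with real := fun a i => if h : a = 2 ∧ i < d then y ⟨i, h.2⟩ else M.real a i }

/-- The distribution of the memory after the queries `ys` have been asked one after the other,
each of them answered by running the program `query` for `t` steps. -/
def runQueries {d : ℕ} (query : Cmd) (t : ℕ) (M : PMF Mem) (ys : List (Fin d → ℝ)) : PMF Mem :=
  ys.foldl (fun D y => D.bind fun M' => query.run t (writeQuery y M')) M

/-- The kernels `k d` on `ℝ^d`, for the dimensions `d ∈ D`, admit an `O(d m / (μ^p ε²))` time KDE
algorithm: there are a program `prep` that processes `m` points `X` in `O(d m / (μ^p ε²))` time,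
and a program `query` that answers any query, after any history `ys` of earlier queries, in
`O(d / (μ^p ε²))` time, such that the answer (found in cell `0` of real array `3`) to a query
point of density at least `μ` has relative error at most `ε` with probability at least `2/3`. -/
def AdmitsFastKDE (D : Set ℕ) (k : (d : ℕ) → (Fin d → ℝ) → (Fin d → ℝ) → ℝ) (p : ℝ) : Prop :=
  ∃ (prep query : Cmd) (C : ℝ), ∀ d ∈ D, ∀ (m : ℕ) (X : Fin m → Fin d → ℝ) (ε μ : ℝ),
    1 ≤ m → 0 < ε → ε < 1 → 0 < μ → μ ≤ 1 →
    let tPrep : ℕ := ⌊C * (d * m / (μ ^ p * ε ^ 2))⌋₊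
    let tQuery : ℕ := ⌊C * (d / (μ ^ p * ε ^ 2))⌋₊
    let after : List (Fin d → ℝ) → PMF Mem :=
      runQueries query tQuery (prep.run tPrep (inputMem X ε μ))
    prep.HaltsIn (inputMem X ε μ) tPrep ∧
    ∀ (ys : List (Fin d → ℝ)) (y : Fin d → ℝ),
      (∀ M ∈ (after ys).support, query.HaltsIn (writeQuery y M) tQuery) ∧
      (μ ≤ kernelDensity (k d) X y →
        (2 / 3 : ℝ≥0∞) ≤ (after (ys ++ [y])).toOuterMeasure
          {M | |M.real 3 0 - kernelDensity (k d) X y| ≤ ε * kernelDensity (k d) X y})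

/-! ## The running time of the eigenvector algorithm and its output -/

/-- The quantity `d n^(1+p) log(n/ε)^(2+p) / ε^(7+4p)`. -/
def eigenvectorTime (p : ℝ) (n d : ℕ) (ε : ℝ) : ℝ :=
  d * (n : ℝ) ^ (1 + p) * Real.log (n / ε) ^ (2 + p) / ε ^ (7 + 4 * p)

/-- The vector in the first `n` cells of real array `2`. -/
def outputVector (n : ℕ) (M : Mem) : EuclideanSpace ℝ (Fin n) :=
  WithLp.toLp 2 fun i => M.real 2 i

end

open scoped ENNReal

noncomputable section

namespace RealRAM

/-! ### Expectations of nonnegative functions -/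

/-! The algorithm is a power method in which every matrix-vector product is estimated by density
queries. Its errors are multiplicative up to a small rounding term, so no eigenvalue gap is needed.
Write K for the kernel matrix, λ for its top eigenvalue, E = ε/256 and F = √n/E.

Products from densities. A nonnegative unit vector z is rounded to positive integer weights w with F
z ≤ w ≤ F z + 1. The multiset containing x_i exactly w_i times has m ≤ n/E + n points
(`sum_weight_le`), and its density at x_l is (Kw)_l / m. This is at least 1/m because K has unit
diagonal and w_l ≥ 1. Hence the KDE algorithm with μ = 1/m and accuracy E applies at every x_l.

Progress. Taking absolute values in a top eigenvector gives a unit vector u ≥ 0 with λu ≤ Ku, since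
K has nonnegative entries. Let y agree with Kw up to factors 1 ± η, where η = 8E. If ‖y‖ ≤ (1 -
2η)λF, then replacing z by y/‖y‖ multiplies ⟨u, z⟩ by at least 1 + η (`PowerState.step`). This inner
product starts at 1/√n or more and never exceeds 1, so within about log(n/ε)/E iterations some ‖y‖
reaches (1 - 2η)λF. The z that produced the longest y has ‖Kz‖ ≥ (1 - 32E)λ, and positive
semidefiniteness gives ‖Kz‖² ≤ λ zᵀKz (`mulVec_sq_le`). So zᵀKz ≥ (1 - ε)λ (`PowerState.rayleigh`).

Confidence. An answer is good only with probability 2/3, and answers from one data structure may be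
dependent. Each iteration therefore builds r data structures, with r of order log(n/ε), each in
unused memory. For every point a majority vote over logarithmic buckets plays the role of the median
of the answers (`bucket_good`, `Vote.result`). The potential (4/9)^(good votes) yields a Chernoff
bound (17/18)^r per point (`wp_queryCopies`). A union bound covers the points and the iterations. It
is taken conditionally on the memory at the start of each iteration, so the dependence of later
vectors on earlier answers does no harm (`wp_iterations`).

Machine level. `wp` is an expectation transformer with value ⊤ unless the machine surely halts
within its budget, so one finite upper bound proves both termination and the probability estimate.
The KDE programs are black boxes that may touch arbitrary addresses. They are run in interleaved
copies of the memory with a slowdown of 32 (`wp_reloc`). -/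

/-- The expectation of `g` under `p`. -/
def expect {α : Type*} (p : PMF α) (g : α → ℝ≥0∞) : ℝ≥0∞ := ∑' a, p a * g a

section expect
variable {α β : Type*}

theorem expect_pure (a : α) (g : α → ℝ≥0∞) : expect (PMF.pure a) g = g a := by
  unfold expect
  rw [tsum_eq_single a]
  · simp
  · intro b hb; simp [PMF.pure_apply, hb]

theorem expect_bind (p : PMF α) (q : α → PMF β) (g : β → ℝ≥0∞) :
    expect (p.bind q) g = expect p fun a => expect (q a) g := by
  unfold expect
  simp only [PMF.bind_apply, ← ENNReal.tsum_mul_right, ← ENNReal.tsum_mul_left]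
  rw [ENNReal.tsum_comm]
  simp only [mul_assoc]

theorem expect_map (p : PMF α) (h : α → β) (g : β → ℝ≥0∞) :
    expect (p.map h) g = expect p fun a => g (h a) := by
  unfold PMF.map
  rw [expect_bind]
  simp [expect_pure]

theorem expect_mono_support {p : PMF α} {g h : α → ℝ≥0∞} (H : ∀ a ∈ p.support, g a ≤ h a) :
    expect p g ≤ expect p h := by
  refine ENNReal.tsum_le_tsum fun a => ?_
  by_cases ha : p a = 0
  · simp [ha]
  · gcongr
    exact H a ((p.mem_support_iff a).2 ha)

theorem expect_mono {p : PMF α} {g h : α → ℝ≥0∞} (H : ∀ a, g a ≤ h a) :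
    expect p g ≤ expect p h := expect_mono_support fun a _ => H a

theorem expect_const (p : PMF α) (v : ℝ≥0∞) : expect p (fun _ => v) = v := by
  unfold expect
  rw [ENNReal.tsum_mul_right, p.tsum_coe, one_mul]

theorem expect_mul_left (p : PMF α) (v : ℝ≥0∞) (g : α → ℝ≥0∞) :
    expect p (fun a => v * g a) = v * expect p g := by
  unfold expect
  rw [← ENNReal.tsum_mul_left]
  congr 1; ext a; ring

theorem expect_sum {ι : Type*} (s : Finset ι) (p : PMF α) (g : ι → α → ℝ≥0∞) :
    expect p (fun a => ∑ l ∈ s, g l a) = ∑ l ∈ s, expect p (g l) := by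
  classical
  induction s using Finset.induction_on with
  | empty => simp [expect]
  | insert i s hi ih =>
    simp only [Finset.sum_insert hi]
    rw [← ih]
    unfold expect
    rw [← ENNReal.tsum_add]
    simp only [mul_add]

theorem ne_top_of_expect_ne_top {p : PMF α} {g : α → ℝ≥0∞} (H : expect p g ≠ ⊤) {a : α}
    (ha : a ∈ p.support) : g a ≠ ⊤ := by
  intro h
  apply H
  rw [← top_le_iff]
  calc (⊤ : ℝ≥0∞) = p a * g a := by
        rw [h, ENNReal.mul_top]; exact (p.mem_support_iff a).1 ha
    _ ≤ expect p g := ENNReal.le_tsum a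

open Classical in
theorem toOuterMeasure_eq_expect (p : PMF α) (s : Set α) :
    p.toOuterMeasure s = expect p fun a => if a ∈ s then 1 else 0 := by
  rw [PMF.toOuterMeasure_apply]
  unfold expect
  congr 1; ext a
  by_cases h : a ∈ s <;> simp [h]

end expect

/-! ### Expected values at halting -/

/-- The expected value of `f` in the final memory; `⊤` unless the machine surely halts within `t`
steps. -/
def wp (f : Mem → ℝ≥0∞) : ℕ → Config → ℝ≥0∞
  | 0, ([], M) => f M
  | 0, (_ :: _, _) => ⊤
  | _ + 1, ([], M) => f M
  | t + 1, (c :: K, M) => expect (step (c :: K, M)) (wp f t)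

@[simp] theorem wp_nil (f : Mem → ℝ≥0∞) (t : ℕ) (M : Mem) : wp f t ([], M) = f M := by
  cases t <;> simp [wp]

theorem wp_zero_cons (f : Mem → ℝ≥0∞) (c : Cmd) (K : List Cmd) (M : Mem) :
    wp f 0 (c :: K, M) = ⊤ := by simp [wp]

theorem wp_succ (f : Mem → ℝ≥0∞) (t : ℕ) (s : Config) :
    wp f (t + 1) s = expect (step s) (wp f t) := by
  obtain ⟨K, M⟩ := s
  cases K with
  | nil => simp [step, expect_pure]
  | cons c K => simp [wp]

/-- A halted machine stays as it is, and an exhausted budget already costs ⊤, so extra steps can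
only lower the value. -/
theorem wp_succ_le (f : Mem → ℝ≥0∞) (t : ℕ) (s : Config) : wp f (t + 1) s ≤ wp f t s := by
  induction t generalizing s with
  | zero =>
    obtain ⟨K, M⟩ := s
    cases K with
    | nil => simp
    | cons c K => simp [wp_zero_cons]
  | succ t ih =>
    rw [wp_succ, wp_succ f t]
    exact expect_mono ih

theorem wp_anti (f : Mem → ℝ≥0∞) {t u : ℕ} (h : t ≤ u) (s : Config) : wp f u s ≤ wp f t s := by
  induction h with
  | refl => exact le_rfl
  | step _ ih => exact (wp_succ_le f _ s).trans ih

theorem wp_mono {f g : Mem → ℝ≥0∞} (h : ∀ M, f M ≤ g M) (t : ℕ) (s : Config) :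
    wp f t s ≤ wp g t s := by
  induction t generalizing s with
  | zero =>
    obtain ⟨K, M⟩ := s
    cases K with
    | nil => simpa using h M
    | cons c K => simp [wp_zero_cons]
  | succ t ih => rw [wp_succ, wp_succ]; exact expect_mono ih

/-- This is the form in which union bounds pass through a program. An empty sum must be excluded: it
is 0, while a run that does not halt has value ⊤ for every postcondition. -/
theorem wp_sum {ι : Type*} (s : Finset ι) (hs : s.Nonempty) (f : ι → Mem → ℝ≥0∞) (t : ℕ)
    (S : Config) : wp (fun M => ∑ l ∈ s, f l M) t S = ∑ l ∈ s, wp (f l) t S := by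
  induction t generalizing S with
  | zero =>
    obtain ⟨K, M⟩ := S
    cases K with
    | nil => simp
    | cons c K =>
      simp only [wp_zero_cons]
      obtain ⟨i, hi⟩ := hs
      symm
      rw [ENNReal.sum_eq_top]
      exact ⟨i, hi, rfl⟩
  | succ t ih =>
    simp only [wp_succ]
    rw [← expect_sum]
    congr 1
    ext S
    exact ih S

/-- The factor must not vanish because 0 * ⊤ = 0, which would hide a run that does not halt. -/
theorem wp_mul_left {a : ℝ≥0∞} (ha : a ≠ 0) (f : Mem → ℝ≥0∞) (t : ℕ) (S : Config) :
    wp (fun M => a * f M) t S = a * wp f t S := by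
  induction t generalizing S with
  | zero =>
    obtain ⟨K, M⟩ := S
    cases K with
    | nil => simp
    | cons c K => simp [wp_zero_cons, ENNReal.mul_top ha]
  | succ t ih =>
    rw [wp_succ, wp_succ, ← expect_mul_left]
    congr 1
    funext S
    exact ih S

theorem step_append (c : Cmd) (S K : List Cmd) (M : Mem) :
    step (c :: S ++ K, M) = (step (c :: S, M)).map fun s => (s.1 ++ K, s.2) := by
  cases c with
  | instr i => simp [step, PMF.map_comp, Function.comp_def]
  | seq c₁ c₂ => simp [step, PMF.pure_map]
  | ite b c₁ c₂ => by_cases h : b.holds M <;> simp [step, PMF.pure_map, h]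
  | _ b c => by_cases h : b.holds M <;> simp [step, PMF.pure_map, h]

/-- Only an inequality, since the first stack may finish early and leave unused steps to the second.
-/
theorem wp_append (f : Mem → ℝ≥0∞) (t u : ℕ) (S K : List Cmd) (M : Mem) :
    wp f (t + u) (S ++ K, M) ≤ wp (fun M' => wp f u (K, M')) t (S, M) := by
  induction t generalizing S M with
  | zero =>
    cases S with
    | nil => simp
    | cons c S => simp [wp_zero_cons]
  | succ t ih =>
    cases S with
    | nil => simpa using wp_anti f (by omega) _
    | cons c S =>
      rw [show t + 1 + u = (t + u) + 1 by ring, wp_succ, wp_succ, step_append, expect_map]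
      exact expect_mono fun s => ih s.1 s.2

/-- The expected value of `f` after running `c`. -/
abbrev Cmd.wp (c : Cmd) (t : ℕ) (f : Mem → ℝ≥0∞) (M : Mem) : ℝ≥0∞ := RealRAM.wp f t ([c], M)

theorem wp_cons (f : Mem → ℝ≥0∞) (t u : ℕ) (c : Cmd) (K : List Cmd) (M : Mem) :
    wp f (t + u) (c :: K, M) ≤ c.wp t (fun M' => wp f u (K, M')) M :=
  wp_append f t u [c] K M

theorem wp_seq (c₁ c₂ : Cmd) (t₁ t₂ : ℕ) (f : Mem → ℝ≥0∞) (M : Mem) :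
    (Cmd.seq c₁ c₂).wp (t₁ + t₂ + 1) f M ≤ c₁.wp t₁ (c₂.wp t₂ f) M := by
  unfold Cmd.wp
  rw [wp_succ]
  simp only [step, expect_pure]
  exact wp_cons f t₁ t₂ c₁ [c₂] M

theorem wp_ite_true {b : Test} {M : Mem} (h : b.holds M) (c₁ c₂ : Cmd) (t : ℕ)
    (f : Mem → ℝ≥0∞) : (Cmd.ite b c₁ c₂).wp (t + 1) f M = c₁.wp t f M := by
  unfold Cmd.wp
  rw [wp_succ]
  simp [step, expect_pure, h]

theorem wp_ite_false {b : Test} {M : Mem} (h : ¬ b.holds M) (c₁ c₂ : Cmd) (t : ℕ)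
    (f : Mem → ℝ≥0∞) : (Cmd.ite b c₁ c₂).wp (t + 1) f M = c₂.wp t f M := by
  unfold Cmd.wp
  rw [wp_succ]
  simp [step, expect_pure, h]

theorem wp_instr (i : Instr) (M : Mem) (t : ℕ) (f : Mem → ℝ≥0∞) :
    (Cmd.instr i).wp (t + 1) f M = expect (i.exec M) f := by
  unfold Cmd.wp
  rw [wp_succ]
  simp only [step, expect_map]
  simp

/-! ### Connection with the semantics -/

theorem wp_eq_expect {f : Mem → ℝ≥0∞} {t : ℕ} {s : Config}
    (h : ∀ s' ∈ (steps t s).support, s'.1 = []) :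
    wp f t s = expect (steps t s) fun s' => f s'.2 := by
  induction t generalizing s with
  | zero =>
    obtain ⟨K, M⟩ := s
    have : K = [] := h (K, M) (by simp [steps])
    subst this
    simp [steps, expect_pure]
  | succ t ih =>
    rw [wp_succ]
    simp only [steps, expect_bind]
    have : ∀ s' ∈ (step s).support,
        wp f t s' = expect (steps t s') fun s' => f s'.2 := fun s' hs' => by
      apply ih
      intro s'' hs''
      apply h
      simp only [steps, PMF.mem_support_bind_iff]
      exact ⟨s', hs', hs''⟩
    exact le_antisymm (expect_mono_support fun s' hs' => (this s' hs').le)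
      (expect_mono_support fun s' hs' => (this s' hs').ge)

/-- A reachable configuration that has not halted carries positive mass and contributes ⊤ to the
expectation. Finiteness for any one postcondition therefore proves sure termination. -/
theorem halted_of_wp_ne_top {f : Mem → ℝ≥0∞} {t : ℕ} {s : Config} (h : wp f t s ≠ ⊤) :
    ∀ s' ∈ (steps t s).support, s'.1 = [] := by
  induction t generalizing s with
  | zero =>
    obtain ⟨K, M⟩ := s
    cases K with
    | nil => simp [steps]
    | cons c K => simp [wp_zero_cons] at h
  | succ t ih =>
    rw [wp_succ] at h
    simp only [steps, PMF.mem_support_bind_iff]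
    rintro s'' ⟨s', hs', hs''⟩
    exact ih (ne_top_of_expect_ne_top h hs') s'' hs''

theorem haltsIn_of_wp_ne_top {f : Mem → ℝ≥0∞} {t : ℕ} {c : Cmd} {M : Mem}
    (h : c.wp t f M ≠ ⊤) : c.HaltsIn M t := halted_of_wp_ne_top h

theorem Cmd.HaltsIn.wp_eq {f : Mem → ℝ≥0∞} {t : ℕ} {c : Cmd} {M : Mem} (h : c.HaltsIn M t) :
    c.wp t f M = expect (c.run t M) f := by
  unfold Cmd.run Cmd.wp
  rw [expect_map, wp_eq_expect h]

/-! ### Sure postconditions -/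

/-- Started on `M`, the program `c` surely halts within `t` steps, in a memory satisfying `Q`. -/
def Sure (c : Cmd) (t : ℕ) (M : Mem) (Q : Mem → Prop) : Prop :=
  ∀ (f : Mem → ℝ≥0∞) (v : ℝ≥0∞), (∀ M', Q M' → f M' ≤ v) → c.wp t f M ≤ v

theorem Sure.weaken {c : Cmd} {t u : ℕ} {M : Mem} {Q R : Mem → Prop} (h : Sure c t M Q)
    (htu : t ≤ u) (hQ : ∀ M', Q M' → R M') : Sure c u M R := fun f v hf =>
  (wp_anti f htu _).trans (h f v fun M' hM' => hf M' (hQ M' hM'))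

theorem Sure.mono {c : Cmd} {t : ℕ} {M : Mem} {Q R : Mem → Prop} (h : Sure c t M Q)
    (hQ : ∀ M', Q M' → R M') : Sure c t M R := h.weaken le_rfl hQ

theorem Sure.wp_seq {c₁ c₂ : Cmd} {t₁ t₂ : ℕ} {M : Mem} {Q : Mem → Prop} {f : Mem → ℝ≥0∞}
    {v : ℝ≥0∞} (h₁ : Sure c₁ t₁ M Q) (h₂ : ∀ M', Q M' → c₂.wp t₂ f M' ≤ v) :
    (Cmd.seq c₁ c₂).wp (t₁ + t₂ + 1) f M ≤ v :=
  (RealRAM.wp_seq c₁ c₂ t₁ t₂ f M).trans (h₁ _ _ h₂)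

theorem Sure.seq {c₁ c₂ : Cmd} {t₁ t₂ : ℕ} {M : Mem} {Q R : Mem → Prop}
    (h₁ : Sure c₁ t₁ M Q) (h₂ : ∀ M', Q M' → Sure c₂ t₂ M' R) :
    Sure (Cmd.seq c₁ c₂) (t₁ + t₂ + 1) M R := fun f v hf =>
  h₁.wp_seq fun M' hM' => h₂ M' hM' f v hf

theorem wp_seq_sure {c₁ c₂ : Cmd} {t₁ t₂ : ℕ} {M : Mem} {f g : Mem → ℝ≥0∞} {v : ℝ≥0∞}
    (h₁ : c₁.wp t₁ g M ≤ v) (h₂ : ∀ M', c₂.wp t₂ f M' ≤ g M') :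
    (Cmd.seq c₁ c₂).wp (t₁ + t₂ + 1) f M ≤ v :=
  (RealRAM.wp_seq c₁ c₂ t₁ t₂ f M).trans ((wp_mono h₂ _ _).trans h₁)

theorem sure_ite {b : Test} {c₁ c₂ : Cmd} {t : ℕ} {M : Mem} {Q : Mem → Prop}
    (h₁ : b.holds M → Sure c₁ t M Q) (h₂ : ¬ b.holds M → Sure c₂ t M Q) :
    Sure (Cmd.ite b c₁ c₂) (t + 1) M Q := fun f v hf => by
  by_cases h : b.holds M
  · rw [wp_ite_true h]; exact h₁ h f v hf
  · rw [wp_ite_false h]; exact h₂ h f v hf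

/-! ### Blocks of deterministic instructions -/

/-- The effect of an instruction that draws no random number. -/
def Instr.effect : Instr → Mem → Mem
  | .setNat dst c, M => M.setInt dst c
  | .natOp op dst a b, M => M.setInt dst (op.eval (M.getInt a) (M.getInt b))
  | .realOp op dst a b, M => M.setReal dst (op.eval (M.getReal a) (M.getReal b))
  | .realFun f dst a, M => M.setReal dst (f.eval (M.getReal a))
  | .cast dst a, M => M.setReal dst (M.getInt a : ℝ)
  | .floor dst a, M => M.setInt dst ⌊M.getReal a⌋₊
  | .rand _ _, M => M

/-- The instruction draws no random number. -/
def Instr.IsDet : Instr → Prop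
  | .rand _ _ => False
  | _ => True

theorem Instr.exec_eq {i : Instr} (h : i.IsDet) (M : Mem) : i.exec M = PMF.pure (i.effect M) := by
  cases i <;> first | rfl | exact h.elim

/-- A nonempty sequence of instructions. -/
def block : Instr → List Instr → Cmd
  | i, [] => .instr i
  | i, j :: l => .seq (.instr i) (block j l)

theorem sure_instr {i : Instr} (h : i.IsDet) (M : Mem) :
    Sure (.instr i) 1 M (· = i.effect M) := fun f v hf => by
  rw [wp_instr, Instr.exec_eq h, expect_pure]
  exact hf _ rfl

theorem sure_block (i : Instr) (l : List Instr) (h : ∀ j ∈ i :: l, j.IsDet) (M : Mem) :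
    Sure (block i l) (2 * l.length + 1) M (· = (i :: l).foldl (fun M j => j.effect M) M) := by
  induction l generalizing i M with
  | nil => simpa [block] using sure_instr (h i (by simp)) M
  | cons j l ih =>
    have := Sure.seq (sure_instr (h i (by simp)) M) (c₂ := block j l) (t₂ := 2 * l.length + 1)
      (R := (· = (i :: j :: l).foldl (fun M j => j.effect M) M)) (fun M' hM' => by
        subst hM'
        exact ih j (fun k hk => h k (List.mem_cons_of_mem _ hk)) _)
    exact this.weaken (by simp; omega) fun _ h => h

/-! ### Frames -/

/-- The integer array written by an instruction, if any. -/
def Instr.intDst : Instr → Option ℕ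
  | .setNat dst _ | .natOp _ dst _ _ | .floor dst _ | .rand dst _ => some dst.arr
  | .realOp _ _ _ _ | .realFun _ _ _ | .cast _ _ => none

/-- The real array written by an instruction, if any. -/
def Instr.realDst : Instr → Option ℕ
  | .setNat _ _ | .natOp _ _ _ _ | .floor _ _ | .rand _ _ => none
  | .realOp _ dst _ _ | .realFun _ dst _ | .cast dst _ => some dst.arr

/-- The program contains an instruction that writes to the integer array `a`. -/
def Cmd.WritesInt : Cmd → ℕ → Prop
  | .instr i, a => i.intDst = some a
  | .seq c₁ c₂, a | .ite _ c₁ c₂, a => c₁.WritesInt a ∨ c₂.WritesInt a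
  | .while _ c, a => c.WritesInt a

/-- The program contains an instruction that writes to the real array `a`. -/
def Cmd.WritesReal : Cmd → ℕ → Prop
  | .instr i, a => i.realDst = some a
  | .seq c₁ c₂, a | .ite _ c₁ c₂, a => c₁.WritesReal a ∨ c₂.WritesReal a
  | .while _ c, a => c.WritesReal a

theorem setInt_int (M : Mem) (r : Ref) (v a i : ℕ) :
    (M.setInt r v).int a i = if a = r.arr ∧ i = M.index r.idx then v else M.int a i := by
  unfold Mem.setInt
  by_cases h : a = r.arr
  · subst h
    by_cases h : i = M.index r.idx <;> simp [Function.update, h]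
  · simp [Function.update, h]

@[simp] theorem setInt_real (M : Mem) (r : Ref) (v : ℕ) : (M.setInt r v).real = M.real := rfl

@[simp] theorem setReal_int (M : Mem) (r : Ref) (v : ℝ) : (M.setReal r v).int = M.int := rfl

theorem setReal_real (M : Mem) (r : Ref) (v : ℝ) (a i : ℕ) :
    (M.setReal r v).real a i = if a = r.arr ∧ i = M.index r.idx then v else M.real a i := by
  unfold Mem.setReal
  by_cases h : a = r.arr
  · subst h
    by_cases h : i = M.index r.idx <;> simp [Function.update, h]
  · simp [Function.update, h]

/-- The memories agree outside the integer arrays `A` and the real arrays `B`. -/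
def EqOff (A B : ℕ → Prop) (M M' : Mem) : Prop :=
  (∀ a, ¬ A a → ∀ i, M'.int a i = M.int a i) ∧ ∀ a, ¬ B a → ∀ i, M'.real a i = M.real a i

theorem EqOff.refl (A B : ℕ → Prop) (M : Mem) : EqOff A B M M :=
  ⟨fun _ _ _ => rfl, fun _ _ _ => rfl⟩

theorem EqOff.trans {A B : ℕ → Prop} {M M' M'' : Mem} (h : EqOff A B M M')
    (h' : EqOff A B M' M'') : EqOff A B M M'' :=
  ⟨fun a ha i => (h'.1 a ha i).trans (h.1 a ha i), fun a ha i => (h'.2 a ha i).trans (h.2 a ha i)⟩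

theorem eqOff_setInt {A B : ℕ → Prop} {r : Ref} (h : A r.arr) (M : Mem) (v : ℕ) :
    EqOff A B M (M.setInt r v) :=
  ⟨fun a ha i => by rw [setInt_int, if_neg]; rintro ⟨rfl, -⟩; exact ha h, fun _ _ _ => rfl⟩

theorem eqOff_setReal {A B : ℕ → Prop} {r : Ref} (h : B r.arr) (M : Mem) (v : ℝ) :
    EqOff A B M (M.setReal r v) :=
  ⟨fun _ _ _ => rfl, fun a ha i => by rw [setReal_real, if_neg]; rintro ⟨rfl, -⟩; exact ha h⟩

theorem eqOff_exec {A B : ℕ → Prop} {i : Instr} (hA : ∀ a, i.intDst = some a → A a)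
    (hB : ∀ a, i.realDst = some a → B a) {M M' : Mem} (h : M' ∈ (i.exec M).support) :
    EqOff A B M M' := by
  cases i with
  | rand dst a =>
    simp only [Instr.exec, PMF.mem_support_map_iff] at h
    obtain ⟨v, -, rfl⟩ := h
    exact eqOff_setInt (hA _ rfl) _ _
  | setNat | natOp | floor =>
    simp only [Instr.exec, PMF.support_pure, Set.mem_singleton_iff] at h
    subst h
    exact eqOff_setInt (hA _ rfl) _ _
  | realOp | realFun | cast =>
    simp only [Instr.exec, PMF.support_pure, Set.mem_singleton_iff] at h
    subst h
    exact eqOff_setReal (hB _ rfl) _ _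

open Classical in
-- Memories that break the frame are unreachable, so the postcondition may be replaced by 0 there.
-- Upper bounds then need checking only on memories that agree with the start outside the written
-- arrays.
theorem wp_frame {A B : ℕ → Prop} (f : Mem → ℝ≥0∞) (t : ℕ) (M₀ : Mem) (S : List Cmd)
    (hA : ∀ c ∈ S, ∀ a, c.WritesInt a → A a) (hB : ∀ c ∈ S, ∀ a, c.WritesReal a → B a)
    (M : Mem) (hM : EqOff A B M₀ M) :
    wp f t (S, M) ≤ wp (fun M' => if EqOff A B M₀ M' then f M' else 0) t (S, M) := by
  induction t generalizing S M with
  | zero =>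
    cases S with
    | nil => simp [hM]
    | cons c S => simp [wp_zero_cons]
  | succ t ih =>
    cases S with
    | nil => simp [hM]
    | cons c S =>
      rw [wp_succ, wp_succ]
      have hA' := fun c' hc' => hA c' (List.mem_cons_of_mem c hc')
      have hB' := fun c' hc' => hB c' (List.mem_cons_of_mem c hc')
      have hAc := hA c (List.mem_cons_self)
      have hBc := hB c (List.mem_cons_self)
      cases c with
      | instr i =>
        simp only [step, expect_map]
        exact expect_mono_support fun M' hM' =>
          ih S hA' hB' M' (hM.trans (eqOff_exec hAc hBc hM'))
      | seq c₁ c₂ =>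
        simp only [step, expect_pure]
        refine ih _ ?_ ?_ M hM
        · simp only [List.mem_cons, forall_eq_or_imp]
          exact ⟨fun a h => hAc a (Or.inl h), fun a h => hAc a (Or.inr h), hA'⟩
        · simp only [List.mem_cons, forall_eq_or_imp]
          exact ⟨fun a h => hBc a (Or.inl h), fun a h => hBc a (Or.inr h), hB'⟩
      | ite b c₁ c₂ =>
        simp only [step, expect_pure]
        refine ih _ ?_ ?_ M hM
        · split_ifs <;> simp only [List.mem_cons, forall_eq_or_imp]
          exacts [⟨fun a h => hAc a (Or.inl h), hA'⟩, ⟨fun a h => hAc a (Or.inr h), hA'⟩]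
        · split_ifs <;> simp only [List.mem_cons, forall_eq_or_imp]
          exacts [⟨fun a h => hBc a (Or.inl h), hB'⟩, ⟨fun a h => hBc a (Or.inr h), hB'⟩]
      | _ b c =>
        simp only [step, expect_pure]
        refine ih _ ?_ ?_ M hM
        · split_ifs
          · simp only [List.mem_cons, forall_eq_or_imp]
            exact ⟨fun a h => hAc a h, fun a h => hAc a h, hA'⟩
          · exact hA'
        · split_ifs
          · simp only [List.mem_cons, forall_eq_or_imp]
            exact ⟨fun a h => hBc a h, fun a h => hBc a h, hB'⟩
          · exact hB'

open Classical in
theorem Cmd.wp_frame (c : Cmd) (t : ℕ) (f : Mem → ℝ≥0∞) (M : Mem) :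
    c.wp t f M ≤ c.wp t (fun M' => if EqOff c.WritesInt c.WritesReal M M' then f M' else 0) M :=
  RealRAM.wp_frame f t M [c] (by simp) (by simp) M (EqOff.refl _ _ _)

theorem Sure.frame {c : Cmd} {t : ℕ} {M : Mem} {Q : Mem → Prop} (h : Sure c t M Q) :
    Sure c t M fun M' => Q M' ∧ EqOff c.WritesInt c.WritesReal M M' := fun f v hf => by
  classical
  refine (c.wp_frame t f M).trans (h _ v fun M' hM' => ?_)
  by_cases H : EqOff c.WritesInt c.WritesReal M M'
  · simpa [H] using hf M' ⟨hM', H⟩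
  · simp [H]

/-! ### Counting loops -/

/-- `for i = 0, …, n - 1 do c`, where `i` and `n` are integer variables; the integer variable `3`
holds `1`. -/
def forLoop (i n : ℕ) (c : Cmd) : Cmd :=
  .seq (.instr (.setNat ⟨i, .const 0⟩ 0))
    (.while (.natLt ⟨i, .const 0⟩ ⟨n, .const 0⟩)
      (.seq c (.instr (.natOp .add ⟨i, .const 0⟩ ⟨i, .const 0⟩ ⟨3, .const 0⟩))))

/-- The memory in which the integer variable `i` has been set to `v`. -/
abbrev Mem.setVar (M : Mem) (i v : ℕ) : Mem := M.setInt ⟨i, .const 0⟩ v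

/-- `F` is a potential that does not grow in expectation during a round; it is evaluated after the
counter has been advanced. A round costs 3 extra steps (test, unfolding of the sequence, increment).
Another 3 pay for the outer sequence, the initialization and the last, failing test. The frame rule
keeps the counter and the bound intact across the body. -/
theorem wp_forLoop {i n : ℕ} {c : Cmd} (hi : ¬ c.WritesInt i) (hn : ¬ c.WritesInt n)
    (h3 : ¬ c.WritesInt 3) (hin : n ≠ i) (hi3 : 3 ≠ i) (N : ℕ) (τ : ℕ → ℕ)
    (F : ℕ → Mem → ℝ≥0∞)
    (hF : ∀ j < N, ∀ M : Mem, M.int i 0 = j → M.int n 0 = N → M.int 3 0 = 1 →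
      c.wp (τ j) (fun M' => F (j + 1) (M'.setVar i (j + 1))) M ≤ F j M)
    (M : Mem) (hM : M.int n 0 = N) (hM3 : M.int 3 0 = 1) :
    (forLoop i n c).wp ((∑ j ∈ Finset.range N, (τ j + 3)) + 3) (F N) M ≤ F 0 (M.setVar i 0) := by
  classical
  have key : ∀ k ≤ N, ∀ M : Mem, M.int i 0 = N - k → M.int n 0 = N → M.int 3 0 = 1 →
      RealRAM.wp (F N) ((∑ j ∈ Finset.Ico (N - k) N, (τ j + 3)) + 1)
        ([.while (.natLt ⟨i, .const 0⟩ ⟨n, .const 0⟩)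
          (.seq c (.instr (.natOp .add ⟨i, .const 0⟩ ⟨i, .const 0⟩ ⟨3, .const 0⟩)))], M) ≤
      F (N - k) M := by
    intro k
    induction k with
    | zero =>
      intro _ M hi hn _
      rw [wp_succ]
      simp [step, expect_pure, Test.holds, Mem.getInt, Mem.index, hi, hn]
    | succ k ih =>
      intro hk M hMi hMn hM3
      obtain ⟨j, hj⟩ : ∃ j, j = N - (k + 1) := ⟨_, rfl⟩
      have hjN : j < N := by omega
      have hjk : N - k = j + 1 := by omega
      rw [← hj] at hMi ⊢
      rw [hjk] at ih
      rw [Finset.sum_eq_sum_Ico_succ_bot hjN]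
      rw [show τ j + 3 + ∑ k ∈ Finset.Ico (j + 1) N, (τ k + 3) + 1 =
        (((τ j + ((∑ k ∈ Finset.Ico (j + 1) N, (τ k + 3) + 1) + 1)) + 1) + 1) by ring]
      rw [wp_succ]
      simp only [step, expect_pure]
      rw [if_pos (by simp [Test.holds, Mem.getInt, Mem.index, hMi, hMn, hjN]), wp_succ]
      simp only [step, expect_pure]
      refine (wp_cons _ _ _ _ _ _).trans ((c.wp_frame _ _ _).trans ?_)
      refine le_trans (wp_mono (fun M' => ?_) _ _) (hF j hjN M hMi hMn hM3)
      by_cases H : EqOff c.WritesInt c.WritesReal M M'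
      · rw [if_pos H, wp_succ]
        simp only [step, expect_map, Instr.exec, expect_pure]
        have h1 : M'.int i 0 = j := by rw [H.1 i hi, hMi]
        have h2 : M'.int n 0 = N := by rw [H.1 n hn, hMn]
        have h3' : M'.int 3 0 = 1 := by rw [H.1 3 h3, hM3]
        have e : NatOp.eval .add (M'.getInt ⟨i, .const 0⟩) (M'.getInt ⟨3, .const 0⟩) = j + 1 := by
          simp [NatOp.eval, Mem.getInt, Mem.index, h1, h3']
        rw [e]
        refine ih (by omega) _ ?_ ?_ ?_
        · simp [setInt_int, Mem.index]
        · simp [setInt_int, hin, h2]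
        · simp [setInt_int, hi3, h3']
      · simp [H]
  rw [show ∑ j ∈ Finset.range N, (τ j + 3) + 3 =
    1 + (∑ j ∈ Finset.Ico (N - N) N, (τ j + 3) + 1) + 1 by
      rw [Nat.sub_self, Finset.range_eq_Ico]; ring]
  refine (wp_seq _ _ _ _ _ _).trans ?_
  rw [wp_instr]
  simp only [Instr.exec, expect_pure]
  have := key N le_rfl (M.setVar i 0) (by simp [setInt_int, Mem.index])
    (by simp [setInt_int, hin, hM]) (by simp [setInt_int, hi3, hM3])
  simpa using this

theorem sure_forLoop {i n : ℕ} {c : Cmd} (hi : ¬ c.WritesInt i) (hn : ¬ c.WritesInt n)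
    (h3 : ¬ c.WritesInt 3) (hin : n ≠ i) (hi3 : 3 ≠ i) (N : ℕ) (τ : ℕ → ℕ)
    (I : ℕ → Mem → Prop)
    (hI : ∀ j < N, ∀ M : Mem, M.int i 0 = j → M.int n 0 = N → M.int 3 0 = 1 → I j M →
      Sure c (τ j) M (fun M' => I (j + 1) (M'.setVar i (j + 1))))
    (M : Mem) (hM : M.int n 0 = N) (hM3 : M.int 3 0 = 1) (hM0 : I 0 (M.setVar i 0)) :
    Sure (forLoop i n c) ((∑ j ∈ Finset.range N, (τ j + 3)) + 3) M (I N) := by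
  classical
  intro f v hf
  have := wp_forLoop hi hn h3 hin hi3 N τ (fun j M => if I j M then v else ⊤)
    (fun j hj M h1 h2 h4 => by
      by_cases H : I j M
      · rw [if_pos H]
        exact hI j hj M h1 h2 h4 H _ _ fun M' hM' => by rw [if_pos hM']
      · simp [H]) M hM hM3
  rw [if_pos hM0] at this
  refine le_trans (wp_mono (fun M' => ?_) _ _) this
  by_cases H : I N M'
  · simpa [H] using hf M' H
  · simp [H]

/-! ### Running a program in a fresh part of the memory

The `q`-th copy of a memory is kept in the arrays from `40` on, its cell `i` at address
`address i q`. The integer variables `4` and `5` hold `q` and `q * q`, the variable `2` holds `0`,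
and `6`, …, `10` are used for scratch work. -/

/-- The address of the cell `i` of the copy `q`. -/
def address (i q : ℕ) : ℕ := (i + q) * (i + q) + i

/-- The address lies between (i + q)² and (i + q + 1)², the upper bound excluded, so it determines i
+ q and then i. -/
theorem address_inj {i q i' q' : ℕ} (h : address i q = address i' q') : i = i' ∧ q = q' := by
  unfold address at h
  have h1 : i + q = i' + q' := by
    rcases lt_trichotomy (i + q) (i' + q') with h' | h' | h'
    · exfalso; nlinarith
    · exact h'
    · exfalso; nlinarith
  rw [h1] at h
  omega

/-- The first cell of an array. -/
abbrev var (a : ℕ) : Ref := ⟨a, .const 0⟩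

/-- The memory `M` arises from `M₀` by storing `Ms` in the copy `q` and by changing the scratch
variables. -/
structure Sim (M₀ : Mem) (q : ℕ) (M Ms : Mem) : Prop where
  int : ∀ a i, M.int (40 + a) (address i q) = Ms.int a i
  real : ∀ a i, M.real (40 + a) (address i q) = Ms.real a i
  frame_int : ∀ a c, ¬ (6 ≤ a ∧ a ≤ 10) → (40 ≤ a → ∀ i, c ≠ address i q) →
    M.int a c = M₀.int a c
  frame_real : ∀ a c, (40 ≤ a → ∀ i, c ≠ address i q) → M.real a c = M₀.real a c
  zero : M₀.int 2 0 = 0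
  copy : M₀.int 4 0 = q
  copy_sq : M₀.int 5 0 = q * q

namespace Sim
variable {M₀ M Ms : Mem} {q : ℕ}

theorem int_var (h : Sim M₀ q M Ms) {a : ℕ} (ha : a < 6) (i : ℕ) : M.int a i = M₀.int a i :=
  h.frame_int a i (by omega) (by omega)

theorem setScratch (h : Sim M₀ q M Ms) {r : Ref} (h6 : 6 ≤ r.arr) (h10 : r.arr ≤ 10) (v : ℕ) :
    Sim M₀ q (M.setInt r v) Ms where
  int a i := by rw [setInt_int, if_neg (by omega), h.int]
  real a i := h.real a i
  frame_int a c h1 h2 := by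
    rw [setInt_int, if_neg (by rintro ⟨rfl, -⟩; exact h1 ⟨h6, h10⟩), h.frame_int a c h1 h2]
  frame_real := h.frame_real
  zero := h.zero
  copy := h.copy
  copy_sq := h.copy_sq

theorem setInt (h : Sim M₀ q M Ms) {r : Ref} {x : Idx} (hx : M.index x = address (Ms.index r.idx) q)
    (v : ℕ) : Sim M₀ q (M.setInt ⟨40 + r.arr, x⟩ v) (Ms.setInt r v) where
  int a i := by
    rw [setInt_int, setInt_int, h.int, hx]
    refine if_congr ⟨?_, ?_⟩ rfl rfl
    · rintro ⟨h1, h2⟩; exact ⟨Nat.add_left_cancel h1, (address_inj h2).1⟩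
    · rintro ⟨h1, h2⟩; rw [h1, h2]; exact ⟨rfl, rfl⟩
  real a i := h.real a i
  frame_int a c h1 h2 := by
    rw [setInt_int, if_neg, h.frame_int a c h1 h2]
    rintro ⟨rfl, rfl⟩
    exact h2 (by simp) _ hx
  frame_real := h.frame_real
  zero := h.zero
  copy := h.copy
  copy_sq := h.copy_sq

theorem setReal (h : Sim M₀ q M Ms) {r : Ref} {x : Idx}
    (hx : M.index x = address (Ms.index r.idx) q) (v : ℝ) :
    Sim M₀ q (M.setReal ⟨40 + r.arr, x⟩ v) (Ms.setReal r v) where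
  real a i := by
    rw [setReal_real, setReal_real, h.real, hx]
    refine if_congr ⟨?_, ?_⟩ rfl rfl
    · rintro ⟨h1, h2⟩; exact ⟨Nat.add_left_cancel h1, (address_inj h2).1⟩
    · rintro ⟨h1, h2⟩; rw [h1, h2]; exact ⟨rfl, rfl⟩
  int a i := h.int a i
  frame_real a c h2 := by
    rw [setReal_real, if_neg, h.frame_real a c h2]
    rintro ⟨rfl, rfl⟩
    exact h2 (by simp) _ hx
  frame_int := h.frame_int
  zero := h.zero
  copy := h.copy
  copy_sq := h.copy_sq

end Sim

/-- Load an index of the copied memory into the integer variable `s`. -/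
def loadIdx (s : ℕ) : Idx → Instr
  | .const i => .setNat (var s) i
  | .var r => .natOp .add (var s) ⟨40 + r, .var 5⟩ (var 2)

/-- Compute the address of a cell of the copied memory in the integer variable `s`. -/
def loadAddress (s : ℕ) (x : Idx) : Cmd :=
  block (loadIdx s x) [.natOp .add (var 9) (var s) (var 4), .natOp .mul (var 9) (var 9) (var 9),
    .natOp .add (var s) (var 9) (var s)]

theorem sure_loadAddress {M₀ M Ms : Mem} {q : ℕ} (h : Sim M₀ q M Ms) {s : ℕ} (h6 : 6 ≤ s)
    (h8 : s ≤ 8) (x : Idx) :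
    Sure (loadAddress s x) 7 M fun M' => Sim M₀ q M' Ms ∧
      M'.int s 0 = address (Ms.index x) q ∧ ∀ b ≤ 8, b ≠ s → M'.int b 0 = M.int b 0 := by
  have hdet : ∀ j ∈ loadIdx s x :: [.natOp .add (var 9) (var s) (var 4),
      .natOp .mul (var 9) (var 9) (var 9), .natOp .add (var s) (var 9) (var s)], j.IsDet := by
    intro j hj
    simp only [List.mem_cons, List.not_mem_nil, or_false] at hj
    rcases hj with rfl | rfl | rfl | rfl <;> cases x <;> trivial
  refine (sure_block _ _ hdet M).mono ?_
  rintro M' rfl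
  have e : (loadIdx s x).effect M = M.setInt (var s) (Ms.index x) := by
    cases x with
    | const i => rfl
    | var r =>
      -- The address of cell 0 of the copy is q * q, which is why this square is kept in a variable:
      -- the scalars of the copy are reached without any arithmetic.
      have h1 : M.int (40 + r) (q * q) = Ms.int r 0 := by
        rw [← h.int r 0]; simp [address]
      have h2 : M.int 2 0 = 0 := by rw [h.int_var (by norm_num), h.zero]
      have h5 : M.int 5 0 = q * q := by rw [h.int_var (by norm_num), h.copy_sq]
      simp [loadIdx, Instr.effect, NatOp.eval, Mem.getInt, Mem.index, h1, h2, h5]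
  have h4 : M.int 4 0 = q := by rw [h.int_var (by norm_num), h.copy]
  simp only [List.foldl, e]
  have h9 : s ≠ 9 := by omega
  have h4s : 4 ≠ s := by omega
  refine ⟨?_, ?_, ?_⟩
  · exact (((h.setScratch (r := var s) h6 (by simp; omega) _).setScratch (by simp) (by simp) _
      ).setScratch (by simp) (by simp) _).setScratch (r := var s) h6 (by simp; omega) _
  · simp [Instr.effect, NatOp.eval, Mem.getInt, setInt_int, Mem.index, h4, h9, h4s, address]
  · intro b hb hbs
    have hb9 : b ≠ 9 := by omega
    simp [Instr.effect, setInt_int, hbs, hb9]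

/-- The addresses of three cells of the copied memory are in the integer variables `6`, `7`
and `8`. -/
structure Loaded (q : ℕ) (M Ms : Mem) (x y z : Idx) : Prop where
  fst : M.int 6 0 = address (Ms.index x) q
  snd : M.int 7 0 = address (Ms.index y) q
  trd : M.int 8 0 = address (Ms.index z) q

/-- Load three addresses. -/
def loadAddresses (x y z : Idx) : Cmd :=
  .seq (.seq (loadAddress 6 x) (loadAddress 7 y)) (loadAddress 8 z)

theorem sure_loadAddresses {M₀ M Ms : Mem} {q : ℕ} (h : Sim M₀ q M Ms) (x y z : Idx) :
    Sure (loadAddresses x y z) 23 M fun M' => Sim M₀ q M' Ms ∧ Loaded q M' Ms x y z := by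
  refine Sure.seq (t₁ := 15) (t₂ := 7) (Sure.seq (t₁ := 7) (t₂ := 7)
    (sure_loadAddress h le_rfl (by norm_num) x) fun M₁ h₁ =>
      (sure_loadAddress h₁.1 (by norm_num) (by norm_num) y).mono
        (R := fun M' => Sim M₀ q M' Ms ∧ M'.int 6 0 = address (Ms.index x) q ∧
          M'.int 7 0 = address (Ms.index y) q) fun M₂ h₂ => ⟨h₂.1, ?_, h₂.2.1⟩) fun M₂ h₂ =>
      (sure_loadAddress h₂.1 (by norm_num) (by norm_num) z).mono fun M₃ h₃ =>
        ⟨h₃.1, ?_, ?_, h₃.2.1⟩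
  · rw [h₂.2.2 6 (by norm_num) (by norm_num), h₁.2.1]
  · rw [h₃.2.2 6 (by norm_num) (by norm_num), h₂.2.1]
  · rw [h₃.2.2 7 (by norm_num) (by norm_num), h₂.2.2]

/-- The cell whose address is in the integer variable `s`. -/
def Ref.reloc (r : Ref) (s : ℕ) : Ref := ⟨40 + r.arr, .var s⟩

/-- Load the addresses needed by an instruction, and execute it in the copied memory. -/
def Instr.reloc : Instr → Cmd
  | .setNat dst c => .seq (loadAddresses dst.idx dst.idx dst.idx) (.instr (.setNat (dst.reloc 6) c))
  | .natOp op dst a b =>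
    .seq (loadAddresses dst.idx a.idx b.idx)
      (.instr (.natOp op (dst.reloc 6) (a.reloc 7) (b.reloc 8)))
  | .realOp op dst a b =>
    .seq (loadAddresses dst.idx a.idx b.idx)
      (.instr (.realOp op (dst.reloc 6) (a.reloc 7) (b.reloc 8)))
  | .realFun f dst a =>
    .seq (loadAddresses dst.idx a.idx a.idx) (.instr (.realFun f (dst.reloc 6) (a.reloc 7)))
  | .cast dst a =>
    .seq (loadAddresses dst.idx a.idx a.idx) (.instr (.cast (dst.reloc 6) (a.reloc 7)))
  | .floor dst a =>
    .seq (loadAddresses dst.idx a.idx a.idx) (.instr (.floor (dst.reloc 6) (a.reloc 7)))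
  | .rand dst a =>
    .seq (loadAddresses dst.idx a.idx a.idx) (.instr (.rand (dst.reloc 6) (a.reloc 7)))

theorem Sim.getInt {M₀ M Ms : Mem} {q s : ℕ} (h : Sim M₀ q M Ms) {r : Ref}
    (hs : M.int s 0 = address (Ms.index r.idx) q) : M.getInt (r.reloc s) = Ms.getInt r := by
  simp [Mem.getInt, Ref.reloc, Mem.index, hs, h.int]

theorem Sim.getReal {M₀ M Ms : Mem} {q s : ℕ} (h : Sim M₀ q M Ms) {r : Ref}
    (hs : M.int s 0 = address (Ms.index r.idx) q) : M.getReal (r.reloc s) = Ms.getReal r := by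
  simp [Mem.getReal, Ref.reloc, Mem.index, hs, h.real]

/-- The range of the draw occurs in the type of the distribution, so equal bounds have to be
substituted while they are still variables. -/
theorem expect_uniform_congr {u v : ℕ} (h : u = v) (hu : Nonempty (Fin (u + 1)))
    (hv : Nonempty (Fin (v + 1))) (f : ℕ → ℝ≥0∞) :
    expect (do let a ← @PMF.uniformOfFintype (Fin (u + 1)) _ hu; pure (a : ℕ)) f =
      expect (do let a ← @PMF.uniformOfFintype (Fin (v + 1)) _ hv; pure (a : ℕ)) f := by
  subst h; rfl

theorem wp_reloc_instr {M₀ M Ms : Mem} {q : ℕ} (h : Sim M₀ q M Ms) (i : Instr)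
    (f g : Mem → ℝ≥0∞) (hfg : ∀ M' Ms', Sim M₀ q M' Ms' → f M' ≤ g Ms') :
    i.reloc.wp 25 f M ≤ expect (i.exec Ms) g := by
  cases i with
  | setNat dst c =>
    refine (sure_loadAddresses h _ _ _).wp_seq (t₂ := 1) fun M' hM' => ?_
    obtain ⟨hS, hL⟩ := hM'
    rw [wp_instr]
    simp only [Instr.exec, expect_pure]
    exact hfg _ _ (hS.setInt (x := .var 6) hL.fst _)
  | natOp op dst a b =>
    refine (sure_loadAddresses h _ _ _).wp_seq (t₂ := 1) fun M' hM' => ?_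
    obtain ⟨hS, hL⟩ := hM'
    rw [wp_instr]
    simp only [Instr.exec, expect_pure, hS.getInt hL.snd, hS.getInt hL.trd]
    exact hfg _ _ (hS.setInt (x := .var 6) hL.fst _)
  | realOp op dst a b =>
    refine (sure_loadAddresses h _ _ _).wp_seq (t₂ := 1) fun M' hM' => ?_
    obtain ⟨hS, hL⟩ := hM'
    rw [wp_instr]
    simp only [Instr.exec, expect_pure, hS.getReal hL.snd, hS.getReal hL.trd]
    exact hfg _ _ (hS.setReal (x := .var 6) hL.fst _)
  | realFun F dst a =>
    refine (sure_loadAddresses h _ _ _).wp_seq (t₂ := 1) fun M' hM' => ?_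
    obtain ⟨hS, hL⟩ := hM'
    rw [wp_instr]
    simp only [Instr.exec, expect_pure, hS.getReal hL.snd]
    exact hfg _ _ (hS.setReal (x := .var 6) hL.fst _)
  | cast dst a =>
    refine (sure_loadAddresses h _ _ _).wp_seq (t₂ := 1) fun M' hM' => ?_
    obtain ⟨hS, hL⟩ := hM'
    rw [wp_instr]
    simp only [Instr.exec, expect_pure, hS.getInt hL.snd]
    exact hfg _ _ (hS.setReal (x := .var 6) hL.fst _)
  | floor dst a =>
    refine (sure_loadAddresses h _ _ _).wp_seq (t₂ := 1) fun M' hM' => ?_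
    obtain ⟨hS, hL⟩ := hM'
    rw [wp_instr]
    simp only [Instr.exec, expect_pure, hS.getReal hL.snd]
    exact hfg _ _ (hS.setInt (x := .var 6) hL.fst _)
  | rand dst a =>
    refine (sure_loadAddresses h _ _ _).wp_seq (t₂ := 1) fun M' hM' => ?_
    obtain ⟨hS, hL⟩ := hM'
    rw [wp_instr]
    simp only [Instr.exec, expect_map]
    rw [expect_uniform_congr (hS.getInt (r := a) hL.snd) _ ⟨0⟩]
    exact expect_mono fun v => hfg _ _ (hS.setInt (x := .var 6) hL.fst _)

/-- The test on the copied memory, once the addresses are loaded. -/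
def Test.reloc : Test → Test
  | .natLt a b => .natLt (a.reloc 6) (b.reloc 7)
  | .realLt a b => .realLt (a.reloc 6) (b.reloc 7)

/-- Load the addresses needed by a test. -/
def Test.load : Test → Cmd
  | .natLt a b | .realLt a b => loadAddresses a.idx b.idx b.idx

theorem sure_test_load {M₀ M Ms : Mem} {q : ℕ} (h : Sim M₀ q M Ms) (b : Test) :
    Sure b.load 23 M fun M' => Sim M₀ q M' Ms ∧ (b.reloc.holds M' ↔ b.holds Ms) := by
  cases b with
  | natLt a b =>
    refine (sure_loadAddresses h _ _ _).mono fun M' hM' => ⟨hM'.1, ?_⟩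
    simp only [Test.reloc, Test.holds, hM'.1.getInt hM'.2.fst, hM'.1.getInt hM'.2.snd]
  | realLt a b =>
    refine (sure_loadAddresses h _ _ _).mono fun M' hM' => ⟨hM'.1, ?_⟩
    simp only [Test.reloc, Test.holds, hM'.1.getReal hM'.2.fst, hM'.1.getReal hM'.2.snd]

/-- Evaluate a test on the copied memory into the integer variable `10`. -/
def Test.flag (b : Test) : Cmd :=
  .seq b.load (.ite b.reloc (.instr (.setNat (var 10) 1)) (.instr (.setNat (var 10) 0)))

theorem sure_test_flag {M₀ M Ms : Mem} {q : ℕ} (h : Sim M₀ q M Ms) (b : Test) :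
    Sure b.flag 26 M fun M' => Sim M₀ q M' Ms ∧ (0 < M'.int 10 0 ↔ b.holds Ms) := by
  refine Sure.seq (t₁ := 23) (t₂ := 2) (sure_test_load h b) fun M₁ ⟨h₁, hb⟩ =>
    sure_ite (t := 1) (fun H => ?_) fun H => ?_
  · refine (sure_instr (by trivial) _).mono ?_
    rintro M' rfl
    refine ⟨h₁.setScratch (by simp) (by simp) _, ?_⟩
    simp [Instr.effect, setInt_int, Mem.index, ← hb, H]
  · refine (sure_instr (by trivial) _).mono ?_
    rintro M' rfl
    refine ⟨h₁.setScratch (by simp) (by simp) _, ?_⟩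
    simp [Instr.effect, setInt_int, Mem.index, ← hb, H]

/-- The loop into which `while b do c` is translated, once the test has been evaluated; `c'` is the
translation of `c`. -/
def relocLoop (b : Test) (c' : Cmd) : Cmd :=
  .while (.natLt (var 2) (var 10)) (.seq c' b.flag)

/-- The program executed in the copied memory. -/
def Cmd.reloc : Cmd → Cmd
  | .instr i => i.reloc
  | .seq c₁ c₂ => .seq c₁.reloc c₂.reloc
  | .ite b c₁ c₂ => .seq b.load (.ite b.reloc c₁.reloc c₂.reloc)
  | .while b c => .seq b.flag (relocLoop b c.reloc)

/-- Strong induction on the budget with arbitrary continuations on both sides. The second conjunct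
is needed because, after the body of a translated loop, the stack holds the test evaluation followed
by the translated loop instead of a translated `while`. It gets one step less, as the unfolding of
the enclosing sequence has been paid for. The factor 32 exceeds the overhead of loading addresses,
evaluating tests and unfolding for every kind of command. -/
theorem wp_reloc_cons (f g : Mem → ℝ≥0∞) (M₀ : Mem) (q t : ℕ) :
    ∀ (K S : List Cmd), (∀ u ≤ t, ∀ M Ms, Sim M₀ q M Ms →
        wp f (32 * u) (S, M) ≤ wp g u (K, Ms)) → ∀ M Ms, Sim M₀ q M Ms →
      (∀ c : Cmd, wp f (32 * t) (c.reloc :: S, M) ≤ wp g t (c :: K, Ms)) ∧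
      ∀ b c, wp f (32 * t - 1) (b.flag :: relocLoop b c.reloc :: S, M) ≤
        wp g t (.while b c :: K, Ms) := by
  induction t using Nat.strong_induction_on with
  | _ t ih =>
  cases t with
  | zero => intro K S _ M Ms _; simp [wp_zero_cons]
  | succ t =>
  intro K S hS M Ms hM
  have hS' : ∀ u ≤ t, ∀ M Ms, Sim M₀ q M Ms → wp f (32 * u) (S, M) ≤ wp g u (K, Ms) :=
    fun u hu => hS u (by omega)
  have loop : ∀ b c, wp f (32 * (t + 1) - 1) (b.flag :: relocLoop b c.reloc :: S, M) ≤
      wp g (t + 1) (.while b c :: K, Ms) := by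
    intro b c
    -- 26 steps evaluate the flag and one tests it; the remainder covers entering the body and the
    -- simulation of `t` further steps.
    rw [show 32 * (t + 1) - 1 = 26 + (32 * t + 4 + 1) by omega]
    refine (wp_cons _ _ _ _ _ _).trans (sure_test_flag hM b _ _ fun M' hM' => ?_)
    obtain ⟨hS₁, hb⟩ := hM'
    rw [wp_succ, wp_succ]
    have h2 : M'.int 2 0 = 0 := by rw [hS₁.int_var (by norm_num), hS₁.zero]
    simp only [step, relocLoop, expect_pure]
    by_cases H : b.holds Ms
    · rw [if_pos (by simpa [Test.holds, Mem.getInt, Mem.index, h2] using hb.2 H), if_pos H]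
      rw [show 32 * t + 4 = (32 * t + 3) + 1 by ring, wp_succ]
      simp only [step, expect_pure]
      refine (wp_anti f (by omega : 32 * t ≤ 32 * t + 3) _).trans
        ((ih t (by omega) (.while b c :: K) (b.flag :: relocLoop b c.reloc :: S) ?_ _ _ hS₁).1 c)
      intro u hu M Ms hM
      exact (wp_anti f (by omega) _).trans ((ih u (by omega) K S
        (fun u' hu' => hS u' (by omega)) _ _ hM).2 b c)
    · rw [if_neg (by
        have := mt hb.1 H
        simpa [Test.holds, Mem.getInt, Mem.index, h2] using this), if_neg H]
      exact (wp_anti f (by omega) _).trans (hS t (by omega) _ _ hS₁)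
  refine ⟨fun c => ?_, loop⟩
  cases c with
  | instr i =>
    rw [wp_succ g]
    simp only [step, expect_map]
    rw [show 32 * (t + 1) = 25 + (32 * t + 7) by ring]
    exact (wp_cons _ _ _ _ _ _).trans (wp_reloc_instr hM i _ _ fun M' Ms' h =>
      (wp_anti f (by omega) _).trans (hS t (by omega) _ _ h))
  | seq c₁ c₂ =>
    rw [wp_succ g, show 32 * (t + 1) = (32 * t + 31) + 1 by ring, wp_succ]
    simp only [step, Cmd.reloc, expect_pure]
    refine (wp_anti f (by omega : 32 * t ≤ 32 * t + 31) _).trans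
      ((ih t (by omega) (c₂ :: K) (c₂.reloc :: S) ?_ _ _ hM).1 c₁)
    intro u hu M Ms hM
    exact (ih u (by omega) K S (fun u' hu' => hS u' (by omega)) _ _ hM).1 c₂
  | ite b c₁ c₂ =>
    rw [wp_succ g, show 32 * (t + 1) = (23 + (32 * t + 7 + 1)) + 1 by ring, wp_succ]
    simp only [step, Cmd.reloc, expect_pure]
    refine (wp_cons _ _ _ _ _ _).trans (sure_test_load hM b _ _ fun M' hM' => ?_)
    obtain ⟨hS₁, hb⟩ := hM'
    rw [wp_succ]
    simp only [step, expect_pure]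
    have := (ih t (by omega) K S hS' _ _ hS₁).1
    by_cases H : b.holds Ms
    · rw [if_pos H, if_pos (hb.2 H)]
      exact (wp_anti f (by omega : 32 * t ≤ 32 * t + 7) _).trans (this c₁)
    · rw [if_neg H, if_neg (mt hb.1 H)]
      exact (wp_anti f (by omega : 32 * t ≤ 32 * t + 7) _).trans (this c₂)
  | _ b c =>
    rw [show 32 * (t + 1) = (32 * (t + 1) - 1) + 1 by omega, wp_succ]
    simp only [step, Cmd.reloc, expect_pure]
    exact loop b c

/-- The relocated program simulates the original one. -/
theorem wp_reloc {f g : Mem → ℝ≥0∞} {M₀ M Ms : Mem} {q : ℕ} (hM : Sim M₀ q M Ms)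
    (hfg : ∀ M' Ms', Sim M₀ q M' Ms' → f M' ≤ g Ms') (t : ℕ) (c : Cmd) :
    c.reloc.wp (32 * t) f M ≤ c.wp t g Ms :=
  (wp_reloc_cons f g M₀ q t [] [] (fun u _ M Ms h => by simpa using hfg M Ms h) M Ms hM).1 c

/-! The relocated program writes only to scratch variables and to the copied memory. -/

theorem loadAddress_writesInt {s a : ℕ} {x : Idx} (h : (loadAddress s x).WritesInt a) :
    a = s ∨ a = 9 := by
  cases x <;> simp [loadAddress, block, Cmd.WritesInt, Instr.intDst, loadIdx] at h <;> omega

theorem loadAddress_writesReal {s a : ℕ} {x : Idx} (h : (loadAddress s x).WritesReal a) : False := by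
  cases x <;> simp [loadAddress, block, Cmd.WritesReal, Instr.realDst, loadIdx] at h

theorem loadAddresses_writesInt {a : ℕ} {x y z : Idx} (h : (loadAddresses x y z).WritesInt a) :
    6 ≤ a ∧ a ≤ 10 := by
  rcases h with (h | h) | h <;> have := loadAddress_writesInt h <;> omega

theorem loadAddresses_writesReal {a : ℕ} {x y z : Idx} (h : (loadAddresses x y z).WritesReal a) :
    False := by
  rcases h with (h | h) | h <;> exact loadAddress_writesReal h

theorem Instr.reloc_writesInt {i : Instr} {a : ℕ} (h : i.reloc.WritesInt a) :
    6 ≤ a ∧ a ≤ 10 ∨ 40 ≤ a := by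
  cases i <;> rcases h with h | h <;>
    first
    | exact Or.inl (loadAddresses_writesInt h)
    | (simp [Cmd.WritesInt, Instr.intDst, Ref.reloc] at h; try omega)

theorem Instr.reloc_writesReal {i : Instr} {a : ℕ} (h : i.reloc.WritesReal a) : 40 ≤ a := by
  cases i <;> rcases h with h | h <;>
    first
    | exact (loadAddresses_writesReal h).elim
    | (simp [Cmd.WritesReal, Instr.realDst, Ref.reloc] at h; try omega)

theorem Test.flag_writesInt {b : Test} {a : ℕ} (h : b.flag.WritesInt a) : 6 ≤ a ∧ a ≤ 10 := by
  rcases h with h | h | h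
  · cases b <;> exact loadAddresses_writesInt h
  all_goals simp [Cmd.WritesInt, Instr.intDst] at h; omega

theorem Test.flag_writesReal {b : Test} {a : ℕ} (h : b.flag.WritesReal a) : False := by
  rcases h with h | h | h
  · cases b <;> exact loadAddresses_writesReal h
  all_goals simp [Cmd.WritesReal, Instr.realDst] at h

theorem Cmd.reloc_writesInt {c : Cmd} {a : ℕ} (h : c.reloc.WritesInt a) :
    6 ≤ a ∧ a ≤ 10 ∨ 40 ≤ a := by
  induction c with
  | instr i => exact i.reloc_writesInt h
  | seq c₁ c₂ h₁ h₂ => exact h.elim h₁ h₂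
  | ite b c₁ c₂ h₁ h₂ =>
    rcases h with h | h | h
    · exact Or.inl (by cases b <;> exact loadAddresses_writesInt h)
    · exact h₁ h
    · exact h₂ h
  | _ b c hc =>
    rcases h with h | h | h
    · exact Or.inl (Test.flag_writesInt h)
    · exact hc h
    · exact Or.inl (Test.flag_writesInt h)

theorem Cmd.reloc_writesReal {c : Cmd} {a : ℕ} (h : c.reloc.WritesReal a) : 40 ≤ a := by
  induction c with
  | instr i => exact i.reloc_writesReal h
  | seq c₁ c₂ h₁ h₂ => exact h.elim h₁ h₂
  | ite b c₁ c₂ h₁ h₂ =>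
    rcases h with h | h | h
    · exact (by cases b <;> exact (loadAddresses_writesReal h).elim)
    · exact h₁ h
    · exact h₂ h
  | _ b c hc =>
    rcases h with h | h | h
    · exact (Test.flag_writesReal h).elim
    · exact hc h
    · exact (Test.flag_writesReal h).elim

end RealRAM

/-! ### Positive semidefinite matrices with nonnegative entries -/

section spectral
variable {n : ℕ} {A : Matrix (Fin n) (Fin n) ℝ}

theorem topEigenvalue_mem_spectrum [NeZero n] (hA : A.IsHermitian) :
    topEigenvalue A ∈ spectrum ℝ A := by
  unfold topEigenvalue
  have h := hA.spectrum_real_eq_range_eigenvalues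
  refine Set.Nonempty.csSup_mem ?_ ?_
  · rw [h]; exact Set.range_nonempty _
  · rw [h]; exact Set.finite_range _

theorem le_topEigenvalue (hA : A.IsHermitian) {μ : ℝ} (hμ : μ ∈ spectrum ℝ A) :
    μ ≤ topEigenvalue A := by
  refine le_csSup ?_ hμ
  rw [hA.spectrum_real_eq_range_eigenvalues]
  exact (Set.finite_range _).bddAbove

theorem exists_topEigenvector [NeZero n] (hA : A.IsHermitian) :
    ∃ v : Fin n → ℝ, v ≠ 0 ∧ A.mulVec v = topEigenvalue A • v := by
  have h := topEigenvalue_mem_spectrum hA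
  rw [spectrum.mem_iff, Matrix.isUnit_iff_isUnit_det, isUnit_iff_ne_zero, not_not] at h
  obtain ⟨v, hv, hv0⟩ := Matrix.exists_mulVec_eq_zero_iff.2 h
  refine ⟨v, hv, ?_⟩
  rw [Matrix.sub_mulVec, sub_eq_zero] at hv0
  rw [← hv0, Algebra.algebraMap_eq_smul_one, Matrix.smul_mulVec, Matrix.one_mulVec]

/-- The matrix λ - A is positive semidefinite, because its spectrum is λ minus the spectrum of A,
where λ is the largest eigenvalue. -/
theorem dotProduct_mulVec_le (hA : A.IsHermitian) (x : Fin n → ℝ) :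
    x ⬝ᵥ A.mulVec x ≤ topEigenvalue A * (x ⬝ᵥ x) := by
  have h : (algebraMap ℝ (Matrix (Fin n) (Fin n) ℝ) (topEigenvalue A) - A).PosSemidef := by
    rw [Matrix.posSemidef_iff_isHermitian_and_spectrum_nonneg]
    refine ⟨?_, ?_⟩
    · refine Matrix.IsHermitian.sub ?_ hA
      rw [Algebra.algebraMap_eq_smul_one]
      simp [Matrix.IsHermitian]
    · rw [← spectrum.singleton_sub_eq]
      rintro _ ⟨a, ha, b, hb, rfl⟩
      rw [Set.mem_singleton_iff] at ha
      subst ha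
      simpa using le_topEigenvalue hA hb
  have := h.dotProduct_mulVec_nonneg x
  rw [Matrix.sub_mulVec, dotProduct_sub, Algebra.algebraMap_eq_smul_one, Matrix.smul_mulVec,
    Matrix.one_mulVec, dotProduct_smul, smul_eq_mul] at this
  simpa using this

theorem dotProduct_mulVec_symm (hA : A.IsHermitian) (x y : Fin n → ℝ) :
    x ⬝ᵥ A.mulVec y = A.mulVec x ⬝ᵥ y := by
  have : A.transpose = A := by
    have := hA.eq
    rwa [Matrix.conjTranspose_eq_transpose_of_trivial] at this
  rw [Matrix.dotProduct_mulVec, ← Matrix.mulVec_transpose, this]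

/-- Positivity of A at λx - Ax, combined with the Rayleigh bound at Ax, gives λ‖Ax‖² ≤ λ² xᵀAx; then
cancel λ. This turns a long image Ax into a large Rayleigh quotient without an eigenvalue gap. -/
theorem mulVec_sq_le (hA : A.PosSemidef) (hpos : 0 < topEigenvalue A) (x : Fin n → ℝ) :
    A.mulVec x ⬝ᵥ A.mulVec x ≤ topEigenvalue A * (x ⬝ᵥ A.mulVec x) := by
  have hH := hA.isHermitian
  have h := hA.dotProduct_mulVec_nonneg (topEigenvalue A • x - A.mulVec x)
  have h2 := dotProduct_mulVec_le hH (A.mulVec x)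
  simp only [star_trivial, Matrix.mulVec_sub, Matrix.mulVec_smul, sub_dotProduct, dotProduct_sub,
    smul_dotProduct, dotProduct_smul, smul_eq_mul] at h
  have h3 := dotProduct_mulVec_symm hH x (A.mulVec x)
  rw [h3] at h
  nlinarith

/-- The Euclidean norm of a vector. -/
abbrev euclNorm (x : Fin n → ℝ) : ℝ := ‖WithLp.toLp 2 x‖

theorem euclNorm_eq (x : Fin n → ℝ) : euclNorm x = √(∑ i, x i * x i) := by
  rw [euclNorm, EuclideanSpace.norm_eq]
  simp [← sq]

theorem euclNorm_sq (x : Fin n → ℝ) : euclNorm x ^ 2 = x ⬝ᵥ x := by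
  rw [euclNorm_eq, Real.sq_sqrt (Finset.sum_nonneg fun i _ => mul_self_nonneg _)]
  rfl

theorem euclNorm_mono {x y : Fin n → ℝ} (h0 : ∀ i, 0 ≤ x i) (h : ∀ i, x i ≤ y i) :
    euclNorm x ≤ euclNorm y := by
  rw [euclNorm_eq, euclNorm_eq]
  exact Real.sqrt_le_sqrt (Finset.sum_le_sum fun i _ => mul_self_le_mul_self (h0 i) (h i))

theorem euclNorm_mulVec_le (hA : A.PosSemidef) (hpos : 0 < topEigenvalue A) (x : Fin n → ℝ) :
    euclNorm (A.mulVec x) ≤ topEigenvalue A * euclNorm x := by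
  refine le_of_sq_le_sq ?_ (by positivity)
  rw [mul_pow, euclNorm_sq, euclNorm_sq, sq, mul_assoc]
  exact (mulVec_sq_le hA hpos x).trans
    (mul_le_mul_of_nonneg_left (dotProduct_mulVec_le hA.isHermitian x) hpos.le)

theorem dotProduct_le_euclNorm (x y : Fin n → ℝ) : x ⬝ᵥ y ≤ euclNorm x * euclNorm y := by
  have := real_inner_le_norm (WithLp.toLp 2 x) (WithLp.toLp 2 y)
  rwa [EuclideanSpace.inner_toLp_toLp, star_trivial, dotProduct_comm] at this

/-- A matrix with nonnegative entries has a nonnegative vector that witnesses the top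
eigenvalue. -/
theorem exists_nonneg_witness [NeZero n] (hA : A.PosSemidef) (hnn : ∀ i j, 0 ≤ A i j) :
    ∃ u : Fin n → ℝ, (∀ i, 0 ≤ u i) ∧ euclNorm u = 1 ∧
      ∀ i, topEigenvalue A * u i ≤ A.mulVec u i := by
  obtain ⟨v, hv, hAv⟩ := exists_topEigenvector hA.isHermitian
  have hv0 : 0 < euclNorm v := by
    rw [euclNorm, norm_pos_iff]
    simpa using hv
  -- Normalized absolute values of a top eigenvector. The triangle inequality gives the inequality
  -- λu ≤ Au, which suffices; no Perron–Frobenius theory is needed.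
  refine ⟨fun i => (euclNorm v)⁻¹ * |v i|, fun i => by positivity, ?_, fun i => ?_⟩
  · have : euclNorm (fun i => (euclNorm v)⁻¹ * |v i|) = √((euclNorm v)⁻¹ ^ 2 * euclNorm v ^ 2) := by
      rw [euclNorm_eq, euclNorm_sq, dotProduct, Finset.mul_sum]
      congr 1
      refine Finset.sum_congr rfl fun i _ => ?_
      rw [← abs_mul_abs_self (v i)]
      ring
    rw [this, ← mul_pow, inv_mul_cancel₀ hv0.ne']
    simp
  · have h1 : topEigenvalue A * v i = ∑ j, A i j * v j := by
      have := congrFun hAv i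
      simpa [Matrix.mulVec, dotProduct] using this.symm
    have h2 : topEigenvalue A * |v i| ≤ ∑ j, A i j * |v j| := by
      calc topEigenvalue A * |v i| ≤ |topEigenvalue A| * |v i| := by
            gcongr; exact le_abs_self _
        _ = |∑ j, A i j * v j| := by rw [← abs_mul, h1]
        _ ≤ ∑ j, |A i j * v j| := Finset.abs_sum_le_sum_abs _ _
        _ = ∑ j, A i j * |v j| := by
          refine Finset.sum_congr rfl fun j _ => ?_
          rw [abs_mul, abs_of_nonneg (hnn i j)]
    calc topEigenvalue A * ((euclNorm v)⁻¹ * |v i|)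
        = (euclNorm v)⁻¹ * (topEigenvalue A * |v i|) := by ring
      _ ≤ (euclNorm v)⁻¹ * ∑ j, A i j * |v j| := by gcongr
      _ = A.mulVec (fun i => (euclNorm v)⁻¹ * |v i|) i := by
        rw [Finset.mul_sum]
        simp only [Matrix.mulVec, dotProduct]
        exact Finset.sum_congr rfl fun j _ => by ring

/-- The first unit vector has Rayleigh quotient 1. -/
theorem topEigenvalue_pos [NeZero n] (hA : A.IsHermitian) (hdiag : ∀ i, A i i = 1) :
    0 < topEigenvalue A := by
  have h := dotProduct_mulVec_le hA (Pi.single (0 : Fin n) (1 : ℝ))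
  simp only [Matrix.mulVec_single, MulOpposite.op_one, one_smul, single_dotProduct,
    Matrix.col_apply, hdiag, Pi.single_eq_same, mul_one] at h
  linarith

end spectral

/-! ### The power method with one-sided errors -/

section power
variable {n : ℕ} {A : Matrix (Fin n) (Fin n) ℝ}

/-- The state of the noisy power method after `t` iterations: the current vector `z` has a
correlation with the witness `u` that has grown geometrically, unless the longest vector met so
far is long enough; `out` is the vector that gave the longest one. -/
structure PowerState (A : Matrix (Fin n) (Fin n) ℝ) (F η : ℝ) (u : Fin n → ℝ) (t : ℕ)
    (z out : Fin n → ℝ) (best : ℝ) : Prop where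
  grow : (1 - 2 * η) * topEigenvalue A * F ≤ best ∨ (1 + η) ^ t ≤ √n * (u ⬝ᵥ z)
  out : best = 0 ∨ euclNorm out = 1 ∧
    best ≤ (1 + η) * (F * euclNorm (A.mulVec out) + topEigenvalue A * √n)

theorem euclNorm_one : euclNorm (fun _ : Fin n => (1 : ℝ)) = √n := by
  rw [euclNorm_eq]; simp

theorem mulVec_mono (hnn : ∀ i j, 0 ≤ A i j) {x y : Fin n → ℝ} (h : ∀ i, x i ≤ y i) (i : Fin n) :
    A.mulVec x i ≤ A.mulVec y i := by
  simp only [Matrix.mulVec, dotProduct]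
  exact Finset.sum_le_sum fun j _ => mul_le_mul_of_nonneg_left (h j) (hnn i j)

/-- Pairing the lower bounds for y and w with u gives ⟨u, y⟩ ≥ (1 - η)λF⟨u, z⟩. If the length s
stays below (1 - 2η)λF, division by s gains at least (1 - η)/(1 - 2η) ≥ 1 + η. For the stored
vector, y ≤ (1 + η)A(Fz + 1) entrywise, where 1 is the all-ones vector, and the norm is monotone on
nonnegative vectors. The rounding contributes at most ‖A1‖ ≤ λ√n. -/
theorem PowerState.step (hA : A.PosSemidef) (hnn : ∀ i j, 0 ≤ A i j)
    (hpos : 0 < topEigenvalue A) {F η : ℝ} (hF : 0 < F) (hη : 0 < η) (hη' : η ≤ 1 / 32)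
    {u : Fin n → ℝ} (hu : ∀ i, 0 ≤ u i) (hu' : ∀ i, topEigenvalue A * u i ≤ A.mulVec u i)
    {t : ℕ} {z out : Fin n → ℝ} {best : ℝ} (h : PowerState A F η u t z out best)
    (hz : ∀ i, 0 ≤ z i) (hz1 : euclNorm z = 1) {w y : Fin n → ℝ} (hw : ∀ i, F * z i ≤ w i)
    (hw' : ∀ i, w i ≤ F * z i + 1) (hy : ∀ i, (1 - η) * A.mulVec w i ≤ y i)
    (hy' : ∀ i, y i ≤ (1 + η) * A.mulVec w i) {s : ℝ} (hs : s = euclNorm y) (hs0 : 0 < s) :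
    PowerState A F η u (t + 1) (fun i => y i / s) (if best < s then z else out)
      (if best < s then s else best) where
  grow := by
    by_cases hb : (1 - 2 * η) * topEigenvalue A * F ≤ if best < s then s else best
    · exact Or.inl hb
    right
    rw [not_le] at hb
    have hsb : s ≤ if best < s then s else best := by split_ifs <;> linarith
    have hbb : best ≤ if best < s then s else best := by split_ifs <;> linarith
    have hg : (1 + η) ^ t ≤ √n * (u ⬝ᵥ z) := by
      rcases h.grow with h | h
      · exact absurd (hbb.trans_lt hb) (not_lt.2 h)
      · exact h
    have h1 : (1 - η) * (topEigenvalue A * (F * (u ⬝ᵥ z))) ≤ u ⬝ᵥ y := by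
      calc (1 - η) * (topEigenvalue A * (F * (u ⬝ᵥ z)))
          ≤ (1 - η) * (u ⬝ᵥ A.mulVec w) := by
            refine mul_le_mul_of_nonneg_left ?_ (by linarith)
            rw [dotProduct_mulVec_symm hA.isHermitian]
            simp only [dotProduct, Finset.mul_sum]
            refine Finset.sum_le_sum fun i _ => ?_
            calc topEigenvalue A * (F * (u i * z i)) = (topEigenvalue A * u i) * (F * z i) := by ring
              _ ≤ (topEigenvalue A * u i) * w i :=
                mul_le_mul_of_nonneg_left (hw i) (mul_nonneg hpos.le (hu i))
              _ ≤ _ := mul_le_mul_of_nonneg_right (hu' i)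
                ((mul_nonneg hF.le (hz i)).trans (hw i))
        _ ≤ u ⬝ᵥ y := by
            simp only [dotProduct, Finset.mul_sum]
            refine Finset.sum_le_sum fun i _ => ?_
            calc (1 - η) * (u i * A.mulVec w i) = u i * ((1 - η) * A.mulVec w i) := by ring
              _ ≤ u i * y i := mul_le_mul_of_nonneg_left (hy i) (hu i)
    have h2 : u ⬝ᵥ (fun i => y i / s) = (u ⬝ᵥ y) / s := by
      simp only [dotProduct, Finset.sum_div]
      exact Finset.sum_congr rfl fun i _ => by ring
    rw [h2, ← mul_div_assoc, le_div_iff₀ hs0, pow_succ]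
    have hsl : s ≤ (1 - 2 * η) * topEigenvalue A * F := hsb.trans hb.le
    have hp : 0 < (1 + η) ^ t := by positivity
    calc (1 + η) ^ t * (1 + η) * s
        ≤ (1 + η) ^ t * (1 + η) * ((1 - 2 * η) * topEigenvalue A * F) := by gcongr
      _ ≤ (1 + η) ^ t * ((1 - η) * topEigenvalue A * F) := by
          rw [mul_assoc]
          refine mul_le_mul_of_nonneg_left ?_ hp.le
          have : (1 + η) * (1 - 2 * η) ≤ 1 - η := by nlinarith
          calc (1 + η) * ((1 - 2 * η) * topEigenvalue A * F)
              = ((1 + η) * (1 - 2 * η)) * (topEigenvalue A * F) := by ring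
            _ ≤ (1 - η) * (topEigenvalue A * F) := by gcongr
            _ = _ := by ring
      _ ≤ (√n * (u ⬝ᵥ z)) * ((1 - η) * topEigenvalue A * F) := by
          refine mul_le_mul_of_nonneg_right hg ?_
          have : 0 ≤ 1 - η := by linarith
          positivity
      _ = √n * ((1 - η) * (topEigenvalue A * (F * (u ⬝ᵥ z)))) := by ring
      _ ≤ √n * (u ⬝ᵥ y) := by gcongr
  out := by
    by_cases hb : best < s
    · right
      simp only [hb, if_true]
      refine ⟨hz1, ?_⟩
      have hy0 : ∀ i, 0 ≤ y i := fun i => by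
        refine le_trans (mul_nonneg (by linarith) ?_) (hy i)
        simp only [Matrix.mulVec, dotProduct]
        exact Finset.sum_nonneg fun j _ => mul_nonneg (hnn i j)
          ((mul_nonneg hF.le (hz j)).trans (hw j))
      have e : WithLp.toLp 2 ((1 + η) • A.mulVec (F • z + fun _ => 1)) =
          (1 + η) • (F • WithLp.toLp 2 (A.mulVec z) +
            WithLp.toLp 2 (A.mulVec fun _ => (1 : ℝ))) := by
        rw [Matrix.mulVec_add, Matrix.mulVec_smul]
        rfl
      calc s = euclNorm y := hs
        _ ≤ euclNorm ((1 + η) • A.mulVec (F • z + fun _ => 1)) := by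
            refine euclNorm_mono hy0 fun i => (hy' i).trans ?_
            simp only [Pi.smul_apply, smul_eq_mul]
            refine mul_le_mul_of_nonneg_left (mulVec_mono hnn (fun j => ?_) i) (by linarith)
            simpa using hw' j
        _ ≤ (1 + η) * (F * euclNorm (A.mulVec z) + euclNorm (A.mulVec fun _ => (1 : ℝ))) := by
            rw [euclNorm, e, norm_smul, Real.norm_of_nonneg (by linarith)]
            refine mul_le_mul_of_nonneg_left ((norm_add_le _ _).trans_eq ?_) (by linarith)
            rw [norm_smul, Real.norm_of_nonneg hF.le]
        _ ≤ _ := by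
            refine mul_le_mul_of_nonneg_left (add_le_add_right ?_ _) (by linarith)
            rw [← euclNorm_one (n := n)]
            exact euclNorm_mulVec_le hA hpos _
    · simp only [hb, if_false]
      exact h.out

/-- Growth beyond √n would contradict ⟨u, z⟩ ≤ 1, so the best length is at least (1 - 16E)λF. As √n
= EF, dividing its upper bound by F gives (1 - 16E)λ ≤ (1 + 8E)(‖A out‖ + Eλ), hence ‖A out‖ ≥ (1 -
32E)λ. Squaring and applying `mulVec_sq_le` leaves room up to the loss 256E = ε. -/
theorem PowerState.rayleigh (hA : A.PosSemidef) (hpos : 0 < topEigenvalue A) {F E : ℝ}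
    (hF : 0 < F) (hE : 0 < E) (hE' : E ≤ 1 / 256) (hEF : √n = E * F) {u : Fin n → ℝ}
    (hu : euclNorm u = 1) {t : ℕ} {z out : Fin n → ℝ} {best : ℝ}
    (h : PowerState A F (8 * E) u t z out best) (hz1 : euclNorm z = 1)
    (ht : √n < (1 + 8 * E) ^ t) :
    euclNorm out = 1 ∧
      (1 - 256 * E) * topEigenvalue A ≤ out ⬝ᵥ A.mulVec out := by
  have hb : (1 - 2 * (8 * E)) * topEigenvalue A * F ≤ best := by
    refine h.grow.resolve_right fun h => ?_
    have := dotProduct_le_euclNorm u z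
    rw [hu, hz1, mul_one] at this
    have := mul_le_mul_of_nonneg_left this (Real.sqrt_nonneg (n : ℝ))
    linarith
  have h16 : 0 < 1 - 2 * (8 * E) := by linarith
  have hb0 : best ≠ 0 := by
    have : 0 < (1 - 2 * (8 * E)) * topEigenvalue A * F := by positivity
    linarith
  obtain ⟨h1, h2⟩ := h.out.resolve_left hb0
  refine ⟨h1, ?_⟩
  set N := euclNorm (A.mulVec out) with hN
  set l := topEigenvalue A with hl
  have h3 : (1 - 2 * (8 * E)) * l ≤ (1 + 8 * E) * (N + l * E) := by
    refine le_of_mul_le_mul_right ?_ hF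
    calc _ ≤ best := hb
      _ ≤ _ := h2
      _ = _ := by rw [hEF]; ring
  have h4 : (1 - 32 * E) * l ≤ N := by
    have : (1 + 8 * E) * ((1 - 32 * E) * l) ≤ (1 + 8 * E) * N := by nlinarith [mul_pos hE hpos]
    exact le_of_mul_le_mul_left this (by linarith)
  have h5 := mulVec_sq_le hA hpos out
  rw [← euclNorm_sq, ← hN] at h5
  have h6 : ((1 - 32 * E) * l) ^ 2 ≤ N ^ 2 :=
    pow_le_pow_left₀ (mul_nonneg (by linarith) hpos.le) h4 2
  have h7 : l * ((1 - 256 * E) * l) ≤ l * (out ⬝ᵥ A.mulVec out) := by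
    refine le_trans ?_ (h6.trans h5)
    nlinarith [mul_pos hpos hpos, mul_pos hE (mul_pos hpos hpos)]
  exact le_of_mul_le_mul_left h7 hpos

/-- The entries of u lie in [0, 1], so Σ u_i ≥ Σ u_i² = 1. A best length of 0 records that no vector
has been stored yet. -/
theorem PowerState.init [NeZero n] {F η : ℝ} {u : Fin n → ℝ} (hu : ∀ i, 0 ≤ u i)
    (hu1 : euclNorm u = 1) (out : Fin n → ℝ) :
    PowerState A F η u 0 (fun _ => 1 / √n) out 0 where
  grow := by
    right
    have hn : 0 < √(n : ℝ) := Real.sqrt_pos.2 (by exact_mod_cast NeZero.pos n)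
    have h1 : ∀ i, u i ≤ 1 := fun i => by
      have : ‖(WithLp.toLp 2 u : EuclideanSpace ℝ (Fin n)) i‖ ≤ euclNorm u := by
        exact PiLp.norm_apply_le _ i
      rw [hu1] at this
      exact (le_abs_self _).trans this
    have h2 : 1 ≤ ∑ i, u i := by
      calc (1 : ℝ) = euclNorm u ^ 2 := by rw [hu1]; norm_num
        _ = ∑ i, u i * u i := euclNorm_sq u
        _ ≤ ∑ i, u i := Finset.sum_le_sum fun i _ => mul_le_of_le_one_left (hu i) (h1 i)
    rw [pow_zero]
    calc 1 ≤ ∑ i, u i := h2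
      _ = √n * (u ⬝ᵥ fun _ => 1 / √n) := by
        simp only [dotProduct, ← Finset.sum_mul]
        field_simp
  out := Or.inl rfl

end power

/-! ### Counting votes in buckets -/

/-- The bucket of a positive real number on the logarithmic scale of width `4 * E`. -/
def bucket (E a : ℝ) : ℕ := ⌊Real.log a / (4 * E) + 1⌋₊

/-- The lower of the two buckets that contain the good approximations of `V`. -/
def goodBucket (E V : ℝ) : ℕ := ⌊Real.log V / (4 * E) + 1 / 2⌋₊

/-- A relative error of E moves the logarithm by at most 2E. The good answers thus fill a window of
length 4E, exactly one bucket width, which meets at most two consecutive buckets. -/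
theorem bucket_good {E a V : ℝ} (hE : 0 < E) (hE' : E ≤ 1 / 256) (hV : 1 ≤ V)
    (h : |a - V| ≤ E * V) : bucket E a = goodBucket E V ∨ bucket E a = goodBucket E V + 1 := by
  rw [abs_le] at h
  have hV0 : 0 < V := by linarith
  have hl : 0 ≤ Real.log V := Real.log_nonneg hV
  have ha : (1 - E) * V ≤ a := by linarith
  have ha' : a ≤ (1 + E) * V := by linarith
  have ha0 : 0 < a := lt_of_lt_of_le (mul_pos (by linarith) hV0) ha
  have h1 : Real.log V - 2 * E ≤ Real.log a := by
    have e : Real.log ((1 - E) * V) ≤ Real.log a :=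
      Real.log_le_log (mul_pos (by linarith) hV0) ha
    rw [Real.log_mul (by linarith) hV0.ne'] at e
    have := Real.one_sub_inv_le_log_of_pos (x := 1 - E) (by linarith)
    have h3 : (1 - E)⁻¹ ≤ 1 + 2 * E := by
      rw [inv_le_comm₀ (by linarith) (by linarith), inv_le_iff_one_le_mul₀ (by linarith)]
      nlinarith
    linarith
  have h2 : Real.log a ≤ Real.log V + 2 * E := by
    have e : Real.log a ≤ Real.log ((1 + E) * V) := Real.log_le_log ha0 ha'
    rw [Real.log_mul (by linarith) hV0.ne'] at e
    have := Real.log_le_sub_one_of_pos (x := 1 + E) (by linarith)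
    linarith
  have h4 : Real.log V / (4 * E) + 1 / 2 ≤ Real.log a / (4 * E) + 1 := by
    have : (Real.log V - 2 * E) / (4 * E) ≤ Real.log a / (4 * E) := by gcongr
    rw [sub_div, show 2 * E / (4 * E) = 1 / 2 by field_simp; norm_num] at this
    linarith
  have h5 : Real.log a / (4 * E) + 1 ≤ Real.log V / (4 * E) + 1 / 2 + 1 := by
    have : Real.log a / (4 * E) ≤ (Real.log V + 2 * E) / (4 * E) := by gcongr
    rw [add_div, show 2 * E / (4 * E) = 1 / 2 by field_simp; norm_num] at this
    linarith
  -- Since V ≥ 1, the rounded quantity is nonnegative, so truncation at zero does not interfere with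
  -- the shift of the floor by one.
  have h0 : 0 ≤ Real.log V / (4 * E) + 1 / 2 := by positivity
  have h6 := Nat.floor_mono h4
  have h7 := Nat.floor_mono h5
  rw [Nat.floor_add_one h0] at h7
  unfold bucket goodBucket
  omega

/-- Even a bucket one above the two good ones yields a logarithm within 6E of log V. For E ≤ 1/256,
a factor between exp(-6E) and exp(6E) is a relative error of at most 8E. -/
theorem exp_bucket {E V : ℝ} (hE : 0 < E) (hE' : E ≤ 1 / 256) (hV : 1 ≤ V) {j : ℕ}
    (hj : goodBucket E V ≤ j) (hj' : j ≤ goodBucket E V + 2) :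
    (1 - 8 * E) * V ≤ Real.exp (((j : ℝ) - 1) * (4 * E)) ∧
      Real.exp (((j : ℝ) - 1) * (4 * E)) ≤ (1 + 8 * E) * V := by
  have hV0 : 0 < V := by linarith
  have hl : 0 ≤ Real.log V := Real.log_nonneg hV
  have h0 : 0 ≤ Real.log V / (4 * E) + 1 / 2 := by positivity
  have h1 := Nat.floor_le h0
  have h2 := Nat.lt_floor_add_one (Real.log V / (4 * E) + 1 / 2)
  change ((goodBucket E V : ℕ) : ℝ) ≤ _ at h1
  change _ < ((goodBucket E V : ℕ) : ℝ) + 1 at h2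
  have h3 : (goodBucket E V : ℝ) ≤ j := by exact_mod_cast hj
  have h4 : (j : ℝ) ≤ goodBucket E V + 2 := by exact_mod_cast hj'
  have e : Real.log V / (4 * E) * (4 * E) = Real.log V := by field_simp
  have hlo : Real.log V - 6 * E ≤ ((j : ℝ) - 1) * (4 * E) := by nlinarith
  have hhi : ((j : ℝ) - 1) * (4 * E) ≤ Real.log V + 6 * E := by nlinarith
  constructor
  · calc (1 - 8 * E) * V ≤ Real.exp (-(6 * E)) * V := by
          gcongr
          have := Real.add_one_le_exp (-(6 * E))
          linarith
      _ = Real.exp (Real.log V - 6 * E) := by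
          rw [sub_eq_add_neg, Real.exp_add, Real.exp_log hV0, mul_comm]
      _ ≤ _ := Real.exp_le_exp.2 hlo
  · calc _ ≤ Real.exp (Real.log V + 6 * E) := Real.exp_le_exp.2 hhi
      _ = Real.exp (6 * E) * V := by rw [Real.exp_add, Real.exp_log hV0, mul_comm]
      _ ≤ (1 + 8 * E) * V := by
          gcongr
          have := Real.exp_bound_div_one_sub_of_interval (x := 6 * E) (by positivity) (by linarith)
          refine this.trans ?_
          rw [div_le_iff₀ (by linarith)]
          nlinarith

/-- The state of the vote after `k` ballots, each of which names two consecutive candidates `b`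
and `b + 1`: candidates that share no ballot with `J + 1` do not get more votes than the ballots
missed by `J + 1`; and `res` has a majority if `J + 1` has. -/
structure Vote (r J k : ℕ) (cnt : ℕ → ℕ) (res : ℕ) : Prop where
  disjoint : ∀ j, j < J ∨ J + 2 < j → cnt j + cnt (J + 1) ≤ k
  majority : r < 2 * cnt (J + 1) → r < 2 * cnt res

/-- The votes after a ballot for `b` and `b + 1`. -/
def ballot (cnt : ℕ → ℕ) (b j : ℕ) : ℕ := if j = b ∨ j = b + 1 then cnt j + 1 else cnt j

/-- Two consecutive candidates cannot include both J + 1 and a candidate outside J, …, J + 2, so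
each ballot raises the sum of these two counts by at most one. If the result is kept, neither named
candidate has a majority. A majority for J + 1 is then an old one, and the old result still has its
majority because counts never decrease. -/
theorem Vote.step {r J k : ℕ} {cnt : ℕ → ℕ} {res : ℕ} (h : Vote r J k cnt res) (b : ℕ) {res' : ℕ}
    (h' : (r < 2 * ballot cnt b (b + 1) ∧ res' = b + 1) ∨
      (¬ r < 2 * ballot cnt b (b + 1) ∧ r < 2 * ballot cnt b b ∧ res' = b) ∨
      (¬ r < 2 * ballot cnt b (b + 1) ∧ ¬ r < 2 * ballot cnt b b ∧ res' = res)) :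
    Vote r J (k + 1) (ballot cnt b) res' where
  disjoint j hj := by
    have := h.disjoint j hj
    unfold ballot
    split_ifs <;> omega
  majority hJ := by
    rcases h' with ⟨h1, rfl⟩ | ⟨-, h1, rfl⟩ | ⟨h1, h2, rfl⟩
    · exact h1
    · exact h1
    · have h3 : ballot cnt b (J + 1) = cnt (J + 1) := by
        unfold ballot
        rw [if_neg]
        rintro (h | h)
        · rw [h] at hJ; exact h2 hJ
        · rw [h] at hJ; exact h1 hJ
      rw [h3] at hJ
      have := h.majority hJ
      unfold ballot
      split_ifs <;> omega

/-- Two candidates with more than half of the `r` ballots each must share a ballot, and J + 1 shares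
ballots only with J and J + 2. -/
theorem Vote.result {r J : ℕ} {cnt : ℕ → ℕ} {res : ℕ} (h : Vote r J r cnt res)
    (hJ : r < 2 * cnt (J + 1)) : J ≤ res ∧ res ≤ J + 2 := by
  have := h.majority hJ
  by_contra hc
  have := h.disjoint res (by omega)
  omega

namespace RealRAM

attribute [simp] setInt_int setReal_real NatOp.eval RealOp.eval RealFun.eval Mem.getInt Mem.getReal
  Mem.index Instr.effect Instr.IsDet Instr.intDst Instr.realDst Cmd.WritesInt Cmd.WritesReal block

/-! ### The programs

Integer variables: `0` is `n`, `1` is `d`, `2` is zero, `3` is one, `4` is the number of the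
current copy and `5` its square, `12` is the number of copies per iteration, `15` is the index of
a point, `16` counts coordinates, `17` is the total weight, `18` is the number of coordinates
written so far, `26` is `n` times the number of finished iterations. The integer array `24` holds
the ballots, `25` the elected buckets. Real arrays: `1` are the points, `2` is the output, `5` the
current vector, `6` the approximate product; real variables: `3` is the accuracy `E`, `4` the scale
`F`, `12` the width `4 * E` of a bucket, `13` is zero. -/

/-- A cell of an array, indexed by an integer variable. -/
abbrev cell (a i : ℕ) : Ref := ⟨a, .var i⟩

/-- Compute in the integer variable `21` the address in the current copy of the cell whose index is
in the integer variable `s`. -/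
def copyAddress (s : ℕ) : List Instr :=
  [.natOp .add (var 21) (var s) (var 4), .natOp .mul (var 21) (var 21) (var 21),
    .natOp .add (var 21) (var 21) (var s)]

attribute [simp] copyAddress

/-- Append one coordinate to the points in the copy. -/
def copyEntry : Cmd :=
  .seq (block (.natOp .mod (var 20) (var 16) (var 1))
      (.natOp .add (var 20) (var 20) (var 28) :: copyAddress 18))
    (.seq (.instr (.realOp .add (cell 41 21) (cell 1 20) (var 13)))
      (.instr (.natOp .add (var 18) (var 18) (var 3))))

/-- Append the current point to the points in the copy, as often as its weight says. -/
def addPoint : Cmd :=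
  .seq (block (.realOp .mul (var 9) (cell 5 15) (var 4))
      [.floor (var 19) (var 9), .natOp .add (var 19) (var 19) (var 3),
        .natOp .add (var 17) (var 17) (var 19), .natOp .mul (var 19) (var 19) (var 1),
        .natOp .mul (var 28) (var 15) (var 1)])
    (forLoop 16 19 copyEntry)

/-- Write the parameters of the weighted instance to the copy. -/
def writeParams : Cmd :=
  .seq (.instr (.natOp .add (cell 40 5) (var 17) (var 2)))
    (.seq (.instr (.natOp .add (cell 41 5) (var 1) (var 2)))
      (.seq (.instr (.realOp .add (cell 40 5) (var 3) (var 13)))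
        (.seq (block (.cast (var 9) (var 17)) (.cast (var 10) (var 3) :: copyAddress 3))
          (.instr (.realOp .div (cell 40 21) (var 10) (var 9))))))

/-- Write the weighted instance to the copy. -/
def fillCopy : Cmd :=
  .seq (block (.setNat (var 17) 0) [.setNat (var 18) 0]) (.seq (forLoop 15 0 addPoint) writeParams)

/-- Write one coordinate of the query to the copy. -/
def queryEntry : Cmd :=
  .seq (block (.natOp .add (var 20) (var 28) (var 16)) (copyAddress 16))
    (.instr (.realOp .add (cell 42 21) (cell 1 20) (var 13)))

/-- Write the current point to the copy, as a query. -/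
def writePoint : Cmd :=
  .seq (.instr (.natOp .mul (var 28) (var 15) (var 1))) (forLoop 16 1 queryEntry)

/-- Count a vote of the current point for the bucket in the integer variable `22`. -/
def countVote : Cmd :=
  .seq (block (.natOp .add (var 21) (var 22) (var 23))
      [.natOp .mul (var 21) (var 21) (var 21), .natOp .add (var 21) (var 21) (var 22),
        .natOp .add (cell 24 21) (cell 24 21) (var 3),
        .natOp .add (var 20) (cell 24 21) (cell 24 21)])
    (.ite (.natLt (var 12) (var 20)) (.instr (.natOp .add (cell 25 15) (var 22) (var 2)))
      (.instr (.setNat (var 20) 0)))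

/-- Find the bucket of the answer to the query, and cast the votes. -/
def castBallot : Cmd :=
  .seq (block (.cast (var 9) (var 17))
      [.realOp .mul (var 9) (var 9) (cell 43 5), .realFun .log (var 9) (var 9),
        .realOp .div (var 9) (var 9) (var 12), .cast (var 10) (var 3),
        .realOp .add (var 9) (var 9) (var 10), .floor (var 22) (var 9),
        .natOp .add (var 23) (var 26) (var 15)])
    (.seq countVote (.seq (.instr (.natOp .add (var 22) (var 22) (var 3))) countVote))

/-- Query the density of the current point. -/
def queryPoint (query : Cmd) : Cmd := .seq writePoint (.seq query.reloc castBallot)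

/-- Move on to the next copy. -/
def nextCopy : Cmd :=
  block (.natOp .add (var 4) (var 4) (var 3)) [.natOp .mul (var 5) (var 4) (var 4)]

/-- Query the densities of all points in a new copy. -/
def queryCopy (prep query : Cmd) : Cmd :=
  .seq fillCopy (.seq prep.reloc (.seq (forLoop 15 0 (queryPoint query)) nextCopy))

/-- Compute the approximate product from the elected buckets, and its squared norm. -/
def product : Cmd :=
  .seq (.instr (.realOp .add (var 7) (var 13) (var 13)))
    (forLoop 15 0 (block (.cast (var 9) (cell 25 15))
      [.cast (var 10) (var 3), .realOp .sub (var 9) (var 9) (var 10),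
        .realOp .mul (var 9) (var 9) (var 12), .realFun .exp (cell 6 15) (var 9),
        .realOp .mul (var 9) (cell 6 15) (cell 6 15), .realOp .add (var 7) (var 7) (var 9)]))

/-- Remember the current vector if its product is longer than all before. -/
def updateBest : Cmd :=
  .ite (.realLt (var 8) (var 7))
    (.seq (.instr (.realOp .add (var 8) (var 7) (var 13)))
      (forLoop 15 0 (.instr (.realOp .add (cell 2 15) (cell 5 15) (var 13)))))
    (.instr (.setNat (var 20) 0))

/-- Pass to the normalized product. -/
def normalize : Cmd :=
  .seq (forLoop 15 0 (.instr (.realOp .div (cell 5 15) (cell 6 15) (var 7))))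
    (.instr (.natOp .add (var 26) (var 26) (var 0)))

/-- One iteration of the power method. -/
def iteration (prep query : Cmd) : Cmd :=
  .seq (forLoop 14 12 (queryCopy prep query))
    (.seq product (.seq (.instr (.realFun .sqrt (var 7) (var 7))) (.seq updateBest normalize)))

/-- Compute the parameters; `a` determines the number of copies. -/
def setParams (a : ℕ) : Cmd :=
  block (.setNat (var 3) 1)
    [.setNat (var 27) 256, .cast (var 9) (var 27), .realOp .div (var 3) (var 0) (var 9),
      .setNat (var 27) 4, .cast (var 9) (var 27), .realOp .mul (var 12) (var 9) (var 3),
      .cast (var 9) (var 0), .realFun .sqrt (var 10) (var 9),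
      .realOp .div (var 4) (var 10) (var 3), .realOp .div (var 11) (var 9) (var 0),
      .realFun .log (var 11) (var 11), .realOp .div (var 9) (var 11) (var 3),
      .floor (var 11) (var 9), .natOp .add (var 11) (var 11) (var 3), .setNat (var 27) a,
      .cast (var 9) (var 27), .realOp .mul (var 9) (var 9) (var 11), .floor (var 12) (var 9),
      .natOp .add (var 12) (var 12) (var 3), .cast (var 9) (var 3),
      .realOp .div (var 9) (var 9) (var 10)]

/-- The eigenvector program. -/
def eigenvectorProgram (prep query : Cmd) (a : ℕ) : Cmd :=
  .seq (.seq (setParams a)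
      (forLoop 15 0 (.instr (.realOp .add (cell 5 15) (var 9) (var 13)))))
    (forLoop 13 11 (iteration prep query))

/-! ### Copies -/

/-- The contents of the copy `q`. -/
def Mem.copy (M : Mem) (q : ℕ) : Mem :=
  ⟨fun a i => M.int (40 + a) (address i q), fun a i => M.real (40 + a) (address i q)⟩

theorem Mem.ext' {M M' : Mem} (h : ∀ a i, M.int a i = M'.int a i)
    (h' : ∀ a i, M.real a i = M'.real a i) : M = M' := by
  cases M; cases M'
  congr
  · exact funext fun a => funext fun i => h a i
  · exact funext fun a => funext fun i => h' a i

theorem copy_frame {A B : ℕ → Prop} {M M' : Mem} (h : EqOff A B M M') (hA : ∀ a, ¬ A (40 + a))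
    (hB : ∀ a, ¬ B (40 + a)) (q : ℕ) : M'.copy q = M.copy q :=
  Mem.ext' (fun a _ => h.1 _ (hA a) _) (fun a _ => h.2 _ (hB a) _)

theorem copy_setInt {M : Mem} {x : Idx} {i q : ℕ} (h : M.index x = address i q) (a v : ℕ) :
    (M.setInt ⟨40 + a, x⟩ v).copy q = (M.copy q).setInt ⟨a, .const i⟩ v := by
  refine Mem.ext' (fun b j => ?_) fun _ _ => rfl
  have e : ∀ N : Mem, N.index (.const i) = i := fun _ => rfl
  simp only [Mem.copy, setInt_int, h, e, Nat.add_left_cancel_iff]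
  refine if_congr (and_congr_right fun _ => ⟨fun h => (address_inj h).1, fun h => by rw [h]⟩) rfl rfl

theorem copy_setReal {M : Mem} {x : Idx} {i q : ℕ} (h : M.index x = address i q) (a : ℕ) (v : ℝ) :
    (M.setReal ⟨40 + a, x⟩ v).copy q = (M.copy q).setReal ⟨a, .const i⟩ v := by
  refine Mem.ext' (fun _ _ => rfl) fun b j => ?_
  have e : ∀ N : Mem, N.index (.const i) = i := fun _ => rfl
  simp only [Mem.copy, setReal_real, h, e, Nat.add_left_cancel_iff]
  refine if_congr (and_congr_right fun _ => ⟨fun h => (address_inj h).1, fun h => by rw [h]⟩) rfl rfl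

theorem copy_setInt_ne {M : Mem} {x : Idx} {i q q' : ℕ} (h : M.index x = address i q)
    (hq : q' ≠ q) (a v : ℕ) : (M.setInt ⟨a, x⟩ v).copy q' = M.copy q' := by
  refine Mem.ext' (fun b j => ?_) fun _ _ => rfl
  simp only [Mem.copy, setInt_int, h]
  rw [if_neg]
  rintro ⟨-, h⟩
  exact hq (address_inj h).2

theorem copy_setReal_ne {M : Mem} {x : Idx} {i q q' : ℕ} (h : M.index x = address i q)
    (hq : q' ≠ q) (a : ℕ) (v : ℝ) : (M.setReal ⟨a, x⟩ v).copy q' = M.copy q' := by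
  refine Mem.ext' (fun _ _ => rfl) fun b j => ?_
  simp only [Mem.copy, setReal_real, h]
  rw [if_neg]
  rintro ⟨-, h⟩
  exact hq (address_inj h).2

/-- The empty memory. -/
def emptyMem : Mem := ⟨fun _ _ => 0, fun _ _ => 0⟩

/-- The memory with the contents `c` in the real array `1`. -/
def pointMem (c : ℕ → ℝ) : Mem := ⟨fun _ _ => 0, fun a j => if a = 1 then c j else 0⟩

/-- The constants of the computation. -/
structure Consts {n d : ℕ} (r : ℕ) (E F : ℝ) (x : Fin n → Fin d → ℝ) (M : Mem) : Prop where
  int0 : M.int 0 0 = n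
  int1 : M.int 1 0 = d
  int2 : M.int 2 0 = 0
  int3 : M.int 3 0 = 1
  int12 : M.int 12 0 = r
  points : ∀ i, M.real 1 i = flatten x i
  real3 : M.real 3 0 = E
  real4 : M.real 4 0 = F
  width : M.real 12 0 = 4 * E
  rzero : M.real 13 0 = 0

/-- The constants, and the number of the current copy; the later copies are empty. -/
structure Current {n d : ℕ} (r : ℕ) (E F : ℝ) (x : Fin n → Fin d → ℝ) (q : ℕ) (M : Mem) : Prop
    extends Consts r E F x M where
  int4 : M.int 4 0 = q
  int5 : M.int 5 0 = q * q
  fresh : ∀ q', q < q' → M.copy q' = emptyMem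

section specs
variable {n d r : ℕ} {E F : ℝ} {x : Fin n → Fin d → ℝ} {q : ℕ} {M M' : Mem} {A B : ℕ → Prop}

theorem Consts.frame (h : Consts r E F x M) (hf : EqOff A B M M')
    (hA : ¬ A 0 ∧ ¬ A 1 ∧ ¬ A 2 ∧ ¬ A 3 ∧ ¬ A 12)
    (hB : ¬ B 1 ∧ ¬ B 3 ∧ ¬ B 4 ∧ ¬ B 12 ∧ ¬ B 13) : Consts r E F x M' where
  int0 := (hf.1 _ hA.1 _).trans h.int0
  int1 := (hf.1 _ hA.2.1 _).trans h.int1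
  int2 := (hf.1 _ hA.2.2.1 _).trans h.int2
  int3 := (hf.1 _ hA.2.2.2.1 _).trans h.int3
  int12 := (hf.1 _ hA.2.2.2.2 _).trans h.int12
  points i := (hf.2 _ hB.1 _).trans (h.points i)
  real3 := (hf.2 _ hB.2.1 _).trans h.real3
  real4 := (hf.2 _ hB.2.2.1 _).trans h.real4
  width := (hf.2 _ hB.2.2.2.1 _).trans h.width
  rzero := (hf.2 _ hB.2.2.2.2 _).trans h.rzero

theorem Current.frame (h : Current r E F x q M) (hf : EqOff A B M M')
    (hA : ¬ A 0 ∧ ¬ A 1 ∧ ¬ A 2 ∧ ¬ A 3 ∧ ¬ A 12)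
    (hB : ¬ B 1 ∧ ¬ B 3 ∧ ¬ B 4 ∧ ¬ B 12 ∧ ¬ B 13) (hA' : ¬ A 4 ∧ ¬ A 5)
    (hc : ∀ q', q < q' → M'.copy q' = M.copy q') :
    Current r E F x q M' where
  toConsts := h.toConsts.frame hf hA hB
  int4 := (hf.1 _ hA'.1 _).trans h.int4
  int5 := (hf.1 _ hA'.2 _).trans h.int5
  fresh q' hq' := (hc q' hq').trans (h.fresh q' hq')

theorem eqOff_setVar (M : Mem) (i v : ℕ) : EqOff (· = i) (fun _ => False) M (M.setVar i v) :=
  eqOff_setInt (by rfl) M v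

theorem Current.setVar (h : Current r E F x q M) {i : ℕ} (hi : 13 ≤ i) (hi' : i < 40) (v : ℕ) :
    Current r E F x q (M.setVar i v) :=
  h.frame (eqOff_setVar M i v) (by omega) (by simp) (by omega)
    fun q' _ => copy_frame (eqOff_setVar M i v) (by omega) (by simp) q'

theorem copy_setVar {i : ℕ} (hi : i < 40) (v q : ℕ) : (M.setVar i v).copy q = M.copy q :=
  copy_frame (eqOff_setVar M i v) (by omega) (by simp) q

/-! ### Filling a copy -/

theorem flatten_apply {n d : ℕ} (x : Fin n → Fin d → ℝ) (i : Fin n) (j : Fin d) :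
    flatten x (i * d + j) = x i j := by
  have h : (i : ℕ) * d + j < n * d := by
    calc (i : ℕ) * d + j < i * d + d := by omega
      _ = (i + 1) * d := by ring
      _ ≤ n * d := Nat.mul_le_mul_right d i.2
  unfold flatten
  rw [dif_pos h]
  have : (⟨i * d + j, h⟩ : Fin (n * d)) = finProdFinEquiv (i, j) := by
    apply Fin.ext; simp [finProdFinEquiv]; ring
  rw [this, Equiv.symm_apply_apply]

theorem flatten_of_le {n d a : ℕ} (x : Fin n → Fin d → ℝ) (h : n * d ≤ a) : flatten x a = 0 := by
  unfold flatten
  rw [dif_neg (by omega)]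

/-- Appending `w` copies of one point repeats its coordinates periodically, so the offset modulo `d`
selects the coordinate to be written. -/
theorem flatten_append {m w n d : ℕ} (hd : 1 ≤ d) (x : Fin n → Fin d → ℝ) (X : Fin m → Fin d → ℝ) (i : Fin n) (a : ℕ) :
    flatten (Fin.append X fun _ : Fin w => x i) a =
      if m * d ≤ a ∧ a < m * d + w * d then flatten x (i * d + (a - m * d) % d) else flatten X a := by
  by_cases h : a < (m + w) * d
  · obtain ⟨b, c, rfl⟩ : ∃ (b : Fin (m + w)) (c : Fin d), a = b * d + c :=
      ⟨⟨a / d, Nat.div_lt_of_lt_mul (by rwa [mul_comm])⟩, ⟨a % d, Nat.mod_lt _ hd⟩,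
        (Nat.div_add_mod' a d).symm⟩
    rw [flatten_apply]
    induction b using Fin.addCases with
    | left b =>
      have : (b : ℕ) * d + c < m * d := by
        calc (b : ℕ) * d + c < b * d + d := by omega
          _ = (b + 1) * d := by ring
          _ ≤ m * d := Nat.mul_le_mul_right d b.2
      rw [if_neg (by simp; omega)]
      simp only [Fin.append_left, Fin.val_castAdd, flatten_apply]
    | right b =>
      have e : ((Fin.natAdd m b : Fin (m + w)) : ℕ) * d + c = m * d + (b * d + c) := by
        simp; ring
      rw [e, if_pos ⟨by omega, by
        have : (b : ℕ) * d + c < w * d := by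
          calc (b : ℕ) * d + c < b * d + d := by omega
            _ = (b + 1) * d := by ring
            _ ≤ w * d := Nat.mul_le_mul_right d b.2
        omega⟩]
      rw [Nat.add_sub_cancel_left, mul_comm (b : ℕ) d, Nat.mul_add_mod, Nat.mod_eq_of_lt c.2, flatten_apply, Fin.append_right]
  · have : ¬ (m * d ≤ a ∧ a < m * d + w * d) := by rw [← add_mul]; omega
    rw [if_neg this, flatten_of_le _ (by omega), flatten_of_le]
    rw [add_mul] at h; omega

/-- The state while a copy is being filled. -/
structure Filling {n d : ℕ} (r : ℕ) (E F : ℝ) (x : Fin n → Fin d → ℝ) (q : ℕ) (c : ℕ → ℝ)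
    (pos : ℕ) (M : Mem) : Prop extends Current r E F x q M where
  contents : M.copy q = pointMem c
  pos : M.int 18 0 = pos

theorem Filling.frame {c : ℕ → ℝ} {pos : ℕ} (h : Filling r E F x q c pos M)
    (hf : EqOff A B M M')
    (hA : ¬ A 0 ∧ ¬ A 1 ∧ ¬ A 2 ∧ ¬ A 3 ∧ ¬ A 12)
    (hB : ¬ B 1 ∧ ¬ B 3 ∧ ¬ B 4 ∧ ¬ B 12 ∧ ¬ B 13) (hA' : ¬ A 4 ∧ ¬ A 5 ∧ ¬ A 18)
    (hA'' : ∀ a, ¬ A (40 + a)) (hB' : ∀ a, ¬ B (40 + a)) :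
    Filling r E F x q c pos M' where
  toCurrent := h.toCurrent.frame hf hA hB ⟨hA'.1, hA'.2.1⟩ fun q' _ => copy_frame hf hA'' hB' q'
  contents := (copy_frame hf hA'' hB' q).trans h.contents
  pos := (hf.1 _ hA'.2.2 _).trans h.pos

theorem sure_copyEntry {c : ℕ → ℝ} {pos e b : ℕ} (h : Filling r E F x q c pos M)
    (he : M.int 16 0 = e) (hb : M.int 28 0 = b) :
    Sure copyEntry 13 M fun M' => Filling r E F x q
      (Function.update c pos (flatten x (b + e % d))) (pos + 1) M' ∧ M'.int 28 0 = b := by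
  refine Sure.seq (t₁ := 9) (t₂ := 3)
    (Q := fun M₁ => Filling r E F x q c pos M₁ ∧ M₁.int 28 0 = b ∧ M₁.int 20 0 = b + e % d ∧
      M₁.int 21 0 = address pos q) ?_ ?_
  · refine (sure_block _ _ (by simp) M).frame.mono ?_
    rintro M₁ ⟨h₁, hf⟩
    refine ⟨h.frame hf ?_ ?_ ?_ ?_ ?_, ?_, ?_, ?_⟩
    any_goals simp; try omega
    · rw [hf.1 _ (by simp), hb]
    · simp [h₁, he, hb, h.int1, add_comm]
    · simp [h₁, h.pos, h.int4, address]
  · rintro M₁ ⟨h₁, hb₁, h20, h21⟩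
    refine Sure.seq (t₁ := 1) (t₂ := 1) (sure_instr (by trivial) M₁) ?_
    rintro M₂ rfl
    refine (sure_instr (by trivial) _).mono ?_
    rintro M₃ rfl
    have hix : M₁.index (.var 21) = address pos q := h21
    have e₁ : (Instr.realOp .add (cell 41 21) (cell 1 20) (var 13)).effect M₁ =
        M₁.setReal (cell 41 21) (flatten x (b + e % d)) := by
      simp [h20, h₁.points, h₁.rzero]
    have e₂ : (Instr.natOp .add (var 18) (var 18) (var 3)).effect
        (M₁.setReal (cell 41 21) (flatten x (b + e % d))) =
        (M₁.setReal (cell 41 21) (flatten x (b + e % d))).setVar 18 (pos + 1) := by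
      simp [h₁.pos, h₁.int3]
    rw [e₁, e₂]
    have hc : ((M₁.setReal (cell 41 21) (flatten x (b + e % d))).setVar 18 (pos + 1)).copy q =
        pointMem (Function.update c pos (flatten x (b + e % d))) := by
      rw [copy_setVar (by norm_num), copy_setReal (a := 1) hix, h₁.contents]
      refine Mem.ext' (fun _ _ => rfl) fun a i => ?_
      by_cases ha : a = 1 <;> by_cases hi : i = pos <;> simp [pointMem, ha, hi]
    refine ⟨⟨(h₁.toCurrent.frame (A := fun _ => False) (B := (· = 41)) (eqOff_setReal (by rfl) _ _)
      (by simp) (by simp) (by simp) fun q' hq' => copy_setReal_ne hix (by omega) _ _).setVar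
        (by norm_num) (by norm_num) _, hc, by simp⟩, by simpa using hb₁⟩

end specs

section specs
variable {n d r : ℕ} {E F : ℝ} {x : Fin n → Fin d → ℝ} {q : ℕ} {M M' : Mem} {A B : ℕ → Prop}

theorem Filling.setVar {c : ℕ → ℝ} {pos : ℕ} (h : Filling r E F x q c pos M) {i : ℕ}
    (hi : 13 ≤ i) (hi' : i < 40) (hi18 : i ≠ 18) (v : ℕ) :
    Filling r E F x q c pos (M.setVar i v) :=
  h.frame (eqOff_setVar M i v) (by omega) (by simp) (by omega) (by omega) (by simp)

theorem Current.setIntCopy (h : Current r E F x q M) {y : Idx} {i : ℕ}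
    (hy : M.index y = address i q) (a v : ℕ) : Current r E F x q (M.setInt ⟨40 + a, y⟩ v) :=
  h.frame (A := (· = 40 + a)) (B := fun _ => False) (eqOff_setInt (by rfl) _ _) (by omega)
    (by simp) (by omega) fun _ _ => copy_setInt_ne hy (by omega) _ _

theorem Current.setRealCopy (h : Current r E F x q M) {y : Idx} {i : ℕ}
    (hy : M.index y = address i q) (a : ℕ) (v : ℝ) :
    Current r E F x q (M.setReal ⟨40 + a, y⟩ v) :=
  h.frame (A := fun _ => False) (B := (· = 40 + a)) (eqOff_setReal (by rfl) _ _) (by simp)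
    (by omega) (by simp) fun _ _ => copy_setReal_ne hy (by omega) _ _

/-- The state while a copy is being filled, when the points `0`, …, `i - 1` have been dealt with;
the point `l` is written `w l` times. -/
def FilledUpTo {n d : ℕ} (r : ℕ) (E F : ℝ) (x : Fin n → Fin d → ℝ) (q : ℕ) (z : Fin n → ℝ)
    (w : Fin n → ℕ) (i : ℕ) (M : Mem) : Prop :=
  (∀ l : Fin n, M.real 5 l = z l) ∧ ∃ (m : ℕ) (X : Fin m → Fin d → ℝ),
    Filling r E F x q (flatten X) (m * d) M ∧ M.int 17 0 = m ∧
      ∀ g : (Fin d → ℝ) → ℝ, ∑ a, g (X a) = ∑ l : Fin n, if (l : ℕ) < i then w l * g (x l) else 0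

theorem sure_addPoint (hd : 1 ≤ d) {z : Fin n → ℝ} {w : Fin n → ℕ}
    (hw : ∀ l, w l = ⌊z l * F⌋₊ + 1) (i : Fin n) (h : FilledUpTo r E F x q z w i M)
    (hi : M.int 15 0 = i) :
    Sure addPoint (16 * (w i * d) + 15) M (FilledUpTo r E F x q z w (i + 1)) := by
  obtain ⟨hz, m, X, hX, h17, hsum⟩ := h
  have key : Sure addPoint (11 + (∑ _e ∈ Finset.range (w i * d), (13 + 3) + 3) + 1) M fun M' =>
      Filling r E F x q (flatten (Fin.append X fun _ : Fin (w i) => x i)) ((m + w i) * d) M' ∧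
        M'.int 17 0 = m + w i := by
    refine Sure.seq (Q := fun M₁ => Filling r E F x q (flatten X) (m * d) M₁ ∧
      M₁.int 17 0 = m + w i ∧ M₁.int 19 0 = w i * d ∧ M₁.int 28 0 = i * d) ?_ ?_
    · refine (sure_block _ _ (by simp) M).frame.mono ?_
      rintro M₁ ⟨h₁, hf⟩
      refine ⟨hX.frame hf ?_ ?_ ?_ ?_ ?_, ?_, ?_, ?_⟩
      any_goals simp; try omega
      all_goals simp [h₁, hi, hX.int1, h17, hz, hX.real4, hX.int3, hw]
    · rintro M₁ ⟨h₁, h17, h19, h28⟩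
      -- The contents of the point array after `e` coordinates have been appended.
      let c : ℕ → ℕ → ℝ := fun e j =>
        if m * d ≤ j ∧ j < m * d + e then flatten x (i * d + (j - m * d) % d) else flatten X j
      have hc0 : c 0 = flatten X := by
        funext j; simp only [c]; rw [if_neg (by omega)]
      have hce : ∀ e, c (e + 1) =
          Function.update (c e) (m * d + e) (flatten x (i * d + e % d)) := by
        intro e
        funext j
        by_cases hj : j = m * d + e
        · subst hj
          simp only [Function.update_self, c]
          rw [if_pos ⟨by omega, by omega⟩, Nat.add_sub_cancel_left]
        · rw [Function.update_of_ne hj]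
          exact if_congr (by omega) rfl rfl
      have hcw : c (w i * d) = flatten (Fin.append X fun _ : Fin (w i) => x i) := by
        funext j; rw [flatten_append hd]
      have := sure_forLoop (i := 16) (n := 19) (c := copyEntry) (by simp [copyEntry])
        (by simp [copyEntry]) (by simp [copyEntry]) (by norm_num) (by norm_num) (w i * d)
        (fun _ => 13) (fun e M => Filling r E F x q (c e) (m * d + e) M ∧ M.int 28 0 = i * d)
        (fun e _ M he _ _ hM => (sure_copyEntry hM.1 he hM.2).mono fun M' hM' => by
          refine ⟨?_, by simpa using hM'.2⟩
          rw [hce]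
          exact hM'.1.setVar (by norm_num) (by norm_num) (by norm_num) _)
        M₁ h19 h₁.int3 ⟨by rw [hc0]; exact h₁.setVar (by norm_num) (by norm_num) (by norm_num) _,
          by simpa using h28⟩
      refine this.frame.mono ?_
      rintro M₂ ⟨⟨hM₂, -⟩, hf⟩
      rw [hcw, ← add_mul] at hM₂
      exact ⟨hM₂, by rw [hf.1 17 (by simp [copyEntry, forLoop]), h17]⟩
  refine key.frame.weaken ?_ ?_
  · simp; omega
  · rintro M' ⟨⟨h₁, h₂⟩, hf⟩
    refine ⟨fun l => by rw [hf.2 5 (by simp [copyEntry, addPoint, forLoop]), hz], m + w i, _, h₁, h₂,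
      fun g => ?_⟩
    rw [Fin.sum_univ_add]
    simp only [Fin.append_left, Fin.append_right, hsum, Finset.sum_const, Finset.card_univ,
      Fintype.card_fin, nsmul_eq_mul]
    rw [← Fintype.sum_ite_eq i (fun l => (w l : ℝ) * g (x l)), ← Finset.sum_add_distrib]
    refine Finset.sum_congr rfl fun l _ => ?_
    by_cases hl : l = i
    · subst hl; simp
    · have hl' : (l : ℕ) ≠ i := fun h => hl (Fin.ext h)
      rw [if_neg (Ne.symm hl), add_zero]
      exact if_congr (by omega) rfl rfl

theorem sure_writeParams {m : ℕ} {X : Fin m → Fin d → ℝ} {pos : ℕ}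
    (h : Filling r E F x q (flatten X) pos M) (h17 : M.int 17 0 = m) :
    Sure writeParams 17 M fun M' =>
      Current r E F x q M' ∧ M'.copy q = inputMem X E (1 / m) ∧ M'.int 17 0 = m := by
  -- Parameters at index 0 are addressed by the stored square q * q; only μ, at index 1, requires an
  -- address computation.
  have i0 : ∀ {N : Mem}, N.int 5 0 = q * q → N.index (.var 5) = address 0 q := fun h => by
    simp [h, address]
  refine Sure.seq (t₁ := 1) (t₂ := 15) (sure_instr (by trivial) M) ?_
  rintro _ rfl
  refine Sure.seq (t₁ := 1) (t₂ := 13) (sure_instr (by trivial) _) ?_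
  rintro _ rfl
  refine Sure.seq (t₁ := 1) (t₂ := 11) (sure_instr (by trivial) _) ?_
  rintro M₃ h₃
  have e₃ : M₃ = ((M.setInt ⟨40 + 0, .var 5⟩ m).setInt ⟨40 + 1, .var 5⟩ d).setReal
      ⟨40 + 0, .var 5⟩ E := by
    simp [h₃, h.int1, h.int2, h17, h.real3, h.rzero]
  have c₁ := h.toCurrent.setIntCopy (i0 h.int5) 0 m
  have c₂ := c₁.setIntCopy (i0 c₁.int5) 1 d
  have c₃ := c₂.setRealCopy (i0 c₂.int5) 0 E
  have g₃ := copy_setReal (i0 c₂.int5) 0 E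
  rw [copy_setInt (i0 c₁.int5), copy_setInt (i0 h.int5), h.contents] at g₃
  rw [← e₃] at c₃ g₃
  have h17' : M₃.int 17 0 = m := by simp [e₃, h17]
  clear h₃ e₃
  refine Sure.seq (t₁ := 9) (t₂ := 1) (Q := fun M₄ => Current r E F x q M₄ ∧
    M₄.copy q = M₃.copy q ∧ M₄.int 17 0 = m ∧ M₄.real 9 0 = m ∧ M₄.real 10 0 = 1 ∧
    M₄.index (.var 21) = address 1 q) ?_ ?_
  · refine (sure_block _ _ (by simp) M₃).frame.mono ?_
    rintro M₄ ⟨h₄, hf⟩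
    have hc := copy_frame hf (by simp; omega) (by simp; omega)
    refine ⟨c₃.frame hf (by simp) (by simp) (by simp) fun q' _ => hc q', hc q, ?_, ?_, ?_, ?_⟩
    · rw [hf.1 17 (by simp), h17']
    all_goals simp [h₄, h17', c₃.int3, c₃.int4, address]
  · rintro M₄ ⟨c₄, g₄, h17, h9, h10, h21⟩
    refine (sure_instr (by trivial) M₄).mono ?_
    rintro _ rfl
    have e : (Instr.realOp .div (cell 40 21) (var 10) (var 9)).effect M₄ =
        M₄.setReal ⟨40 + 0, .var 21⟩ (1 / m) := by simp [h9, h10]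
    rw [e]
    refine ⟨c₄.setRealCopy h21 _ _, ?_, by simpa using h17⟩
    rw [copy_setReal h21, g₄, g₃]
    refine Mem.ext' (fun a i => ?_) fun a i => ?_
    · by_cases ha : a = 0 <;> by_cases ha' : a = 1 <;> by_cases hi : i = 0 <;>
        simp_all [inputMem, pointMem]
    · by_cases ha : a = 0 <;> by_cases ha' : a = 1 <;> by_cases hi : i = 0 <;>
        by_cases hi' : i = 1 <;> simp_all [inputMem, pointMem]

/-- The identity for all `g` expresses that `X` lists each point according to its weight. A constant
`g` gives the number of points, and the kernel at a fixed argument gives the density. -/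
theorem sure_fillCopy (hd : 1 ≤ d) {z : Fin n → ℝ} {w : Fin n → ℕ}
    (hw : ∀ l, w l = ⌊z l * F⌋₊ + 1) (h : Current r E F x q M) (hq : M.copy q = emptyMem)
    (hz : ∀ l : Fin n, M.real 5 l = z l) :
    Sure fillCopy (16 * ((∑ l, w l) * d) + 18 * n + 25) M fun M' =>
      ∃ (m : ℕ) (X : Fin m → Fin d → ℝ), Current r E F x q M' ∧
        M'.copy q = inputMem X E (1 / m) ∧ M'.int 17 0 = m ∧
        ∀ g : (Fin d → ℝ) → ℝ, ∑ a, g (X a) = ∑ l, w l * g (x l) := by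
  let τ : ℕ → ℕ := fun i => if hi : i < n then 16 * (w ⟨i, hi⟩ * d) + 15 else 0
  have key : Sure fillCopy (3 + ((∑ i ∈ Finset.range n, (τ i + 3) + 3) + 17 + 1) + 1) M fun M' =>
      ∃ (m : ℕ) (X : Fin m → Fin d → ℝ), Current r E F x q M' ∧
        M'.copy q = inputMem X E (1 / m) ∧ M'.int 17 0 = m ∧
        ∀ g : (Fin d → ℝ) → ℝ, ∑ a, g (X a) = ∑ l, w l * g (x l) := by
    refine Sure.seq (Q := FilledUpTo r E F x q z w 0) ?_ fun M₁ hM₁ =>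
      Sure.seq (t₁ := ∑ i ∈ Finset.range n, (τ i + 3) + 3) (t₂ := 17)
        (Q := FilledUpTo r E F x q z w n) ?_ ?_
    · refine (sure_block _ _ (by simp) M).frame.mono ?_
      rintro M₁ ⟨h₁, hf⟩
      have hc := copy_frame hf (by simp; omega) (by simp)
      refine ⟨fun l => by rw [hf.2 5 (by simp), hz], 0, Fin.elim0,
        ⟨h.frame hf (by simp) (by simp) (by simp) fun q' _ => hc q', ?_, ?_⟩, ?_, ?_⟩
      · rw [hc, hq]
        exact Mem.ext' (fun _ _ => rfl) fun a i => by simp [emptyMem, pointMem, flatten]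
      · simp [h₁]
      · simp [h₁]
      · simp
    · have hset : ∀ (M : Mem) i v, FilledUpTo r E F x q z w i M →
          FilledUpTo r E F x q z w i (M.setVar 15 v) := by
        rintro M i v ⟨hz, m, X, h₁, h₂, h₃⟩
        exact ⟨hz, m, X, h₁.setVar (by norm_num) (by norm_num) (by norm_num) v, by simpa using h₂, h₃⟩
      obtain ⟨_, _, _, hM₁', _⟩ := id hM₁
      refine sure_forLoop (by simp [addPoint, copyEntry, forLoop])
        (by simp [addPoint, copyEntry, forLoop]) (by simp [addPoint, copyEntry, forLoop])
        (by norm_num) (by norm_num) n τ (FilledUpTo r E F x q z w)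
        (fun i hi M h15 _ _ hM => ?_) M₁ hM₁'.int0 hM₁'.int3 (hset _ _ _ hM₁)
      simp only [τ, dif_pos hi]
      exact (sure_addPoint hd hw ⟨i, hi⟩ hM h15).mono fun M' hM' => hset _ _ _ hM'
    · rintro M₂ ⟨-, m, X, h₁, h₂, h₃⟩
      refine (sure_writeParams h₁ h₂).mono fun M' hM' => ⟨m, X, hM'.1, hM'.2.1, hM'.2.2, ?_⟩
      simpa using h₃
  refine key.weaken (le_of_eq ?_) fun _ h => h
  have : ∑ i ∈ Finset.range n, (τ i + 3) = 16 * ((∑ l, w l) * d) + 18 * n := by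
    rw [Finset.sum_range, Finset.sum_mul, Finset.mul_sum]
    have e : ∀ l : Fin n, τ l + 3 = 16 * (w l * d) + 18 := fun l => by simp [τ]
    simp only [e, Finset.sum_add_distrib, Finset.sum_const, Finset.card_univ, Fintype.card_fin,
      smul_eq_mul]
    ring
  rw [this]
  ring

/-! ### Queries -/

/-- The memory `Ms` with the first `j` coordinates of a query written. -/
def partialQuery (y : ℕ → ℝ) (j : ℕ) (Ms : Mem) : Mem :=
  ⟨Ms.int, fun a i => if a = 2 ∧ i < j then y i else Ms.real a i⟩

theorem sure_writePoint {Ms : Mem} (h : Current r E F x q M) (hq : M.copy q = Ms) (i : Fin n)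
    (hi : M.int 15 0 = i) :
    Sure writePoint (12 * d + 5) M fun M' =>
      Current r E F x q M' ∧ M'.copy q = writeQuery (x i) Ms := by
  let I : ℕ → Mem → Prop := fun j M => Current r E F x q M ∧
    M.copy q = partialQuery (fun c => flatten x (i * d + c)) j Ms ∧ M.int 28 0 = i * d
  have hset : ∀ (M : Mem) j v, I j M → I j (M.setVar 16 v) := by
    rintro M j v ⟨h₁, h₂, h₃⟩
    exact ⟨h₁.setVar (by norm_num) (by norm_num) v, by rwa [copy_setVar (by norm_num)],
      by simpa using h₃⟩
  have key : Sure writePoint (1 + (∑ j ∈ Finset.range d, (9 + 3) + 3) + 1) M (I d) := by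
    refine Sure.seq (Q := I 0) ?_ fun M₁ hM₁ => ?_
    · refine (sure_instr (by trivial) M).frame.mono ?_
      rintro M₁ ⟨h₁, hf⟩
      have hc := copy_frame hf (by simp; omega) (by simp)
      refine ⟨h.frame hf (by simp) (by simp) (by simp) fun q' _ => hc q', ?_, ?_⟩
      · rw [hc, hq]; exact Mem.ext' (fun _ _ => rfl) fun a c => by simp [partialQuery]
      · simp [h₁, hi, h.int1]
    · refine sure_forLoop (by simp [queryEntry]) (by simp [queryEntry]) (by simp [queryEntry])
        (by norm_num) (by norm_num) d (fun _ => 9) I (fun j _ M h16 _ _ hM => ?_) M₁ hM₁.1.int1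
        hM₁.1.int3 (hset _ _ _ hM₁)
      obtain ⟨hM, hc, h28⟩ := hM
      refine (Sure.seq (t₁ := 7) (t₂ := 1) (Q := fun M₂ => I j M₂ ∧
        M₂.index (.var 21) = address j q ∧ M₂.int 20 0 = i * d + j) ?_ ?_ : Sure _ _ _
          (I (j + 1))).mono fun M' hM' => hset _ _ _ hM'
      · refine (sure_block _ _ (by simp) M).frame.mono ?_
        rintro M₂ ⟨h₂, hf⟩
        have hc' := copy_frame hf (by simp; omega) (by simp)
        refine ⟨⟨hM.frame hf (by simp) (by simp) (by simp) fun q' _ => hc' q',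
          by rw [hc', hc], ?_⟩, ?_, ?_⟩
        · rw [hf.1 28 (by simp), h28]
        · simp [h₂, h16, hM.int4, address]
        · simp [h₂, h16, h28]
      · rintro M₂ ⟨⟨c₂, g₂, h28⟩, h21, h20⟩
        refine (sure_instr (by trivial) M₂).mono ?_
        rintro _ rfl
        have e : (Instr.realOp .add (cell 42 21) (cell 1 20) (var 13)).effect M₂ =
            M₂.setReal ⟨40 + 2, .var 21⟩ (flatten x (i * d + j)) := by
          simp [c₂.points, h20, c₂.rzero]
        rw [e]
        refine ⟨c₂.setRealCopy h21 _ _, ?_, by simpa using h28⟩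
        rw [copy_setReal h21, g₂]
        refine Mem.ext' (fun _ _ => rfl) fun a c => ?_
        by_cases ha : a = 2
        · rcases lt_trichotomy c j with hc | hc | hc
          · have : c ≠ j := by omega
            simp [partialQuery, ha, this, hc]
            intro; omega
          · simp [partialQuery, ha, hc]
          · have h1 : c ≠ j := by omega
            have h2 : ¬ c < j := by omega
            simp [partialQuery, ha, h1, h2]
            intro; omega
        · simp [partialQuery, ha]
  refine key.weaken (by simp; omega) ?_
  rintro M' ⟨h₁, h₂, -⟩
  refine ⟨h₁, h₂.trans (Mem.ext' (fun _ _ => rfl) fun a c => ?_)⟩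
  by_cases hc : a = 2 ∧ c < d
  · simp only [partialQuery, writeQuery, hc, and_self, if_true, dif_pos]
    exact flatten_apply x i ⟨c, hc.2⟩
  · simp only [partialQuery, writeQuery, hc, if_false, dif_neg, not_false_eq_true]

/-! ### Votes -/

theorem sure_countVote {b s i : ℕ} (h2 : M.int 2 0 = 0) (h3 : M.int 3 0 = 1)
    (h12 : M.int 12 0 = r) (h15 : M.int 15 0 = i) (h22 : M.int 22 0 = b) (h23 : M.int 23 0 = s) :
    Sure countVote 12 M fun M' =>
      (∀ j s', M'.int 24 (address j s') =
        if j = b ∧ s' = s then M.int 24 (address b s) + 1 else M.int 24 (address j s')) ∧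
      ∀ l, M'.int 25 l = if r < 2 * (M.int 24 (address b s) + 1) ∧ l = i then b
        else M.int 25 l := by
  refine Sure.seq (t₁ := 9) (t₂ := 2) (Q := fun M₁ => M₁.int 2 0 = 0 ∧ M₁.int 12 0 = r ∧
    M₁.int 15 0 = i ∧ M₁.int 22 0 = b ∧ (∀ l, M₁.int 25 l = M.int 25 l) ∧
    M₁.int 20 0 = 2 * (M.int 24 (address b s) + 1) ∧
    ∀ j s', M₁.int 24 (address j s') =
      if j = b ∧ s' = s then M.int 24 (address b s) + 1 else M.int 24 (address j s')) ?_ ?_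
  · refine (sure_block _ _ (by simp) M).frame.mono ?_
    rintro M₁ ⟨h₁, hf⟩
    refine ⟨?_, ?_, ?_, ?_, fun l => ?_, ?_, fun j s' => ?_⟩
    · rw [hf.1 2 (by simp), h2]
    · rw [hf.1 12 (by simp), h12]
    · rw [hf.1 15 (by simp), h15]
    · rw [hf.1 22 (by simp), h22]
    · rw [hf.1 25 (by simp)]
    · simp [h₁, h22, h23, h3, address]; ring
    · have : address j s' = address b s ↔ j = b ∧ s' = s :=
        ⟨address_inj, by rintro ⟨rfl, rfl⟩; rfl⟩
      simp only [address] at this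
      simp [h₁, h22, h23, h3, address, this]
  · rintro M₁ ⟨e2, e12, e15, e22, e25, e20, e24⟩
    refine sure_ite (t := 1) (fun H => ?_) fun H => ?_
    · refine (sure_instr (by trivial) M₁).mono ?_
      rintro _ rfl
      simp only [Test.holds, Mem.getInt, Mem.index, e12, e20] at H
      refine ⟨fun j s' => by simpa using e24 j s', fun l => ?_⟩
      simp [e15, e22, e2, e25, H]
    · refine (sure_instr (by trivial) M₁).mono ?_
      rintro _ rfl
      simp only [Test.holds, Mem.getInt, Mem.index, e12, e20] at H
      refine ⟨fun j s' => by simpa using e24 j s', fun l => ?_⟩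
      simp [e25, H]

/-- The second vote, for b + 1, is counted last and may overwrite the winner set by the vote for b.
Hence the three cases, in the shape required by `Vote.step`. -/
theorem sure_castBallot {m i s : ℕ} (h : Current r E F x q M) (hi : M.int 15 0 = i)
    (h17 : M.int 17 0 = m) (h26 : M.int 26 0 = s) {b : ℕ}
    (hb : b = bucket E (m * (M.copy q).real 3 0)) :
    Sure castBallot 43 M fun M' =>
      (∀ j s', M'.int 24 (address j s') =
        if s' = s + i then ballot (fun j => M.int 24 (address j (s + i))) b j
          else M.int 24 (address j s')) ∧
      (∀ l, l ≠ i → M'.int 25 l = M.int 25 l) ∧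
      ((r < 2 * ballot (fun j => M.int 24 (address j (s + i))) b (b + 1) ∧
          M'.int 25 i = b + 1) ∨
        (¬ r < 2 * ballot (fun j => M.int 24 (address j (s + i))) b (b + 1) ∧
          r < 2 * ballot (fun j => M.int 24 (address j (s + i))) b b ∧ M'.int 25 i = b) ∨
        (¬ r < 2 * ballot (fun j => M.int 24 (address j (s + i))) b (b + 1) ∧
          ¬ r < 2 * ballot (fun j => M.int 24 (address j (s + i))) b b ∧
            M'.int 25 i = M.int 25 i)) := by
  refine Sure.seq (t₁ := 15) (t₂ := 27) (Q := fun M₁ => M₁.int 2 0 = 0 ∧ M₁.int 3 0 = 1 ∧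
    M₁.int 12 0 = r ∧ M₁.int 15 0 = i ∧ M₁.int 22 0 = b ∧ M₁.int 23 0 = s + i ∧
    (∀ l, M₁.int 25 l = M.int 25 l) ∧ ∀ l, M₁.int 24 l = M.int 24 l) ?_ ?_
  · refine (sure_block _ _ (by simp) M).frame.mono ?_
    rintro M₁ ⟨h₁, hf⟩
    refine ⟨?_, ?_, ?_, ?_, ?_, ?_, fun l => ?_, fun l => ?_⟩
    · rw [hf.1 2 (by simp), h.int2]
    · rw [hf.1 3 (by simp), h.int3]
    · rw [hf.1 12 (by simp), h.int12]
    · rw [hf.1 15 (by simp), hi]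
    · simp [h₁, h17, h.int5, h.width, h.int3, hb, bucket, Mem.copy, address]
    · simp [h₁, h26, hi]
    · rw [hf.1 25 (by simp)]
    · rw [hf.1 24 (by simp)]
  rintro M₁ ⟨e2, e3, e12, e15, e22, e23, e25, e24⟩
  refine Sure.seq (t₁ := 12) (t₂ := 14) (sure_countVote e2 e3 e12 e15 e22 e23).frame ?_
  rintro M₂ ⟨⟨g24, g25⟩, hf⟩
  refine Sure.seq (t₁ := 1) (t₂ := 12) (sure_instr (by trivial) M₂).frame ?_
  rintro M₃ ⟨h₃, hf'⟩
  have f2 : M₃.int 2 0 = 0 := by rw [hf'.1 2 (by simp), hf.1 2 (by simp [countVote]), e2]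
  have f3 : M₃.int 3 0 = 1 := by rw [hf'.1 3 (by simp), hf.1 3 (by simp [countVote]), e3]
  have f12 : M₃.int 12 0 = r := by rw [hf'.1 12 (by simp), hf.1 12 (by simp [countVote]), e12]
  have f15 : M₃.int 15 0 = i := by rw [hf'.1 15 (by simp), hf.1 15 (by simp [countVote]), e15]
  have f23 : M₃.int 23 0 = s + i := by rw [hf'.1 23 (by simp), hf.1 23 (by simp [countVote]), e23]
  have f24 : M₃.int 24 = M₂.int 24 := funext fun l => hf'.1 24 (by simp) l
  have f25 : M₃.int 25 = M₂.int 25 := funext fun l => hf'.1 25 (by simp) l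
  have f22 : M₃.int 22 0 = b + 1 := by
    have h22 : M₂.int 22 0 = b := by rw [hf.1 22 (by simp [countVote]), e22]
    have h3 : M₂.int 3 0 = 1 := by rw [hf.1 3 (by simp [countVote]), e3]
    simp [h₃, h22, h3]
  refine (sure_countVote f2 f3 f12 f15 f22 f23).mono ?_
  rintro M₄ ⟨k24, k25⟩
  rw [f24] at k24 k25
  rw [f25] at k25
  simp only [g24, g25, e24, e25] at k24 k25
  refine ⟨fun j s' => ?_, fun l hl => ?_, ?_⟩
  · rw [k24]
    by_cases hs : s' = s + i
    · subst hs
      by_cases h1 : j = b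
      · simp [h1, ballot]
      · by_cases h2 : j = b + 1 <;> simp [h1, h2, ballot]
    · simp [hs]
  · simp [k25, hl]
  · rw [k25]
    simp only [ballot]
    by_cases h1 : r < 2 * (M.int 24 (address (b + 1) (s + i)) + 1) <;>
      by_cases h2 : r < 2 * (M.int 24 (address b (s + i)) + 1) <;> simp [h1, h2]

end specs

section
variable {n d r : ℕ} {E F : ℝ} {x : Fin n → Fin d → ℝ} {q : ℕ} {M M' M₀ Ms : Mem}

/-! ### Programs in a copy -/

theorem Sim.eqOff (h : Sim M₀ q M Ms) :
    EqOff (fun a => 6 ≤ a ∧ a ≤ 10 ∨ 40 ≤ a) (fun a => 40 ≤ a) M₀ M :=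
  ⟨fun a ha i => h.frame_int a i (by tauto) (by tauto), fun a ha i => h.frame_real a i (by tauto)⟩

theorem Sim.copy_eq (h : Sim M₀ q M Ms) : M.copy q = Ms :=
  Mem.ext' (fun _ _ => h.int _ _) (fun _ _ => h.real _ _)

theorem Sim.copy_ne (h : Sim M₀ q M Ms) {q' : ℕ} (hq : q' ≠ q) : M.copy q' = M₀.copy q' :=
  Mem.ext' (fun _ _ => h.frame_int _ _ (by omega) fun _ _ e => hq (address_inj e).2)
    (fun _ _ => h.frame_real _ _ fun _ _ e => hq (address_inj e).2)

theorem Current.sim (h : Current r E F x q M) : Sim M q M (M.copy q) where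
  int _ _ := rfl
  real _ _ := rfl
  frame_int _ _ _ _ := rfl
  frame_real _ _ _ := rfl
  zero := h.int2
  copy := h.int4
  copy_sq := h.int5

theorem Current.of_sim (h : Current r E F x q M) (hs : Sim M q M' Ms) : Current r E F x q M' :=
  h.frame hs.eqOff (by simp) (by simp) (by simp) fun q' hq' => hs.copy_ne (by omega)

theorem wp_reloc_current {f g : Mem → ℝ≥0∞} (h : Current r E F x q M)
    (hfg : ∀ M' Ms', Current r E F x q M' → M'.copy q = Ms' →
      EqOff (fun a => 6 ≤ a ∧ a ≤ 10 ∨ 40 ≤ a) (fun a => 40 ≤ a) M M' → f M' ≤ g Ms')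
    (t : ℕ) (c : Cmd) : c.reloc.wp (32 * t) f M ≤ c.wp t g (M.copy q) :=
  wp_reloc h.sim (fun M' Ms' hs => hfg M' Ms' (h.of_sim hs) hs.copy_eq hs.eqOff) t c

theorem reloc_not_writesInt {c : Cmd} {a : ℕ} (h : a < 6 ∨ 10 < a ∧ a < 40) :
    ¬ c.reloc.WritesInt a := fun h' => by
  have := c.reloc_writesInt h'
  omega

theorem reloc_not_writesReal {c : Cmd} {a : ℕ} (h : a < 40) : ¬ c.reloc.WritesReal a := fun h' => by
  have := c.reloc_writesReal h'
  omega

/-! ### Votes on all points -/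

/-- The votes of the iteration with serial numbers from `s` on; `κ l` ballots have been cast on the
point `l`. -/
structure Votes (r s : ℕ) (J κ : Fin n → ℕ) (M : Mem) : Prop where
  vote : ∀ l : Fin n, Vote r (J l) (κ l) (fun j => M.int 24 (address j (s + l))) (M.int 25 l)
  fresh : ∀ s', s + n ≤ s' → ∀ j, M.int 24 (address j s') = 0

theorem Votes.congr {s : ℕ} {J κ : Fin n → ℕ} (h : Votes r s J κ M)
    (h₁ : ∀ i, M'.int 24 i = M.int 24 i) (h₂ : ∀ i, M'.int 25 i = M.int 25 i) :
    Votes r s J κ M' where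
  vote l := by simpa only [h₁, h₂] using h.vote l
  fresh s' hs' j := by rw [h₁, h.fresh s' hs']

/-- The votes for the good bucket of the point `l`. -/
abbrev goodVotes (s : ℕ) (J : Fin n → ℕ) (l : Fin n) (M : Mem) : ℕ :=
  M.int 24 (address (J l + 1) (s + l))

/-- The state while the points are queried in one copy, before the query `i`; in the earlier copies,
`k` ballots have been cast on each point. -/
structure Querying {n d : ℕ} (r : ℕ) (E F : ℝ) (x : Fin n → Fin d → ℝ) (q m s k : ℕ)
    (J : Fin n → ℕ) (i : ℕ) (M : Mem) : Prop extends Current r E F x q M where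
  weight : M.int 17 0 = m
  serial : M.int 26 0 = s
  votes : Votes r s J (fun l => if (l : ℕ) < i then k + 1 else k) M

theorem Querying.setVar {m s k i : ℕ} {J : Fin n → ℕ} (h : Querying r E F x q m s k J i M) {a : ℕ}
    (ha : a = 14 ∨ a = 15) (v : ℕ) : Querying r E F x q m s k J i (M.setVar a v) where
  toCurrent := h.toCurrent.setVar (by omega) (by omega) v
  weight := by
    have : 17 ≠ a := by omega
    simpa [this] using h.weight
  serial := by
    have : 26 ≠ a := by omega
    simpa [this] using h.serial
  votes := by
    have h1 : 24 ≠ a := by omega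
    have h2 : 25 ≠ a := by omega
    exact h.votes.congr (fun i => by simp [h1]) (fun i => by simp [h2])

/-- Only the black-box query can be random, and the ballot is a function of its answer. The
continuation can therefore be valued by a function `g` of the memory of the copy alone, and the run
reduces to the original query program. -/
theorem wp_queryPoint {m s k : ℕ} {J : Fin n → ℕ} {i : Fin n}
    (h : Querying r E F x q m s k J i M) (hi : M.int 15 0 = i) {f g : Mem → ℝ≥0∞}
    (hfg : ∀ M' Ms', Querying r E F x q m s k J (i + 1) M' → M'.copy q = Ms' →
      (∀ j s', M'.int 24 (address j s') = if s' = s + i then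
        ballot (fun j => M.int 24 (address j (s + i))) (bucket E (m * Ms'.real 3 0)) j
          else M.int 24 (address j s')) → f M' ≤ g Ms') (query : Cmd) (t : ℕ) :
    (queryPoint query).wp (12 * d + 5 + (32 * t + 43 + 1) + 1) f M ≤
      query.wp t g (writeQuery (x i) (M.copy q)) := by
  refine (sure_writePoint h.toCurrent rfl i hi).frame.wp_seq fun M₁ hM₁ => ?_
  obtain ⟨⟨h₁, hc₁⟩, hf₁⟩ := hM₁
  rw [← hc₁]
  refine (wp_seq _ _ _ _ _ _).trans (wp_reloc_current h₁ (fun M₂ Ms' h₂ hc₂ hf₂ => ?_) t query)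
  have hA : ∀ a, a ∈ [15, 17, 24, 25, 26] → ∀ i, M₂.int a i = M.int a i := by
    intro a ha i
    have h1 : ¬ (6 ≤ a ∧ a ≤ 10 ∨ 40 ≤ a) := by simp at ha; omega
    rw [hf₂.1 a h1, hf₁.1 a]
    simp at ha
    rcases ha with rfl | rfl | rfl | rfl | rfl <;> simp [writePoint, queryEntry, forLoop]
  have h15 : M₂.int 15 0 = i := by rw [hA 15 (by simp), hi]
  have h17 : M₂.int 17 0 = m := by rw [hA 17 (by simp), h.weight]
  have h26 : M₂.int 26 0 = s := by rw [hA 26 (by simp), h.serial]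
  refine (sure_castBallot h₂ h15 h17 h26 rfl).frame f _ ?_
  rintro M₃ ⟨⟨g24, g25, hv⟩, hf₃⟩
  rw [hc₂] at g24 hv
  simp only [hA 24 (by simp), hA 25 (by simp)] at g24 g25 hv
  have hc₃ := copy_frame hf₃ (by simp [castBallot, countVote]; omega)
    (by simp [castBallot, countVote]; omega)
  refine hfg M₃ Ms' ⟨h₂.frame hf₃ (by simp [castBallot, countVote])
    (by simp [castBallot, countVote]) (by simp [castBallot, countVote]) fun q' _ => hc₃ q',
    ?_, ?_, fun l => ?_, fun s' hs' j => ?_⟩ ((hc₃ q).trans hc₂) g24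
  · rw [hf₃.1 17 (by simp [castBallot, countVote]), h17]
  · rw [hf₃.1 26 (by simp [castBallot, countVote]), h26]
  · by_cases hl : l = i
    · subst hl
      have := h.votes.vote l
      simp only [lt_irrefl, if_false] at this
      simp only [g24, if_true, Nat.lt_succ_self]
      exact this.step _ hv
    · have hl' : (l : ℕ) ≠ i := fun h => hl (Fin.ext h)
      have h1 : s + (l : ℕ) ≠ s + i := by omega
      have h2 : ((l : ℕ) < i + 1) = ((l : ℕ) < i) := propext (by omega)
      simp only [g24, h1, if_false, g25 _ hl', h2]
      exact h.votes.vote l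
  · have : s' ≠ s + i := by have := i.2; omega
    rw [g24, if_neg this, h.votes.fresh s' hs']

/-! ### The success probability of one copy -/

/-- The constant is 1/3 + (2/3)(4/9) = 17/27. -/
theorem expect_le_of_prob {α : Type*} (p : PMF α) {S : Set α} {h : α → ℝ≥0∞}
    (hp : 2 / 3 ≤ p.toOuterMeasure S) (h1 : ∀ a, h a ≤ 1) (hS : ∀ a ∈ S, h a ≤ 4 / 9) :
    expect p h ≤ 17 / 27 := by
  classical
  rw [toOuterMeasure_eq_expect] at hp
  have e : expect p h + 5 / 9 * expect p (fun a => if a ∈ S then 1 else 0) ≤ 1 := by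
    rw [← expect_mul_left]
    unfold expect
    rw [← ENNReal.tsum_add]
    simp only [← mul_add]
    refine (expect_mono (p := p) (h := fun _ => 1) fun a => ?_).trans_eq (expect_const p 1)
    by_cases ha : a ∈ S
    · rw [if_pos ha, mul_one]
      refine (add_le_add_left (hS a ha) _).trans_eq ?_
      rw [← ENNReal.add_div]
      norm_num
      exact ENNReal.div_self (by norm_num) (by norm_num)
    · simpa [ha] using h1 a
  have e2 : expect p h + 10 / 27 ≤ 17 / 27 + 10 / 27 := by
    calc expect p h + 10 / 27 = expect p h + 5 / 9 * (2 / 3) := by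
          congr 1
          rw [← ENNReal.toReal_eq_toReal_iff' (by finiteness) (by finiteness)]
          simp [ENNReal.toReal_div]; norm_num
      _ ≤ 1 := le_trans (by gcongr) e
      _ = 17 / 27 + 10 / 27 := by
          rw [← ENNReal.add_div]
          norm_num
          exact (ENNReal.div_self (by norm_num) (by norm_num)).symm
  exact (ENNReal.add_le_add_iff_right (by finiteness)).1 e2

/-- Conditioning on the memory at the start of a history lets the query loop be analysed one query
at a time. -/
theorem runQueries_bind {d : ℕ} (query : Cmd) (t : ℕ) (D : PMF Mem) (ys : List (Fin d → ℝ)) :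
    runQueries query t D ys = D.bind fun M => runQueries query t (PMF.pure M) ys := by
  induction ys generalizing D with
  | nil => simp [runQueries]
  | cons y ys ih =>
    have e : ∀ D, runQueries query t D (y :: ys) =
        runQueries query t (D.bind fun M => query.run t (writeQuery y M)) ys := fun _ => rfl
    rw [e, ih, PMF.bind_bind]
    congr 1
    funext M
    rw [e, PMF.pure_bind, ← ih]

theorem runQueries_append {d : ℕ} (query : Cmd) (t : ℕ) (D : PMF Mem) (ys : List (Fin d → ℝ))
    (y : Fin d → ℝ) : runQueries query t D (ys ++ [y]) =
      (runQueries query t D ys).bind fun M => query.run t (writeQuery y M) := by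
  simp [runQueries]

/-- Within the times `tP` and `tQ`, the programs `prep` and `query` estimate the densities of any
`m ≤ N` points with accuracy `E`, down to densities of `1 / m`. -/
def EstimatesWithin {d : ℕ} (k : (Fin d → ℝ) → (Fin d → ℝ) → ℝ) (prep query : Cmd) (E : ℝ)
    (N tP tQ : ℕ) : Prop :=
  ∀ (m : ℕ) (X : Fin m → Fin d → ℝ), 1 ≤ m → m ≤ N → ∃ tp ≤ tP, ∃ tq ≤ tQ,
    prep.HaltsIn (inputMem X E (1 / m)) tp ∧ ∀ (ys : List (Fin d → ℝ)) (y : Fin d → ℝ),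
      (∀ M ∈ (runQueries query tq (prep.run tp (inputMem X E (1 / m))) ys).support,
        query.HaltsIn (writeQuery y M) tq) ∧
      (1 / m ≤ kernelDensity k X y →
        (2 / 3 : ℝ≥0∞) ≤ (runQueries query tq (prep.run tp (inputMem X E (1 / m)))
          (ys ++ [y])).toOuterMeasure
          {M | |M.real 3 0 - kernelDensity k X y| ≤ E * kernelDensity k X y})

/-- The potential of a ballot: `4 / 9` if it contains the good bucket, otherwise `1`. -/
def ballotPotential (E : ℝ) (m J : ℕ) (Ms : Mem) : ℝ≥0∞ :=
  if bucket E (m * Ms.real 3 0) = J ∨ bucket E (m * Ms.real 3 0) = J + 1 then 4 / 9 else 1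

open Classical in
-- Fix a point `l`. Only the query `l` changes its votes, and the law of that answer is the one the
-- KDE guarantee speaks of: the history x_0, …, x_(l-1) followed by x_l. So the loop multiplies the
-- potential of `l` by the expected potential of a single ballot, and independence among the answers
-- of one data structure is never used.
theorem wp_queryLoop {m s k tq : ℕ} {J : Fin n → ℕ} {query : Cmd} {D : PMF Mem}
    (hquery : ∀ (ys : List (Fin d → ℝ)) (y : Fin d → ℝ),
      ∀ M ∈ (runQueries query tq D ys).support, query.HaltsIn (writeQuery y M) tq)
    (h : Querying r E F x q m s k J 0 M) (hM : M.copy q ∈ D.support) (l : Fin n) :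
    (forLoop 15 0 (queryPoint query)).wp (n * (12 * d + 32 * tq + 53) + 3)
      (fun M' => if Querying r E F x q m s k J n M' then (4 / 9) ^ goodVotes s J l M' else ⊤) M ≤
    (4 / 9) ^ goodVotes s J l M *
      expect (runQueries query tq (PMF.pure (M.copy q)) ((List.ofFn x).take (l + 1)))
        (ballotPotential E m (J l)) := by
  -- The expected potential of the ballot on `l`, seen from the memory of the copy just before query
  -- `i`.
  let G : ℕ → Mem → ℝ≥0∞ := fun i Ms =>
    expect (runQueries query tq (PMF.pure Ms) (((List.ofFn x).take (l + 1)).drop i))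
      (ballotPotential E m (J l))
  have hG : ∀ i : Fin n, (i : ℕ) ≤ l → ∀ Ms, G i Ms =
      expect (query.run tq (writeQuery (x i) Ms)) (G (i + 1)) := by
    intro i hi Ms
    simp only [G]
    rw [List.drop_eq_getElem_cons (by simp; omega), List.getElem_take, List.getElem_ofFn]
    have e : ∀ y ys, runQueries query tq (PMF.pure Ms) (y :: ys) =
        runQueries (d := d) query tq ((PMF.pure Ms).bind fun M => query.run tq (writeQuery y M)) ys :=
      fun _ _ => rfl
    rw [e, PMF.pure_bind, runQueries_bind, expect_bind]
  have hGl : ∀ Ms, G (l + 1) Ms = ballotPotential E m (J l) Ms := by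
    intro Ms
    simp only [G]
    rw [List.drop_eq_nil_of_le (by simp)]
    simp [runQueries, expect_pure]
  -- The support condition is what supplies the halting guarantee for the next query.
  let Q : ℕ → Mem → Prop := fun i M => Querying r E F x q m s k J i M ∧
    M.copy q ∈ (runQueries query tq D ((List.ofFn x).take i)).support
  let Φ : ℕ → Mem → ℝ≥0∞ := fun i M => if Q i M then
    (4 / 9) ^ goodVotes s J l M * (if i ≤ l then G i (M.copy q) else 1) else ⊤
  have hstep : ∀ j < n, ∀ M : Mem, M.int 15 0 = j → M.int 0 0 = n → M.int 3 0 = 1 →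
      (queryPoint query).wp (12 * d + 5 + (32 * tq + 43 + 1) + 1)
        (fun M' => Φ (j + 1) (M'.setVar 15 (j + 1))) M ≤ Φ j M := by
    intro j hj M h15 _ _
    by_cases hQ : Q j M
    swap
    · simp [Φ, hQ]
    obtain ⟨i, rfl⟩ : ∃ i : Fin n, (i : ℕ) = j := ⟨⟨j, hj⟩, rfl⟩
    have hsucc : (List.ofFn x).take (i + 1) = (List.ofFn x).take i ++ [x i] := by
      rw [List.take_add_one, List.getElem?_eq_getElem (by simp), List.getElem_ofFn]
      rfl
    let S := (runQueries query tq D ((List.ofFn x).take (i + 1))).support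
    let g : Mem → ℝ≥0∞ := fun Ms => if Ms ∈ S then
      (4 / 9) ^ goodVotes s J l M * (if (i : ℕ) ≤ l then G (i + 1) Ms else 1) else ⊤
    refine (wp_queryPoint (g := g) hQ.1 h15 ?_ query tq).trans ?_
    · intro M' Ms' h' hc h24
      by_cases hS : Ms' ∈ S
      swap
      · simp [g, hS]
      have hQ' : Q (i + 1) (M'.setVar 15 (i + 1)) :=
        ⟨h'.setVar (by simp) _, by rw [copy_setVar (by norm_num), hc]; exact hS⟩
      have hgood : goodVotes s J l (M'.setVar 15 (i + 1)) = if (l : ℕ) = i then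
          ballot (fun j => M.int 24 (address j (s + i))) (bucket E (m * Ms'.real 3 0)) (J l + 1)
          else goodVotes s J l M := by
        simp [goodVotes, h24]
      simp only [Φ, g, if_pos hQ', if_pos hS]
      rw [copy_setVar (by norm_num), hc, hgood]
      rcases lt_trichotomy (i : ℕ) l with hil | hil | hil
      · rw [if_neg (by omega), if_pos (by omega : (i : ℕ) + 1 ≤ l), if_pos (by omega : (i : ℕ) ≤ l)]
      · obtain rfl : i = l := Fin.ext hil
        rw [if_pos rfl, if_neg (by omega), if_pos le_rfl, mul_one, hGl]
        unfold ballotPotential ballot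
        by_cases hb : bucket E (m * Ms'.real 3 0) = J i ∨ bucket E (m * Ms'.real 3 0) = J i + 1
        · rw [if_pos (by omega), if_pos hb, pow_succ]
        · rw [if_neg (by omega), if_neg hb, mul_one]
      -- After query `l` its ballot is settled; the remaining queries only have to halt.
      · rw [if_neg (by omega), if_neg (by omega), if_neg (by omega)]
    · rw [Cmd.HaltsIn.wp_eq (hquery _ (x i) _ hQ.2)]
      have hS : ∀ Ms' ∈ (query.run tq (writeQuery (x i) (M.copy q))).support, Ms' ∈ S := by
        intro Ms' hMs'
        simp only [S, hsucc, runQueries_append, PMF.mem_support_bind_iff]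
        exact ⟨_, hQ.2, hMs'⟩
      simp only [Φ, if_pos hQ]
      have : expect (query.run tq (writeQuery (x i) (M.copy q))) g ≤
          expect (query.run tq (writeQuery (x i) (M.copy q))) fun Ms =>
            (4 / 9) ^ goodVotes s J l M * (if (i : ℕ) ≤ l then G (i + 1) Ms else 1) :=
        expect_mono_support fun Ms' hMs' => by simp only [g, if_pos (hS Ms' hMs'), le_refl]
      refine this.trans_eq ?_
      rw [expect_mul_left]
      congr 1
      by_cases hil : (i : ℕ) ≤ l
      · simp only [if_pos hil]
        exact (hG i hil _).symm
      · simp only [if_neg hil]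
        exact expect_const _ _
  have hw : ∀ a, a = 0 ∨ a = 3 ∨ a = 15 → ¬ (queryPoint query).WritesInt a := by
    intro a ha
    have h1 : ¬ query.reloc.WritesInt a := reloc_not_writesInt (by omega)
    rcases ha with rfl | rfl | rfl <;>
      simp [queryPoint, h1, writePoint, queryEntry, castBallot, countVote, forLoop]
  have := wp_forLoop (hw 15 (by simp)) (hw 0 (by simp)) (hw 3 (by simp)) (by norm_num)
    (by norm_num) n (fun _ => 12 * d + 5 + (32 * tq + 43 + 1) + 1) Φ hstep M h.int0 h.int3
  have ht : ∑ j ∈ Finset.range n, (12 * d + 5 + (32 * tq + 43 + 1) + 1 + 3) + 3 =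
      n * (12 * d + 32 * tq + 53) + 3 := by
    rw [Finset.sum_const, Finset.card_range, smul_eq_mul]; ring
  rw [ht] at this
  refine (wp_mono (fun M' => ?_) _ _).trans (this.trans_eq ?_)
  · by_cases hQ : Q n M'
    · simp only [Φ, if_pos hQ, if_pos hQ.1]
      rw [if_neg (by omega), mul_one]
    · simp [Φ, hQ]
  · have hQ : Q 0 (M.setVar 15 0) := ⟨h.setVar (by simp) 0, by
      rw [copy_setVar (by norm_num)]; simpa [runQueries] using hM⟩
    simp only [Φ, if_pos hQ]
    rw [copy_setVar (by norm_num), if_pos (Nat.zero_le _)]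
    simp [goodVotes, G]

end

/-! ### Weighted sums, repeated copies and the Chernoff bound -/

section
variable {n d r : ℕ} {E F : ℝ} {x : Fin n → Fin d → ℝ} {q : ℕ} {M M' M₀ Ms : Mem}

/-- The weight of a point whose coordinate in the current vector is `a`. -/
def weight (F a : ℝ) : ℕ := ⌊a * F⌋₊ + 1

/-- The weighted kernel sums. -/
def kernelSum (k : (Fin d → ℝ) → (Fin d → ℝ) → ℝ) (F : ℝ) (x : Fin n → Fin d → ℝ) (z : Fin n → ℝ)
    (l : Fin n) : ℝ := ∑ j, weight F (z j) * k (x l) (x j)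

theorem one_le_kernelSum {k : (Fin d → ℝ) → (Fin d → ℝ) → ℝ} (hk : IsNiceKernel k) (F : ℝ)
    (x : Fin n → Fin d → ℝ) (z : Fin n → ℝ) (l : Fin n) : 1 ≤ kernelSum k F x z l := by
  calc (1 : ℝ) ≤ weight F (z l) * k (x l) (x l) := by
        rw [hk.diag, mul_one]
        exact_mod_cast Nat.le_add_left 1 _
    _ ≤ kernelSum k F x z l :=
        Finset.single_le_sum (f := fun j => (weight F (z j) : ℝ) * k (x l) (x j))
          (fun j _ => mul_nonneg (by positivity) (hk.mem_Icc _ _).1) (Finset.mem_univ l)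

/-- The state between two copies, when `k` ballots have been cast on every point. -/
structure Copying {n d : ℕ} (r : ℕ) (E F : ℝ) (x : Fin n → Fin d → ℝ) (s : ℕ) (J : Fin n → ℕ)
    (k : ℕ) (M : Mem) : Prop where
  current : ∃ q, Current r E F x q M ∧ M.copy q = emptyMem
  serial : M.int 26 0 = s
  votes : Votes r s J (fun _ => k) M

theorem Copying.setVar {s k : ℕ} {J : Fin n → ℕ} (h : Copying r E F x s J k M) {a : ℕ}
    (ha : 13 ≤ a ∧ a ≤ 15) (v : ℕ) : Copying r E F x s J k (M.setVar a v) where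
  current := by
    obtain ⟨q, h₁, h₂⟩ := h.current
    exact ⟨q, h₁.setVar (by omega) (by omega) v, by rwa [copy_setVar (by omega)]⟩
  serial := by
    have : 26 ≠ a := by omega
    simpa [this] using h.serial
  votes := by
    have h1 : 24 ≠ a := by omega
    have h2 : 25 ≠ a := by omega
    exact h.votes.congr (fun i => by simp [h1]) (fun i => by simp [h2])

/-- The time for one copy. -/
def copyTime (n d N tP tQ : ℕ) : ℕ :=
  16 * (N * d) + 18 * n + 25 + (32 * tP + (n * (12 * d + 32 * tQ + 53) + 3 + 3 + 1) + 1) + 1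

/-- Nothing is known about which cells a KDE program has touched, so a used copy is abandoned
instead of cleared; the next one is still empty. -/
theorem sure_nextCopy {s k m : ℕ} {J : Fin n → ℕ} (h : Querying r E F x q m s k J n M) :
    Sure nextCopy 3 M (Copying r E F x s J (k + 1)) := by
  refine (sure_block _ _ (by simp) M).frame.mono ?_
  rintro M' ⟨h', hf⟩
  have hc := copy_frame hf (by simp; omega) (by simp)
  refine ⟨⟨q + 1, ⟨h.toConsts.frame hf (by simp) (by simp), ?_, ?_, fun q' hq' => ?_⟩, ?_⟩, ?_, ?_⟩
  · simp [h', h.int4, h.int3]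
  · simp [h', h.int4, h.int3]
  · rw [hc, h.fresh q' (by omega)]
  · rw [hc, h.fresh _ (by omega)]
  · rw [hf.1 26 (by simp), h.serial]
  · have := h.votes.congr (M' := M') (fun i => hf.1 24 (by simp) i) (fun i => hf.1 25 (by simp) i)
    refine ⟨fun l => ?_, this.fresh⟩
    simpa using this.vote l

open Classical in
-- All later copies are empty, so this bound holds from any memory reached by earlier copies. The
-- factors 17/27 can then be multiplied without an explicit independence argument.
theorem wp_queryCopy_aux {s k N tP tQ : ℕ} {K : (Fin d → ℝ) → (Fin d → ℝ) → ℝ}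
    {prep query : Cmd} (hd : 1 ≤ d) (hK : IsNiceKernel K) (hE : 0 < E) (hE' : E ≤ 1 / 256)
    (hest : EstimatesWithin K prep query E N tP tQ) {z : Fin n → ℝ} {J : Fin n → ℕ}
    (hN : ∑ l, weight F (z l) ≤ N) (hJ : ∀ l, J l = goodBucket E (kernelSum K F x z l))
    (h : Copying r E F x s J k M) (hz : ∀ l : Fin n, M.real 5 l = z l) (l : Fin n) :
    (queryCopy prep query).wp (copyTime n d N tP tQ)
      (fun M' => if Copying r E F x s J (k + 1) M' then (4 / 9) ^ goodVotes s J l M' else ⊤) M ≤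
    17 / 27 * (4 / 9) ^ goodVotes s J l M := by
  obtain ⟨q, hcur, hempty⟩ := h.current
  refine (((sure_fillCopy hd (w := fun l => weight F (z l)) (fun _ => rfl) hcur hempty hz).weaken (u := 16 * (N * d) + 18 * n + 25)
    (by gcongr) fun _ h => h).frame).wp_seq fun M₁ hM₁ => ?_
  obtain ⟨⟨m, X, h₁, hc₁, h17, hsum⟩, hf₁⟩ := hM₁
  have hm : m = ∑ l, weight F (z l) := by
    have := hsum fun _ => 1
    simp only [Finset.sum_const, Finset.card_univ, Fintype.card_fin, mul_one, nsmul_eq_mul] at this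
    exact_mod_cast this
  have hm1 : 1 ≤ m := by
    rw [hm]
    exact le_trans (Nat.le_add_left 1 _) (Finset.single_le_sum (f := fun l => weight F (z l))
      (fun _ _ => Nat.zero_le _) (Finset.mem_univ l))
  have hm0 : (0 : ℝ) < m := by exact_mod_cast hm1
  obtain ⟨tp, htp, tq, htq, hhalt, hq⟩ := hest m X hm1 (hm ▸ hN)
  have hdens : kernelDensity K X (x l) = kernelSum K F x z l / m := by
    unfold kernelDensity kernelSum
    rw [hsum fun y => K (x l) y]
    ring
  have h24 : ∀ i, M₁.int 24 i = M.int 24 i := fun i => hf₁.1 24 (by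
    simp [fillCopy, addPoint, copyEntry, forLoop, writeParams]) i
  have h25 : ∀ i, M₁.int 25 i = M.int 25 i := fun i => hf₁.1 25 (by
    simp [fillCopy, addPoint, copyEntry, forLoop, writeParams]) i
  have h26 : M₁.int 26 0 = s := by
    rw [hf₁.1 26 (by simp [fillCopy, addPoint, copyEntry, forLoop, writeParams]), h.serial]
  set D := prep.run tp (inputMem X E (1 / m)) with hD
  set c₀ : ℝ≥0∞ := (4 / 9) ^ goodVotes s J l M with hc₀
  let g : Mem → ℝ≥0∞ := fun Ms => if Ms ∈ D.support then
    c₀ * expect (runQueries query tq (PMF.pure Ms) ((List.ofFn x).take (l + 1)))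
      (ballotPotential E m (J l)) else ⊤
  refine (wp_anti _ (show 32 * tp + (n * (12 * d + 32 * tq + 53) + 3 + 3 + 1) + 1 ≤ _ by
    gcongr) _).trans ?_
  refine (wp_seq _ _ _ _ _ _).trans ((wp_reloc_current (g := g) h₁ ?_ tp prep).trans ?_)
  · intro M₂ Ms h₂ hc₂ hf₂
    by_cases hMs : Ms ∈ D.support
    swap
    · rw [show g Ms = ⊤ from if_neg hMs]; exact le_top
    simp only [g, if_pos hMs]
    have hQ : Querying r E F x q m s k J 0 M₂ := by
      refine ⟨h₂, ?_, ?_, ?_⟩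
      · rw [hf₂.1 17 (by norm_num), h17]
      · rw [hf₂.1 26 (by norm_num), h26]
      · simp only [Nat.not_lt_zero, if_false]
        exact h.votes.congr (fun i => by rw [hf₂.1 24 (by norm_num), h24])
          (fun i => by rw [hf₂.1 25 (by norm_num), h25])
    have hgood : goodVotes s J l M₂ = goodVotes s J l M := by
      simp only [goodVotes]
      rw [hf₂.1 24 (by norm_num), h24]
    have := wp_queryLoop (fun ys y => (hq ys y).1) hQ (by rw [hc₂]; exact hMs) l
    rw [hc₂, hgood] at this
    refine wp_seq_sure (t₁ := n * (12 * d + 32 * tq + 53) + 3) (t₂ := 3) this fun M₃ => ?_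
    by_cases hQ₃ : Querying r E F x q m s k J n M₃
    swap
    · simp [hQ₃]
    rw [if_pos hQ₃]
    refine (sure_nextCopy hQ₃).frame _ _ fun M₄ hM₄ => ?_
    rw [if_pos hM₄.1]
    simp only [goodVotes]
    rw [hM₄.2.1 24 (by simp [nextCopy])]
  · rw [hc₁, Cmd.HaltsIn.wp_eq hhalt, ← hD]
    have e1 : expect D g ≤ expect D fun Ms =>
        c₀ * expect (runQueries query tq (PMF.pure Ms) ((List.ofFn x).take (l + 1)))
          (ballotPotential E m (J l)) :=
      expect_mono_support fun Ms hMs => by simp only [g, if_pos hMs, le_refl]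
    refine e1.trans ?_
    rw [expect_mul_left, ← expect_bind, ← runQueries_bind, mul_comm]
    refine mul_le_mul_left ?_ _
    have hsucc : (List.ofFn x).take (l + 1) = (List.ofFn x).take l ++ [x l] := by
      rw [List.take_add_one, List.getElem?_eq_getElem (by simp), List.getElem_ofFn]
      rfl
    have hV := one_le_kernelSum hK F x z l
    rw [hsucc]
    refine expect_le_of_prob _ ((hq _ _).2 ?_) (fun Ms => ?_) (fun Ms hMs => ?_)
    · rw [hdens]; gcongr
    · unfold ballotPotential
      split_ifs
      · exact ENNReal.div_le_of_le_mul (by norm_num)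
      · exact le_rfl
    · unfold ballotPotential
      rw [if_pos]
      rw [hJ]
      refine bucket_good hE hE' hV ?_
      change |_ - _| ≤ E * _ at hMs
      rw [hdens] at hMs
      have e : m * Ms.real 3 0 - kernelSum K F x z l =
          m * (Ms.real 3 0 - kernelSum K F x z l / m) := by field_simp
      rw [e, abs_mul, abs_of_pos hm0]
      calc (m : ℝ) * |Ms.real 3 0 - kernelSum K F x z l / m|
          ≤ m * (E * (kernelSum K F x z l / m)) := by gcongr
        _ = E * kernelSum K F x z l := by field_simp

theorem queryCopy_not_writesInt {prep query : Cmd} {a : ℕ}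
    (ha : a ∈ [0, 1, 2, 3, 11, 12, 13, 14, 26, 27]) : ¬ (queryCopy prep query).WritesInt a := by
  have h1 : ∀ c : Cmd, ¬ c.reloc.WritesInt a := fun c =>
    reloc_not_writesInt (by simp at ha; omega)
  simp at ha
  rcases ha with rfl | rfl | rfl | rfl | rfl | rfl | rfl | rfl | rfl | rfl <;>
    simp [queryCopy, fillCopy, addPoint, copyEntry, writeParams, queryPoint, h1, writePoint,
      queryEntry, castBallot, countVote, forLoop, nextCopy]

theorem queryCopy_not_writesReal {prep query : Cmd} {a : ℕ}
    (ha : a ∈ [1, 2, 3, 4, 5, 7, 8, 12, 13]) : ¬ (queryCopy prep query).WritesReal a := by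
  have h1 : ∀ c : Cmd, ¬ c.reloc.WritesReal a := fun c =>
    reloc_not_writesReal (by simp at ha; omega)
  simp at ha
  rcases ha with rfl | rfl | rfl | rfl | rfl | rfl | rfl | rfl | rfl <;>
    simp [queryCopy, fillCopy, addPoint, copyEntry, writeParams, queryPoint, h1, writePoint,
      queryEntry, castBallot, countVote, forLoop, nextCopy]

open Classical in
-- A Chernoff bound by potentials. If `l` has no good majority, then 2 * (good votes) ≤ r, so
-- (4/9)^(good votes) ≥ (2/3)^r. The expectation of this potential is at most (17/27)^r, and
-- (3/2)(17/27) = 17/18. The sum over `l` is the union bound.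
theorem wp_queryCopies {s N tP tQ : ℕ} {K : (Fin d → ℝ) → (Fin d → ℝ) → ℝ}
    {prep query : Cmd} (hn : 1 ≤ n) (hd : 1 ≤ d) (hK : IsNiceKernel K) (hE : 0 < E)
    (hE' : E ≤ 1 / 256) (hest : EstimatesWithin K prep query E N tP tQ) {z : Fin n → ℝ}
    {J : Fin n → ℕ} (hN : ∑ l, weight F (z l) ≤ N)
    (hJ : ∀ l, J l = goodBucket E (kernelSum K F x z l))
    (h : Copying r E F x s J 0 M) (hz : ∀ l : Fin n, M.real 5 l = z l)
    (hfresh : ∀ s', s ≤ s' → ∀ j, M.int 24 (address j s') = 0) :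
    (forLoop 14 12 (queryCopy prep query)).wp (r * (copyTime n d N tP tQ + 3) + 3)
      (fun M' => if Copying r E F x s J r M' then
        (if ∀ l, J l ≤ M'.int 25 l ∧ M'.int 25 l ≤ J l + 2 then 0 else 1) else ⊤) M ≤
    n * (17 / 18) ^ r := by
  -- Scaled by (3/2)^r, so that it is at least 1 on failure; the power of 17/27 prepays for the
  -- copies still to come.
  let Φ : Fin n → ℕ → Mem → ℝ≥0∞ := fun l k M =>
    if Copying r E F x s J k M ∧ ∀ l : Fin n, M.real 5 l = z l then
      (3 / 2) ^ r * (17 / 27) ^ (r - k) * (4 / 9) ^ goodVotes s J l M else ⊤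
  have hstep : ∀ l, ∀ j < r, ∀ M : Mem, M.int 14 0 = j → M.int 12 0 = r → M.int 3 0 = 1 →
      (queryCopy prep query).wp (copyTime n d N tP tQ)
        (fun M' => Φ l (j + 1) (M'.setVar 14 (j + 1))) M ≤ Φ l j M := by
    intro l j hj M _ _ _
    by_cases hM : Copying r E F x s J j M ∧ ∀ l : Fin n, M.real 5 l = z l
    swap
    · simp [Φ, hM]
    have := wp_queryCopy_aux (k := j) hd hK hE hE' hest hN hJ hM.1 hM.2 l
    simp only [Φ, if_pos hM]
    obtain ⟨v, hv⟩ : ∃ v, r - j = v + 1 := ⟨r - j - 1, by omega⟩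
    have hv' : r - (j + 1) = v := by omega
    refine (Cmd.wp_frame _ _ _ _).trans ?_
    have e : ∀ M', (if EqOff (queryCopy prep query).WritesInt (queryCopy prep query).WritesReal M M'
        then Φ l (j + 1) (M'.setVar 14 (j + 1)) else 0) ≤ (3 / 2) ^ r * (17 / 27) ^ v *
          (if Copying r E F x s J (j + 1) M' then (4 / 9) ^ goodVotes s J l M' else ⊤) := by
      intro M'
      split_ifs with hf hC
      · have hz' : ∀ l : Fin n, M'.real 5 l = z l := fun l => by
          rw [hf.2 5 (queryCopy_not_writesReal (by simp)), hM.2]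
        simp only [Φ, hv']
        rw [if_pos ⟨hC.setVar (by norm_num) _, by simpa using hz'⟩]
        simp [goodVotes]
      · rw [ENNReal.mul_top]
        · exact le_top
        · have h1 : (3 / 2 : ℝ≥0∞) ^ r ≠ 0 := pow_ne_zero _ (by simp)
          have h2 : (17 / 27 : ℝ≥0∞) ^ v ≠ 0 := pow_ne_zero _ (by simp)
          exact mul_ne_zero h1 h2
      · exact zero_le
      · exact zero_le
    refine (wp_mono e _ _).trans ?_
    rw [wp_mul_left (mul_ne_zero (pow_ne_zero _ (by simp)) (pow_ne_zero _ (by simp)))]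
    refine (mul_le_mul_right this _).trans_eq ?_
    rw [hv, pow_succ]
    ring
  have hcons : M.int 12 0 = r ∧ M.int 3 0 = 1 := by
    obtain ⟨q, hq, -⟩ := h.current
    exact ⟨hq.int12, hq.int3⟩
  have hloop : ∀ l, (forLoop 14 12 (queryCopy prep query)).wp (r * (copyTime n d N tP tQ + 3) + 3)
      (Φ l r) M ≤ (17 / 18) ^ r := by
    intro l
    have := wp_forLoop (queryCopy_not_writesInt (by simp)) (queryCopy_not_writesInt (by simp))
      (queryCopy_not_writesInt (by simp)) (by norm_num) (by norm_num) r
      (fun _ => copyTime n d N tP tQ) (Φ l) (hstep l) M hcons.1 hcons.2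
    rw [Finset.sum_const, Finset.card_range, smul_eq_mul] at this
    refine this.trans_eq ?_
    have hg : goodVotes s J l (M.setVar 14 0) = 0 := by
      simp [goodVotes, hfresh _ (Nat.le_add_right s l)]
    simp only [Φ]
    rw [if_pos ⟨h.setVar (by norm_num) _, by simpa using hz⟩, hg, pow_zero, mul_one, Nat.sub_zero,
      ← mul_pow]
    congr 1
    rw [← ENNReal.toReal_eq_toReal_iff' (by finiteness) (by finiteness)]
    simp [ENNReal.toReal_div]; norm_num
  have hne : (Finset.univ : Finset (Fin n)).Nonempty := ⟨⟨0, hn⟩, Finset.mem_univ _⟩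
  calc _ ≤ (forLoop 14 12 (queryCopy prep query)).wp (r * (copyTime n d N tP tQ + 3) + 3)
        (fun M' => ∑ l, Φ l r M') M := ?_
    _ = ∑ l, (forLoop 14 12 (queryCopy prep query)).wp (r * (copyTime n d N tP tQ + 3) + 3)
        (Φ l r) M := wp_sum _ hne _ _ _
    _ ≤ ∑ l : Fin n, (17 / 18) ^ r := Finset.sum_le_sum fun l _ => hloop l
    _ = _ := by simp
  have hfr : ∀ M', EqOff (forLoop 14 12 (queryCopy prep query)).WritesInt
      (forLoop 14 12 (queryCopy prep query)).WritesReal M M' →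
      ∀ l : Fin n, M'.real 5 l = z l := fun M' hf l => by
    rw [hf.2 5 (by simp [forLoop, queryCopy_not_writesReal]), hz]
  refine (Cmd.wp_frame _ _ _ _).trans (wp_mono (fun M' => ?_) _ _)
  split_ifs with hf hC hgood
  · exact zero_le
  · push Not at hgood
    obtain ⟨l, hl⟩ := hgood
    have hmaj : ¬ r < 2 * goodVotes s J l M' := fun hlt => by
      have := (hC.votes.vote l).result hlt
      exact absurd (hl this.1) (by omega)
    refine le_trans ?_ (Finset.single_le_sum (f := fun l => Φ l r M') (fun _ _ => zero_le)
      (Finset.mem_univ l))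
    simp only [Φ]
    rw [if_pos ⟨hC, hfr M' hf⟩, Nat.sub_self, pow_zero, mul_one]
    calc (1 : ℝ≥0∞) = (3 / 2) ^ r * (2 / 3) ^ r := by
          rw [← mul_pow]
          have : (3 / 2 : ℝ≥0∞) * (2 / 3) = 1 := by
            rw [← ENNReal.toReal_eq_toReal_iff' (by finiteness) (by finiteness)]
            simp [ENNReal.toReal_div]
          rw [this, one_pow]
      _ ≤ (3 / 2) ^ r * (2 / 3) ^ (2 * goodVotes s J l M') := by
          refine mul_le_mul_right (pow_le_pow_right_of_le_one' ?_ (by omega)) _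
          exact ENNReal.div_le_of_le_mul (by norm_num)
      _ = (3 / 2) ^ r * (4 / 9) ^ goodVotes s J l M' := by
          rw [pow_mul]
          congr 2
          rw [← ENNReal.toReal_eq_toReal_iff' (by finiteness) (by finiteness)]
          simp [ENNReal.toReal_div]; norm_num
  -- A broken invariant costs ⊤ in every summand; `1 ≤ n` provides one.
  · refine le_trans ?_ (Finset.single_le_sum (f := fun l => Φ l r M') (fun _ _ => zero_le)
      (Finset.mem_univ ⟨0, hn⟩))
    simp [Φ, hC]
  · exact zero_le

end

theorem wp_const_add (a : ℝ≥0∞) (f : Mem → ℝ≥0∞) (t : ℕ) (S : Config) :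
    wp (fun M => a + f M) t S ≤ a + wp f t S := by
  induction t generalizing S with
  | zero =>
    obtain ⟨K, M⟩ := S
    cases K with
    | nil => simp
    | cons c K => simp [wp_zero_cons]
  | succ t ih =>
    rw [wp_succ, wp_succ]
    refine (expect_mono ih).trans_eq ?_
    rw [← expect_const (step S) a]
    unfold expect
    rw [← ENNReal.tsum_add]
    simp only [mul_add, ENNReal.tsum_mul_right, PMF.tsum_coe, one_mul]

/-! ### Computing, storing and normalizing the product -/

section
variable {n d r : ℕ} {E F : ℝ} {x : Fin n → Fin d → ℝ} {M : Mem}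

/-- A loop that fills a real array. -/
theorem sure_fillArray {a : ℕ} {i : Instr} (hdet : i.IsDet) (hint : i.intDst = none)
    (v : ℕ → ℝ)
    (hi : ∀ j < n, ∀ M', EqOff (· = 15) (· = a) M M' → M'.int 15 0 = j →
      i.effect M' = M'.setReal (cell a 15) (v j)) (h0 : M.int 0 0 = n) (h3 : M.int 3 0 = 1) :
    Sure (forLoop 15 0 (.instr i)) (4 * n + 3) M fun M' =>
      EqOff (· = 15) (· = a) M M' ∧ ∀ j < n, M'.real a j = v j := by
  have hw : ∀ b, ¬ (Cmd.instr i).WritesInt b := fun b hb => by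
    change i.intDst = some b at hb
    rw [hint] at hb
    cases hb
  have := sure_forLoop (hw 15) (hw 0) (hw 3) (by norm_num) (by norm_num) n (fun _ => 1)
    (fun j M' => EqOff (· = 15) (· = a) M M' ∧ ∀ l < j, M'.real a l = v l)
    (fun j hj M₁ h15 _ _ hM₁ => (sure_instr hdet M₁).mono ?_) M h0 h3
    ⟨eqOff_setInt (by rfl) _ _, by simp⟩
  · refine this.weaken (by simp; omega) fun _ h => h
  · rintro M₂ rfl
    rw [hi j hj M₁ hM₁.1 h15]
    refine ⟨(hM₁.1.trans (eqOff_setReal (by rfl) _ _)).trans (eqOff_setInt (by rfl) _ _),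
      fun l hl => ?_⟩
    by_cases hlj : l = j
    · simp [h15, hlj]
    · have := hM₁.2 l (by omega)
      simp [h15, hlj, this]

/-- The approximate product computed from the elected buckets. -/
def productEntry (E : ℝ) (M : Mem) (l : ℕ) : ℝ := Real.exp (((M.int 25 l : ℝ) - 1) * (4 * E))

theorem sure_product (h : Consts r E F x M) :
    Sure product (16 * n + 5) M fun M' => (∀ l < n, M'.real 6 l = productEntry E M l) ∧
      M'.real 7 0 = ∑ l ∈ Finset.range n, productEntry E M l * productEntry E M l := by
  let I : ℕ → Mem → Prop := fun j M' => Consts r E F x M' ∧ (∀ l, M'.int 25 l = M.int 25 l) ∧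
    (∀ l < j, M'.real 6 l = productEntry E M l) ∧
    M'.real 7 0 = ∑ l ∈ Finset.range j, productEntry E M l * productEntry E M l
  have hset : ∀ (M' : Mem) j v, I j M' → I j (M'.setVar 15 v) := by
    rintro M' j v ⟨h₁, h₂, h₃, h₄⟩
    exact ⟨h₁.frame (eqOff_setVar _ _ _) (by simp) (by simp), by simpa using h₂, by simpa using h₃,
      by simpa using h₄⟩
  have key : Sure product (1 + (∑ j ∈ Finset.range n, (13 + 3) + 3) + 1) M (I n) := by
    refine Sure.seq (Q := I 0) ?_ fun M₁ hM₁ => ?_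
    · refine (sure_instr (by trivial) M).frame.mono ?_
      rintro M₁ ⟨h₁, hf⟩
      refine ⟨h.frame hf (by simp) (by simp), fun l => hf.1 25 (by simp) l, by simp, ?_⟩
      simp [h₁, h.rzero]
    · refine sure_forLoop (by simp) (by simp) (by simp) (by norm_num) (by norm_num) n (fun _ => 13)
        I (fun j hj M₂ h15 _ _ hM₂ => ?_) M₁ hM₁.1.int0 hM₁.1.int3 (hset _ _ _ hM₁)
      obtain ⟨c₂, h25, h6, h7⟩ := hM₂
      refine (sure_block _ _ (by simp) M₂).frame.mono ?_
      rintro M₃ ⟨h₃, hf⟩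
      refine hset _ _ _ ⟨c₂.frame hf (by simp) (by simp), fun l => ?_, fun l hl => ?_, ?_⟩
      · rw [hf.1 25 (by simp), h25]
      · by_cases hlj : l = j
        · simp [h₃, h15, hlj, h25, c₂.int3, c₂.width, productEntry]
        · have := h6 l (by omega)
          simp [h₃, h15, hlj, this]
      · rw [Finset.sum_range_succ, ← h7]
        simp [h₃, h15, h25, c₂.int3, c₂.width, productEntry]
  exact key.weaken (by simp; omega) fun M' hM' => hM'.2.2

/-- The part of an iteration after the queries. -/
def finishIteration : Cmd :=
  .seq product (.seq (.instr (.realFun .sqrt (var 7) (var 7))) (.seq updateBest normalize))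

open Classical in
theorem sure_finishIteration (h : Consts r E F x M) {s : ℝ}
    (hs : s = √(∑ l ∈ Finset.range n, productEntry E M l * productEntry E M l)) :
    Sure finishIteration (24 * n + 20) M fun M' =>
      (∀ l < n, M'.real 5 l = productEntry E M l / s) ∧
      M'.real 8 0 = (if M.real 8 0 < s then s else M.real 8 0) ∧
      (∀ l < n, M'.real 2 l = if M.real 8 0 < s then M.real 5 l else M.real 2 l) ∧
      M'.int 26 0 = M.int 26 0 + n := by
  have key : Sure finishIteration
      (16 * n + 5 + (1 + ((4 * n + 5 + 1) + (4 * n + 3 + 1 + 1) + 1) + 1) + 1) M fun M' =>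
      (∀ l < n, M'.real 5 l = productEntry E M l / s) ∧
      M'.real 8 0 = (if M.real 8 0 < s then s else M.real 8 0) ∧
      (∀ l < n, M'.real 2 l = if M.real 8 0 < s then M.real 5 l else M.real 2 l) ∧
      M'.int 26 0 = M.int 26 0 + n := by
    refine Sure.seq (sure_product h).frame ?_
    rintro M₁ ⟨⟨h6, h7⟩, hf₁⟩
    have c₁ := h.frame hf₁ (by simp [product, forLoop]) (by simp [product, forLoop])
    have r₁ : ∀ a, a ∈ [2, 5, 8] → ∀ i, M₁.real a i = M.real a i := fun a ha i => hf₁.2 a (by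
      simp at ha; rcases ha with rfl | rfl | rfl <;> simp [product, forLoop]) i
    have i₁ : M₁.int 26 0 = M.int 26 0 := hf₁.1 26 (by simp [product, forLoop]) 0
    refine Sure.seq (sure_instr (by trivial) M₁).frame ?_
    rintro M₂ ⟨h₂, hf₂⟩
    have c₂ := c₁.frame hf₂ (by simp) (by simp)
    have h7' : M₂.real 7 0 = s := by rw [hs, ← h7, h₂]; simp
    have h6' : ∀ l < n, M₂.real 6 l = productEntry E M l := fun l hl => by
      rw [hf₂.2 6 (by simp), h6 l hl]
    have r₂ : ∀ a, a ∈ [2, 5, 8] → ∀ i, M₂.real a i = M.real a i := fun a ha i => by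
      rw [hf₂.2 a (by simp at ha; rcases ha with rfl | rfl | rfl <;> simp), r₁ a ha]
    have i₂ : M₂.int 26 0 = M.int 26 0 := by rw [hf₂.1 26 (by simp), i₁]
    refine Sure.seq (Q := fun M₃ => Consts r E F x M₃ ∧ (∀ l < n, M₃.real 6 l = productEntry E M l) ∧
      M₃.real 7 0 = s ∧ M₃.int 26 0 = M.int 26 0 ∧
      M₃.real 8 0 = (if M.real 8 0 < s then s else M.real 8 0) ∧
      (∀ l < n, M₃.real 2 l = if M.real 8 0 < s then M.real 5 l else M.real 2 l)) ?_ ?_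
    · have hb : (Test.realLt (var 8) (var 7)).holds M₂ ↔ M.real 8 0 < s := by
        simp [Test.holds, h7', r₂ 8]
      refine sure_ite (t := 4 * n + 5) (fun H => ?_) fun H => ?_
      · rw [hb] at H
        refine (Sure.seq (t₁ := 1) (t₂ := 4 * n + 3)
          (R := fun M₃ => EqOff (· = 15) (fun a => a = 8 ∨ a = 2) M₂ M₃ ∧ M₃.real 8 0 = s ∧
            ∀ l < n, M₃.real 2 l = M.real 5 l)
          (sure_instr (i := .realOp .add (var 8) (var 7) (var 13)) trivial M₂).frame ?_).weaken
            (by omega) ?_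
        · rintro M₃ ⟨h₃, hf₃⟩
          have c₃ := c₂.frame hf₃ (by simp) (by simp)
          refine (sure_fillArray (a := 2) (i := .realOp .add (cell 2 15) (cell 5 15) (var 13)) trivial rfl
            (fun l => M.real 5 l)
            (fun j hj M' hM' h15 => ?_) c₃.int0 c₃.int3).mono ?_
          · have e5 : M'.real 5 j = M.real 5 j := by
              rw [hM'.2 5 (by norm_num), hf₃.2 5 (by simp), r₂ 5 (by simp)]
            have e13 : M'.real 13 0 = 0 := by rw [hM'.2 13 (by norm_num), c₃.rzero]
            simp [h15, e5, e13]
          · rintro M₄ ⟨hf₄, h2⟩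
            refine ⟨⟨fun a ha i => ?_, fun a ha i => ?_⟩, ?_, h2⟩
            · rw [hf₄.1 a ha, hf₃.1 a (by simp)]
            · rw [hf₄.2 a (by tauto), hf₃.2 a (by simp; tauto)]
            · rw [hf₄.2 8 (by norm_num), h₃]
              simp [h7', c₂.rzero]
        · rintro M₃ ⟨hf₃, h8, h2⟩
          refine ⟨c₂.frame hf₃ (by simp) (by simp), fun l hl => ?_, ?_, ?_, ?_, fun l hl => ?_⟩
          · rw [hf₃.2 6 (by norm_num), h6' l hl]
          · rw [hf₃.2 7 (by norm_num), h7']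
          · rw [hf₃.1 26 (by norm_num), i₂]
          · rw [if_pos H, h8]
          · rw [if_pos H, h2 l hl]
      · rw [hb] at H
        refine (sure_instr (by trivial) M₂).frame.weaken (by omega) ?_
        rintro M₃ ⟨-, hf₃⟩
        refine ⟨c₂.frame hf₃ (by simp) (by simp), fun l hl => ?_, ?_, ?_, ?_, fun l hl => ?_⟩
        · rw [hf₃.2 6 (by simp), h6' l hl]
        · rw [hf₃.2 7 (by simp), h7']
        · rw [hf₃.1 26 (by simp), i₂]
        · rw [if_neg H, hf₃.2 8 (by simp), r₂ 8 (by simp)]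
        · rw [if_neg H, hf₃.2 2 (by simp), r₂ 2 (by simp)]
    · rintro M₃ ⟨c₃, h6, h7, h26, h8, h2⟩
      refine Sure.seq (t₁ := 4 * n + 3) (t₂ := 1) (sure_fillArray (a := 5) (i := .realOp .div (cell 5 15) (cell 6 15) (var 7)) trivial rfl
        (fun l => productEntry E M l / s)
        (fun j hj M' hM' h15 => ?_) c₃.int0 c₃.int3) ?_
      · have e6 : M'.real 6 j = productEntry E M j := by rw [hM'.2 6 (by norm_num), h6 j hj]
        have e7 : M'.real 7 0 = s := by rw [hM'.2 7 (by norm_num), h7]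
        simp [h15, e6, e7]
      · rintro M₄ ⟨hf₄, h5⟩
        refine (sure_instr (by trivial) M₄).mono ?_
        rintro _ rfl
        have e0 : M₄.int 0 0 = n := by rw [hf₄.1 0 (by norm_num), c₃.int0]
        have e26 : M₄.int 26 0 = M.int 26 0 := by rw [hf₄.1 26 (by norm_num), h26]
        refine ⟨by simpa using h5, ?_, fun l hl => ?_, ?_⟩
        · simp only [Instr.effect, setInt_real]
          rw [hf₄.2 8 (by norm_num), h8]
        · simp only [Instr.effect, setInt_real]
          rw [hf₄.2 2 (by norm_num), h2 l hl]
        · simp [e0, e26]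
  exact key.weaken (by omega) fun _ h => h

/-! ### One iteration -/

/-- The first `n` cells of a real array. -/
abbrev Mem.vec (M : Mem) (n a : ℕ) (l : Fin n) : ℝ := M.real a l

/-- The state between two iterations, after `t` of them. -/
structure Iterating {n d : ℕ} (r : ℕ) (E F : ℝ) (x : Fin n → Fin d → ℝ) (t : ℕ) (M : Mem) :
    Prop where
  current : ∃ q, Current r E F x q M ∧ M.copy q = emptyMem
  serial : M.int 26 0 = t * n
  fresh : ∀ s', t * n ≤ s' → ∀ j, M.int 24 (address j s') = 0
  nonneg : ∀ l : Fin n, 0 ≤ M.real 5 l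
  unit : euclNorm (M.vec n 5) = 1

/-- The time for one iteration. -/
def iterationTime (n d r N tP tQ : ℕ) : ℕ :=
  r * (copyTime n d N tP tQ + 3) + 3 + (24 * n + 20) + 1

/-- By Cauchy–Schwarz a unit vector has entries summing to at most √n, and each weight exceeds F z_l
by at most 1. -/
theorem sum_weight_le {z : Fin n → ℝ} (hF : 0 ≤ F) (hz : ∀ l, 0 ≤ z l) (hz1 : euclNorm z = 1)
    {N : ℕ} (hN : F * √n + n ≤ N) : ∑ l, weight F (z l) ≤ N := by
  have h1 : ∑ l, z l ≤ √n := by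
    have := dotProduct_le_euclNorm z fun _ => 1
    rw [hz1, one_mul, euclNorm_one] at this
    simpa [dotProduct] using this
  have h2 : ((∑ l, weight F (z l) : ℕ) : ℝ) ≤ N := by
    calc ((∑ l, weight F (z l) : ℕ) : ℝ) ≤ ∑ l, (z l * F + 1) := by
          push_cast
          refine Finset.sum_le_sum fun l _ => ?_
          unfold weight
          push_cast
          have := Nat.floor_le (mul_nonneg (hz l) hF)
          linarith
      _ = F * (∑ l, z l) + n := by
          rw [Finset.sum_add_distrib, ← Finset.sum_mul]; simp [mul_comm]
      _ ≤ F * √n + n := by gcongr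
      _ ≤ N := hN
  exact_mod_cast h2

open Classical in
-- Once all elected buckets are close to the good ones, the rest of the iteration is deterministic
-- and `PowerState.step` applies with η = 8E. The failure bound holds for every starting memory.
-- Stating the postcondition as an implication keeps it independent of whether earlier iterations
-- succeeded.
theorem wp_iteration {t N tP tQ : ℕ} {K : (Fin d → ℝ) → (Fin d → ℝ) → ℝ}
    {prep query : Cmd} (hn : 1 ≤ n) (hd : 1 ≤ d) (hK : IsNiceKernel K) (hE : 0 < E)
    (hE' : E ≤ 1 / 256) (hF : 0 < F) (hest : EstimatesWithin K prep query E N tP tQ)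
    (hN : F * √n + n ≤ N) {u : Fin n → ℝ} (hu : ∀ i, 0 ≤ u i)
    (hu' : ∀ i, topEigenvalue (kernelMatrix K x) * u i ≤ (kernelMatrix K x).mulVec u i)
    (h : Iterating r E F x t M) :
    (iteration prep query).wp (iterationTime n d r N tP tQ)
      (fun M' => if Iterating r E F x (t + 1) M' then
        (if PowerState (kernelMatrix K x) F (8 * E) u t (M.vec n 5) (M.vec n 2) (M.real 8 0) →
          PowerState (kernelMatrix K x) F (8 * E) u (t + 1) (M'.vec n 5) (M'.vec n 2) (M'.real 8 0)
        then 0 else 1) else ⊤) M ≤ n * (17 / 18) ^ r := by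
  let z := M.vec n 5
  let J : Fin n → ℕ := fun l => goodBucket E (kernelSum K F x z l)
  -- Winners left over from the previous iteration need not be erased: all counts at the new serial
  -- numbers are zero, so the majority clause holds vacuously.
  have hcopying : Copying r E F x (t * n) J 0 M := by
    refine ⟨h.current, h.serial, fun l => ⟨fun j _ => ?_, fun hlt => ?_⟩, fun s' hs' j =>
      h.fresh s' (by omega) j⟩
    · simp [h.fresh _ (Nat.le_add_right (t * n) l)]
    · simp [h.fresh _ (Nat.le_add_right (t * n) l)] at hlt
  have hcopies := wp_queryCopies hn hd hK hE hE' hest (z := z) (J := J)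
    (sum_weight_le hF.le h.nonneg h.unit hN) (fun _ => rfl) hcopying (fun _ => rfl) h.fresh
  refine (wp_seq _ _ _ _ _ _).trans ((Cmd.wp_frame _ _ _ _).trans
    ((wp_mono (fun M₁ => ?_) _ _).trans hcopies))
  by_cases hf₁ : EqOff (forLoop 14 12 (queryCopy prep query)).WritesInt
    (forLoop 14 12 (queryCopy prep query)).WritesReal M M₁
  swap
  · rw [if_neg hf₁]; exact zero_le
  rw [if_pos hf₁]
  by_cases hC : Copying r E F x (t * n) J r M₁
  swap
  · rw [if_neg hC]; exact le_top
  rw [if_pos hC]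
  obtain ⟨q, hcur, hempty⟩ := hC.current
  have r₁ : ∀ a, a ∈ [2, 5, 8] → ∀ i, M₁.real a i = M.real a i := fun a ha i => hf₁.2 a (by
    simp at ha
    rcases ha with rfl | rfl | rfl <;> simp [forLoop, queryCopy_not_writesReal]) i
  obtain ⟨s, hs⟩ : ∃ s, s = √(∑ l ∈ Finset.range n, productEntry E M₁ l * productEntry E M₁ l) :=
    ⟨_, rfl⟩
  have hpos : ∀ l, 0 < productEntry E M₁ l := fun l => Real.exp_pos _
  have hs0 : 0 < s := by
    rw [hs]
    refine Real.sqrt_pos.2 (Finset.sum_pos (fun l _ => mul_pos (hpos l) (hpos l)) ⟨0, ?_⟩)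
    exact Finset.mem_range.2 (by omega)
  have hs' : s = euclNorm fun l : Fin n => productEntry E M₁ l := by
    rw [hs, euclNorm_eq, Finset.sum_range]
  refine (sure_finishIteration hcur.toConsts hs).frame _ _ ?_
  rintro M₂ ⟨⟨h5, h8, h2, h26⟩, hf₂⟩
  have w : ∀ a, a ∈ [0, 1, 2, 3, 4, 5, 12, 24] ∨ 40 ≤ a → ¬ finishIteration.WritesInt a := by
    intro a ha
    have : a ≠ 15 ∧ a ≠ 20 ∧ a ≠ 26 := by simp at ha; omega
    simp [finishIteration, product, updateBest, normalize, forLoop]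
    omega
  have w' : ∀ a, a ∈ [1, 3, 4, 12, 13] ∨ 40 ≤ a → ¬ finishIteration.WritesReal a := by
    intro a ha
    have : a ≠ 2 ∧ a ≠ 5 ∧ a ≠ 6 ∧ a ≠ 7 ∧ a ≠ 8 ∧ a ≠ 9 ∧ a ≠ 10 := by simp at ha; omega
    simp [finishIteration, product, updateBest, normalize, forLoop]
    omega
  have hc₂ := copy_frame hf₂ (fun a => w _ (by omega)) (fun a => w' _ (by omega))
  have hz₂ : M₂.vec n 5 = fun l : Fin n => productEntry E M₁ l / s := funext fun l => h5 l l.2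
  have hIter : Iterating r E F x (t + 1) M₂ := by
    refine ⟨⟨q, hcur.frame hf₂ ?_ ?_ ?_ fun q' _ => hc₂ q', by rw [hc₂, hempty]⟩, ?_, ?_, ?_, ?_⟩
    · exact ⟨w _ (by simp), w _ (by simp), w _ (by simp), w _ (by simp), w _ (by simp)⟩
    · exact ⟨w' _ (by simp), w' _ (by simp), w' _ (by simp), w' _ (by simp), w' _ (by simp)⟩
    · exact ⟨w _ (by simp), w _ (by simp)⟩
    · rw [h26, hC.serial]; ring
    · intro s' hs' j
      rw [hf₂.1 24 (w _ (by simp))]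
      exact hC.votes.fresh s' (by rwa [← Nat.succ_mul]) j
    · intro l
      rw [h5 l l.2]
      exact (div_pos (hpos l) hs0).le
    · rw [hz₂]
      have e : WithLp.toLp 2 (fun l : Fin n => productEntry E M₁ l / s) =
          s⁻¹ • WithLp.toLp 2 (fun l : Fin n => productEntry E M₁ l) := by
        ext l
        simp [div_eq_inv_mul]
      rw [euclNorm, e, norm_smul, Real.norm_of_nonneg (by positivity)]
      exact (congrArg (s⁻¹ * ·) hs').symm.trans (inv_mul_cancel₀ hs0.ne')
  rw [if_pos hIter]
  by_cases hgood : ∀ l, J l ≤ M₁.int 25 l ∧ M₁.int 25 l ≤ J l + 2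
  swap
  · rw [if_neg hgood]; split_ifs <;> simp
  rw [if_pos hgood, if_pos]
  intro hP
  have hw : ∀ l, (kernelMatrix K x).mulVec (fun l => (weight F (z l) : ℝ)) l = kernelSum K F x z l := by
    intro l
    simp only [Matrix.mulVec, dotProduct, kernelMatrix, Matrix.of_apply, kernelSum]
    exact Finset.sum_congr rfl fun j _ => mul_comm _ _
  have hy := fun l : Fin n => exp_bucket hE hE' (one_le_kernelSum hK F x z l) (hgood l).1 (hgood l).2
  have hn0 : NeZero n := ⟨by omega⟩
  have := hP.step (hK.posDef n x) (fun i j => (hK.mem_Icc _ _).1)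
    (topEigenvalue_pos (hK.posDef n x).isHermitian fun i => hK.diag _) hF (by linarith)
    (by linarith) hu hu' h.nonneg h.unit (w := fun l => (weight F (z l) : ℝ))
    (y := fun l => productEntry E M₁ l)
    (fun l => by
      unfold weight
      push_cast
      have := Nat.lt_floor_add_one (z l * F)
      rw [mul_comm]
      exact this.le)
    (fun l => by
      unfold weight
      push_cast
      have := Nat.floor_le (mul_nonneg (h.nonneg l) hF.le)
      rw [mul_comm F]
      linarith)
    (fun l => by rw [hw]; exact (hy l).1) (fun l => by rw [hw]; exact (hy l).2) hs' hs0
  rw [hz₂, h8, r₁ 8 (by simp)]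
  have hout : M₂.vec n 2 = if M.real 8 0 < s then M.vec n 5 else M.vec n 2 := by
    funext l
    have := h2 l l.2
    rw [r₁ 8 (by simp), r₁ 5 (by simp), r₁ 2 (by simp)] at this
    rw [Mem.vec, this]
    split_ifs <;> rfl
  rw [hout]
  exact this

end

/-! ### All iterations, and the program as a whole -/

section
variable {n d r : ℕ} {E F : ℝ} {x : Fin n → Fin d → ℝ} {M : Mem}

theorem Iterating.setVar {t : ℕ} (h : Iterating r E F x t M) (v : ℕ) :
    Iterating r E F x t (M.setVar 13 v) := by
  obtain ⟨⟨q, hcur, hempty⟩, h26, h24, hnn, h1⟩ := h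
  refine ⟨⟨q, hcur.setVar (by norm_num) (by norm_num) v, ?_⟩, ?_, fun s hs j => ?_, hnn, h1⟩
  · rw [copy_setVar (by norm_num), hempty]
  · simpa using h26
  · simpa using h24 s hs j

theorem iteration_not_writesInt {prep query : Cmd} {a : ℕ} (ha : a ∈ [3, 11, 13]) :
    ¬ (iteration prep query).WritesInt a := by
  simp at ha
  rcases ha with rfl | rfl | rfl <;>
    simp [iteration, product, updateBest, normalize, forLoop, queryCopy_not_writesInt]

open Classical in
-- Union bound over the iterations, as a potential: the failure probability reserved for the rounds
-- to come, plus 1 if the power invariant is already lost.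
theorem wp_iterations {T N tP tQ : ℕ} {K : (Fin d → ℝ) → (Fin d → ℝ) → ℝ}
    {prep query : Cmd} (hn : 1 ≤ n) (hd : 1 ≤ d) (hK : IsNiceKernel K) (hE : 0 < E)
    (hE' : E ≤ 1 / 256) (hF : 0 < F) (hest : EstimatesWithin K prep query E N tP tQ)
    (hN : F * √n + n ≤ N) {u : Fin n → ℝ} (hu : ∀ i, 0 ≤ u i)
    (hu' : ∀ i, topEigenvalue (kernelMatrix K x) * u i ≤ (kernelMatrix K x).mulVec u i)
    (h : Iterating r E F x 0 M) (h11 : M.int 11 0 = T)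
    (hP : PowerState (kernelMatrix K x) F (8 * E) u 0 (M.vec n 5) (M.vec n 2) (M.real 8 0)) :
    (forLoop 13 11 (iteration prep query)).wp (T * (iterationTime n d r N tP tQ + 3) + 3)
      (fun M' => if Iterating r E F x T M' then
        (if PowerState (kernelMatrix K x) F (8 * E) u T (M'.vec n 5) (M'.vec n 2) (M'.real 8 0)
        then 0 else 1) else ⊤) M ≤ T * (n * (17 / 18) ^ r) := by
  let δ : ℝ≥0∞ := n * (17 / 18) ^ r
  let P : ℕ → Mem → Prop := fun t M =>
    PowerState (kernelMatrix K x) F (8 * E) u t (M.vec n 5) (M.vec n 2) (M.real 8 0)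
  let Φ : ℕ → Mem → ℝ≥0∞ := fun t M =>
    if Iterating r E F x t M then ((T - t : ℕ) : ℝ≥0∞) * δ + (if P t M then 0 else 1) else ⊤
  have hPset : ∀ t M v, P t (Mem.setVar M 13 v) ↔ P t M := fun _ _ _ => Iff.rfl
  have key := wp_forLoop (c := iteration prep query) (i := 13) (n := 11)
    (iteration_not_writesInt (by simp)) (iteration_not_writesInt (by simp))
    (iteration_not_writesInt (by simp)) (by norm_num) (by norm_num) T
    (fun _ => iterationTime n d r N tP tQ) Φ (fun t ht M₁ _ _ _ => ?_) M h11 ?_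
  · refine le_trans ?_ (key.trans (le_of_eq ?_))
    · simp only [Finset.sum_const, Finset.card_range, smul_eq_mul]
      refine wp_mono (fun M' => ?_) _ _
      simp [Φ, P]
    · simp only [Φ]
      rw [if_pos (h.setVar 0), if_pos ((hPset _ _ _).2 hP)]
      simp [δ]
  · by_cases hI : Iterating r E F x t M₁
    swap
    · simp [Φ, hI]
    have hit := wp_iteration hn hd hK hE hE' hF hest hN hu hu' hI
    have e : T - t = (T - (t + 1)) + 1 := by omega
    simp only [Φ]
    rw [if_pos hI, e]
    calc _ ≤ (iteration prep query).wp (iterationTime n d r N tP tQ)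
          (fun M' => (((T - (t + 1) : ℕ) : ℝ≥0∞) * δ + (if P t M₁ then 0 else 1)) +
            if Iterating r E F x (t + 1) M' then (if P t M₁ → P (t + 1) M' then 0 else 1) else ⊤)
          M₁ := by
          refine wp_mono (fun M' => ?_) _ _
          by_cases hI' : Iterating r E F x (t + 1) M'
          · rw [if_pos (hI'.setVar _), if_pos hI', add_assoc]
            gcongr
            simp only [hPset]
            by_cases h1 : P t M₁ <;> by_cases h2 : P (t + 1) M' <;> simp [h1, h2]
          · simp [hI']
      _ ≤ (((T - (t + 1) : ℕ) : ℝ≥0∞) * δ + (if P t M₁ then 0 else 1)) + δ :=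
          (wp_const_add _ _ _ _).trans (add_le_add_right hit _)
      _ = _ := by push_cast; ring
  · obtain ⟨q, hcur, -⟩ := h.current
    exact hcur.int3

theorem sure_setParams {ε : ℝ} (x : Fin n → Fin d → ℝ) (a : ℕ) :
    Sure (setParams a) 43 (inputMem x ε 0) fun M =>
      Consts (⌊a * Real.log (n / ε)⌋₊ + 1) (ε / 256) (√n / (ε / 256)) x M ∧
      M.int 11 0 = ⌊Real.log (n / ε) / (ε / 256)⌋₊ + 1 ∧ M.real 9 0 = 1 / √n := by
  refine (sure_block _ _ (by simp) _).mono ?_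
  rintro M rfl
  refine ⟨⟨?_, ?_, ?_, ?_, ?_, fun i => ?_, ?_, ?_, ?_, ?_⟩, ?_, ?_⟩
  all_goals simp [inputMem]

/-- The vector in the real array `5` is initially the normalized all-ones vector. -/
theorem sure_start {ε : ℝ} (hn : 1 ≤ n) (x : Fin n → Fin d → ℝ) (a : ℕ) :
    Sure (.seq (setParams a) (forLoop 15 0 (.instr (.realOp .add (cell 5 15) (var 9) (var 13)))))
      (43 + (4 * n + 3) + 1) (inputMem x ε 0) fun M =>
      Iterating (⌊a * Real.log (n / ε)⌋₊ + 1) (ε / 256) (√n / (ε / 256)) x 0 M ∧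
      M.int 11 0 = ⌊Real.log (n / ε) / (ε / 256)⌋₊ + 1 ∧ M.vec n 5 = (fun _ => 1 / √n) ∧
      M.real 8 0 = 0 := by
  refine Sure.seq (sure_setParams x a).frame ?_
  rintro M ⟨⟨c, h11, h9⟩, hf⟩
  refine (sure_fillArray (a := 5) (i := .realOp .add (cell 5 15) (var 9) (var 13)) trivial rfl
    (fun _ => 1 / √n) (fun j hj M' hM' h15 => ?_) c.int0 c.int3).mono ?_
  · have e9 : M'.real 9 0 = 1 / √n := by rw [hM'.2 9 (by norm_num), h9]
    have e13 : M'.real 13 0 = 0 := by rw [hM'.2 13 (by norm_num), c.rzero]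
    simp [e9, e13]
  · rintro M' ⟨hf', h5⟩
    have hi : ∀ b, b ∈ [4, 5, 24, 26] ∨ 40 ≤ b → ∀ i, M'.int b i = 0 := fun b hb i => by
      have : b ≠ 15 ∧ b ≠ 3 ∧ b ≠ 27 ∧ b ≠ 11 ∧ b ≠ 12 ∧ b ≠ 0 ∧ b ≠ 1 := by simp at hb; omega
      rw [hf'.1 b (by omega), hf.1 b (by simp [setParams]; omega)]
      simp [inputMem, this]
    have hr : ∀ b, b = 8 ∨ 40 ≤ b → ∀ i, M'.real b i = 0 := fun b hb i => by
      have : b ≠ 0 ∧ b ≠ 1 := by omega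
      rw [hf'.2 b (by omega), hf.2 b (by simp [setParams]; omega)]
      simp [inputMem, this]
    have hcopy : ∀ q, M'.copy q = emptyMem := fun q =>
      Mem.ext' (fun b _ => hi (40 + b) (by omega) _) fun b _ => hr (40 + b) (by omega) _
    have hvec : M'.vec n 5 = fun _ => 1 / √n := funext fun l => h5 l l.2
    have hn0 : 0 < √(n : ℝ) := Real.sqrt_pos.2 (by exact_mod_cast hn)
    refine ⟨⟨⟨0, ⟨c.frame hf' (by simp) (by simp), ?_, ?_, fun q _ => hcopy q⟩, hcopy 0⟩, ?_,
      fun s _ j => hi 24 (by simp) _, fun l => ?_, ?_⟩, ?_, hvec, hr 8 (by simp) 0⟩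
    · exact hi 4 (by simp) 0
    · exact hi 5 (by simp) 0
    · simpa using hi 26 (by simp) 0
    · rw [h5 l l.2]; positivity
    · rw [hvec, euclNorm_eq]
      simp only [Finset.sum_const, Finset.card_univ, Fintype.card_fin, nsmul_eq_mul]
      rw [div_mul_div_comm, Real.mul_self_sqrt (by positivity), one_mul, mul_one_div,
        div_self (by positivity), Real.sqrt_one]
    · rw [hf'.1 11 (by norm_num), h11]

/-- The time for the whole program, with `T` iterations. -/
def programTime (n d r T N tP tQ : ℕ) : ℕ :=
  43 + (4 * n + 3) + 1 + (T * (iterationTime n d r N tP tQ + 3) + 3) + 1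

/-- With E = ε/256, log(1 + 8E) ≥ 4E while the exponent exceeds log(n/ε)/E, so the power exceeds n/ε
> n ≥ √n. -/
theorem sqrt_lt_growth {ε : ℝ} (hn : 1 ≤ n) (hε : 0 < ε) (hε' : ε < 1) :
    √n < (1 + 8 * (ε / 256)) ^ (⌊Real.log (n / ε) / (ε / 256)⌋₊ + 1) := by
  have hn' : (1 : ℝ) ≤ n := by exact_mod_cast hn
  have h1 : (n : ℝ) < n / ε := by
    rw [lt_div_iff₀ hε]; nlinarith
  have hL : 0 < Real.log (n / ε) := Real.log_pos (by linarith)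
  set L := Real.log (n / ε)
  set T := ⌊L / (ε / 256)⌋₊ + 1
  have hT : L / (ε / 256) < T := by
    simpa [T] using Nat.lt_floor_add_one (L / (ε / 256))
  rw [div_lt_iff₀ (by positivity)] at hT
  have h2 : 4 * (ε / 256) ≤ Real.log (1 + 8 * (ε / 256)) := by
    have := Real.one_sub_inv_le_log_of_pos (x := 1 + 8 * (ε / 256)) (by positivity)
    refine le_trans ?_ this
    rw [le_sub_comm, inv_le_iff_one_le_mul₀ (by positivity)]
    nlinarith
  calc √(n : ℝ) ≤ n := by
        rw [Real.sqrt_le_left (by linarith)]; nlinarith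
    _ < n / ε := h1
    _ = Real.exp L := (Real.exp_log (by positivity)).symm
    _ ≤ Real.exp (T * Real.log (1 + 8 * (ε / 256))) := by
        refine Real.exp_le_exp.2 ?_
        have : (T : ℝ) * (4 * (ε / 256)) ≤ T * Real.log (1 + 8 * (ε / 256)) := by gcongr
        linarith
    _ = _ := by
        rw [Real.exp_nat_mul, Real.exp_log (by positivity)]

/-- The memory holds a unit vector that approximates the top eigenvalue of `A`. -/
def IsGoodOutput (A : Matrix (Fin n) (Fin n) ℝ) (ε : ℝ) (M : Mem) : Prop :=
  ‖outputVector n M‖ = 1 ∧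
    (1 - ε) * topEigenvalue A ≤ (outputVector n M).ofLp ⬝ᵥ A.mulVec (outputVector n M).ofLp

open Classical in
theorem wp_eigenvectorProgram {N tP tQ a : ℕ} {ε : ℝ} {K : (Fin d → ℝ) → (Fin d → ℝ) → ℝ}
    {prep query : Cmd} (hn : 1 ≤ n) (hd : 1 ≤ d) (hK : IsNiceKernel K) (hε : 0 < ε) (hε' : ε < 1)
    (hest : EstimatesWithin K prep query (ε / 256) N tP tQ)
    (hN : √n / (ε / 256) * √n + n ≤ N) (x : Fin n → Fin d → ℝ) :
    (eigenvectorProgram prep query a).wp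
      (programTime n d (⌊a * Real.log (n / ε)⌋₊ + 1) (⌊Real.log (n / ε) / (ε / 256)⌋₊ + 1) N tP tQ)
      (fun M => if IsGoodOutput (kernelMatrix K x) ε M then 0 else 1) (inputMem x ε 0) ≤
      (⌊Real.log (n / ε) / (ε / 256)⌋₊ + 1 : ℕ) *
        (n * (17 / 18) ^ (⌊a * Real.log (n / ε)⌋₊ + 1)) := by
  have hn0 : NeZero n := ⟨by omega⟩
  have hs : 0 < √(n : ℝ) := Real.sqrt_pos.2 (by exact_mod_cast hn)
  have hE : 0 < ε / 256 := by positivity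
  have hF : 0 < √(n : ℝ) / (ε / 256) := by positivity
  have hpsd := hK.posDef n x
  have hnn : ∀ i j, 0 ≤ kernelMatrix K x i j := fun i j => (hK.mem_Icc _ _).1
  have hpos := topEigenvalue_pos hpsd.isHermitian fun i => hK.diag _
  obtain ⟨u, hu, hu1, hu'⟩ := exists_nonneg_witness hpsd hnn
  refine (sure_start hn x a).wp_seq ?_
  rintro M ⟨hI, h11, h5, h8⟩
  refine le_trans (wp_mono (fun M' => ?_) _ _) (wp_iterations hn hd hK hE (by linarith) hF hest hN
    hu hu' hI h11 (by rw [h5, h8]; exact PowerState.init hu hu1 _))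
  by_cases hI' : Iterating (⌊a * Real.log (n / ε)⌋₊ + 1) (ε / 256) (√n / (ε / 256)) x
    (⌊Real.log (n / ε) / (ε / 256)⌋₊ + 1) M'
  swap
  · rw [if_neg hI']; exact le_top
  rw [if_pos hI']
  by_cases h1 : IsGoodOutput (kernelMatrix K x) ε M'
  · simp [h1]
  refine le_of_eq_of_le (if_neg h1) (le_of_eq (if_neg fun h2 => ?_).symm)
  have := h2.rayleigh hpsd hpos hF hE (by linarith) (by field_simp) hu1 hI'.unit
    (sqrt_lt_growth hn hε hε')
  refine h1 ⟨this.1, ?_⟩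
  have e : 256 * (ε / 256) = ε := by ring
  rw [← e]
  exact this.2

/-- The bound on `wp` is finite, which gives sure halting. The same number then bounds the
probability of a bad output, and taking complements finishes. -/
theorem eigenvectorProgram_correct {N tP tQ a t : ℕ} {ε δ : ℝ}
    {K : (Fin d → ℝ) → (Fin d → ℝ) → ℝ}
    {prep query : Cmd} (hn : 1 ≤ n) (hd : 1 ≤ d) (hK : IsNiceKernel K) (hε : 0 < ε) (hε' : ε < 1)
    (hest : EstimatesWithin K prep query (ε / 256) N tP tQ)
    (hN : √n / (ε / 256) * √n + n ≤ N)
    (ht : programTime n d (⌊a * Real.log (n / ε)⌋₊ + 1) (⌊Real.log (n / ε) / (ε / 256)⌋₊ + 1)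
      N tP tQ ≤ t)
    (hδ : (⌊Real.log (n / ε) / (ε / 256)⌋₊ + 1 : ℝ) *
        (n * (17 / 18) ^ (⌊a * Real.log (n / ε)⌋₊ + 1)) ≤ δ)
    (x : Fin n → Fin d → ℝ) :
    (eigenvectorProgram prep query a).HaltsIn (inputMem x ε 0) t ∧
      ENNReal.ofReal (1 - δ) ≤ ((eigenvectorProgram prep query a).run t
        (inputMem x ε 0)).toOuterMeasure {M | IsGoodOutput (kernelMatrix K x) ε M} := by
  classical
  have h := (wp_anti _ ht _).trans
    (wp_eigenvectorProgram (a := a) hn hd hK hε hε' hest hN x)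
  have hδ' : ((⌊Real.log (n / ε) / (ε / 256)⌋₊ + 1 : ℕ) : ℝ≥0∞) *
      (n * (17 / 18) ^ (⌊a * Real.log (n / ε)⌋₊ + 1)) ≤ ENNReal.ofReal δ := by
    refine le_trans (le_of_eq ?_) (ENNReal.ofReal_le_ofReal hδ)
    rw [ENNReal.ofReal_mul (by positivity), ENNReal.ofReal_mul (by positivity),
      ENNReal.ofReal_pow (by norm_num), ENNReal.ofReal_natCast,
      ENNReal.ofReal_div_of_pos (by norm_num)]
    norm_cast
  have h := h.trans hδ'
  have hh := haltsIn_of_wp_ne_top (ne_top_of_le_ne_top ENNReal.ofReal_ne_top h)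
  refine ⟨hh, ?_⟩
  have hδ0 : 0 ≤ δ := le_trans (by positivity) hδ
  replace h := hh.wp_eq.ge.trans h
  rw [ENNReal.ofReal_sub _ hδ0, ENNReal.ofReal_one, tsub_le_iff_right, toOuterMeasure_eq_expect]
  refine le_trans ?_ (add_le_add_right h _)
  rw [← expect_const ((eigenvectorProgram prep query a).run t (inputMem x ε 0)) 1]
  unfold expect
  rw [← ENNReal.tsum_add]
  refine ENNReal.tsum_le_tsum fun M => ?_
  rw [← mul_add]
  gcongr
  by_cases hM : IsGoodOutput (kernelMatrix K x) ε M <;> simp [hM]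

end

end RealRAM

open RealRAM

/-! ### Bounds on the failure probability and the running time -/

section
variable {n d : ℕ} {ε p : ℝ}

theorem half_le_log (hn : 2 ≤ n) (hε : 0 < ε) (hε' : ε < 1) : 1 / 2 ≤ Real.log (n / ε) := by
  have h2 : (2 : ℝ) ≤ n / ε := by
    rw [le_div_iff₀ hε]
    have : (2 : ℝ) ≤ n := by exact_mod_cast hn
    linarith
  have := Real.log_le_log (by norm_num) h2
  linarith [Real.log_two_gt_d9]

/-- With ν = n/ε, the number of iterations is at most 256ν² + 1 ≤ ν^11, and n ≤ ν. Since 17/18 ≤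
exp(-1/18), taking 18(c + 12) log ν copies makes (17/18)^r at most ν^(-c-12), which absorbs both
factors and leaves ν^(-c) ≤ n^(-c). -/
theorem failure_le (hn : 2 ≤ n) (hε : 0 < ε) (hε' : ε < 1) (c : ℕ) :
    (⌊Real.log (n / ε) / (ε / 256)⌋₊ + 1 : ℝ) *
      (n * (17 / 18) ^ (⌊((18 * (c + 12) : ℕ) : ℝ) * Real.log (n / ε)⌋₊ + 1)) ≤ 1 / (n : ℝ) ^ c := by
  have hL := half_le_log hn hε hε'
  have hn' : (2 : ℝ) ≤ n := by exact_mod_cast hn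
  have hnν : (n : ℝ) ≤ n / ε := by rw [le_div_iff₀ hε]; nlinarith
  have hεν : 1 / ε ≤ n / ε := by gcongr; linarith
  have hν0 : (0 : ℝ) < n / ε := by positivity
  have hLν : Real.log (n / ε) ≤ n / ε := (Real.log_le_sub_one_of_pos hν0).trans (by linarith)
  have he := Real.exp_log hν0
  set ν : ℝ := n / ε
  set L := Real.log ν
  have hT : (⌊L / (ε / 256)⌋₊ + 1 : ℝ) ≤ ν ^ 11 := by
    have h1 := Nat.floor_le (a := L / (ε / 256)) (by positivity)
    have h2 : L / (ε / 256) = 256 * (L * (1 / ε)) := by field_simp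
    have h3 : L * (1 / ε) ≤ ν * ν := by gcongr
    have h4 : (2 : ℝ) ^ 9 ≤ ν ^ 9 := by gcongr; linarith
    have h5 : 1 ≤ ν * ν := by nlinarith
    have h6 : ν ^ 11 = ν ^ 9 * (ν * ν) := by ring
    rw [h6]
    nlinarith
  have hR : (17 / 18 : ℝ) ^ (⌊((18 * (c + 12) : ℕ) : ℝ) * L⌋₊ + 1) ≤ (ν ^ (c + 12))⁻¹ := by
    have h1 := Nat.lt_floor_add_one (((18 * (c + 12) : ℕ) : ℝ) * L)
    have h2 : (17 / 18 : ℝ) ≤ Real.exp (-(1 / 18)) := by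
      have := Real.add_one_le_exp (-(1 / 18 : ℝ))
      linarith
    calc _ ≤ Real.exp (-(1 / 18)) ^ (⌊((18 * (c + 12) : ℕ) : ℝ) * L⌋₊ + 1) := by gcongr
      _ = Real.exp (((⌊((18 * (c + 12) : ℕ) : ℝ) * L⌋₊ + 1 : ℕ) : ℝ) * (-(1 / 18))) := by
        rw [Real.exp_nat_mul]
      _ ≤ Real.exp (-(((c + 12 : ℕ) : ℝ) * L)) := by
        refine Real.exp_le_exp.2 ?_
        push_cast at h1 ⊢
        linarith
      _ = _ := by rw [Real.exp_neg, Real.exp_nat_mul, he]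
  calc _ ≤ ν ^ 11 * (ν * (ν ^ (c + 12))⁻¹) := by gcongr
    _ = 1 / ν ^ c := by
      rw [pow_add]
      field_simp
    _ ≤ 1 / (n : ℝ) ^ c := by gcongr

/-- The density estimates for all sizes up to `N`. -/
theorem estimatesWithin {k : (Fin d → ℝ) → (Fin d → ℝ) → ℝ} {prep query : Cmd} {C E : ℝ}
    (hp : 0 ≤ p) (hE : 0 < E) (hE' : E < 1) (N : ℕ)
    (h : ∀ (m : ℕ) (X : Fin m → Fin d → ℝ) (ε μ : ℝ), 1 ≤ m → 0 < ε → ε < 1 → 0 < μ → μ ≤ 1 →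
      let tPrep : ℕ := ⌊C * (d * m / (μ ^ p * ε ^ 2))⌋₊
      let tQuery : ℕ := ⌊C * (d / (μ ^ p * ε ^ 2))⌋₊
      let after : List (Fin d → ℝ) → PMF Mem :=
        runQueries query tQuery (prep.run tPrep (inputMem X ε μ))
      prep.HaltsIn (inputMem X ε μ) tPrep ∧
      ∀ (ys : List (Fin d → ℝ)) (y : Fin d → ℝ),
        (∀ M ∈ (after ys).support, query.HaltsIn (writeQuery y M) tQuery) ∧
        (μ ≤ kernelDensity k X y →
          (2 / 3 : ℝ≥0∞) ≤ (after (ys ++ [y])).toOuterMeasure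
            {M | |M.real 3 0 - kernelDensity k X y| ≤ ε * kernelDensity k X y})) :
    EstimatesWithin k prep query E N ⌊|C| * (d * (N : ℝ) ^ (1 + p) / E ^ 2)⌋₊
      ⌊|C| * (d * (N : ℝ) ^ p / E ^ 2)⌋₊ := by
  intro m X hm hmN
  have hm0 : (0 : ℝ) < m := by exact_mod_cast hm
  have hmN' : (m : ℝ) ≤ N := by exact_mod_cast hmN
  have hm1 : (1 : ℝ) / m ≤ 1 := by
    rw [div_le_one hm0]; exact_mod_cast hm
  have e : ((1 : ℝ) / m) ^ p = ((m : ℝ) ^ p)⁻¹ := by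
    rw [one_div, Real.inv_rpow hm0.le]
  have hmp : 0 < (m : ℝ) ^ p := Real.rpow_pos_of_pos hm0 p
  have hmNp : (m : ℝ) ^ p ≤ (N : ℝ) ^ p := Real.rpow_le_rpow hm0.le hmN' hp
  -- The density threshold is μ = 1/m, whence the factor m^p. The absolute value is needed because
  -- `C` may be negative.
  refine ⟨_, Nat.floor_mono ?_, _, Nat.floor_mono ?_, h m X E (1 / m) hm hE hE' (by positivity) hm1⟩
  · have e' : (d : ℝ) * m / ((1 / m) ^ p * E ^ 2) = d * (m : ℝ) ^ (1 + p) / E ^ 2 := by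
      rw [e, Real.rpow_add hm0, Real.rpow_one]
      field_simp
    rw [e']
    calc _ ≤ |C| * (d * (m : ℝ) ^ (1 + p) / E ^ 2) := by gcongr; exact le_abs_self C
      _ ≤ _ := by gcongr
  · have e' : (d : ℝ) / ((1 / m) ^ p * E ^ 2) = d * (m : ℝ) ^ p / E ^ 2 := by
      rw [e]
      field_simp
    rw [e']
    calc _ ≤ |C| * (d * (m : ℝ) ^ p / E ^ 2) := by gcongr; exact le_abs_self C
      _ ≤ _ := by gcongr

theorem copyTime_le {N tP tQ : ℕ} {U C₁ : ℝ} (h1 : 1 ≤ U) (hn : n ≤ U) (hnd : (n * d : ℝ) ≤ U)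
    (hN : (N * d : ℝ) ≤ 258 * U) (hP : tP ≤ C₁ * U) (hQ : (n * tQ : ℝ) ≤ C₁ * U) :
    (copyTime n d N tP tQ + 3 : ℝ) ≤ (4248 + 64 * C₁) * U := by
  unfold copyTime
  push_cast
  linarith

theorem programTime_le {N tP tQ r T : ℕ} {U C₂ L a : ℝ} (h1 : 1 ≤ U) (hn : n ≤ U)
    (hc : (copyTime n d N tP tQ + 3 : ℝ) ≤ C₂ * U) (hC₂ : 0 ≤ C₂) (ha : 0 ≤ a) (hε : 0 < ε) (hε' : ε < 1)
    (hL : 1 / 2 ≤ L)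
    (hr : r ≤ (a + 2) * L) (hT : T ≤ 258 * (L / ε)) :
    (programTime n d r T N tP tQ : ℝ) ≤
      (258 * ((a + 2) * C₂ + 102) + 220) * (L ^ 2 * U / ε) := by
  have hLε : L ≤ L / ε := by rw [le_div_iff₀ hε]; nlinarith
  have h2 : U ≤ 2 * (L * U) := by nlinarith
  have h3 : L * U ≤ 2 * (L ^ 2 * U / ε) := by
    calc L * U ≤ (2 * (L * L)) * U := by gcongr; nlinarith
      _ ≤ (2 * (L * (L / ε))) * U := by gcongr
      _ = _ := by ring
  have h4 : (iterationTime n d r N tP tQ + 3 : ℝ) ≤ ((a + 2) * C₂ + 102) * (L * U) := by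
    unfold iterationTime
    push_cast
    have : (r : ℝ) * (copyTime n d N tP tQ + 3) ≤ ((a + 2) * L) * (C₂ * U) := by gcongr
    linarith
  have h0 : 0 ≤ (a + 2) * C₂ := mul_nonneg (by linarith) hC₂
  have h5 : (T : ℝ) * (iterationTime n d r N tP tQ + 3) ≤
      (258 * (L / ε)) * (((a + 2) * C₂ + 102) * (L * U)) := by gcongr
  have h6 : (258 * (L / ε)) * (((a + 2) * C₂ + 102) * (L * U)) =
      (258 * ((a + 2) * C₂ + 102)) * (L ^ 2 * U / ε) := by ring
  unfold programTime
  push_cast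
  linarith

/-- A power of the logarithm is negligible against (n/ε)^(1-p), and n^(1+p) n^(1-p) = n². -/
theorem eigenvectorTime_isLittleO (hp' : p < 1) (hε : 0 < ε) :
    (fun n : ℕ => eigenvectorTime p n d ε) =o[Filter.atTop] fun n : ℕ => (n : ℝ) ^ 2 := by
  have ht : Filter.Tendsto (fun n : ℕ => (n : ℝ) / ε) Filter.atTop Filter.atTop :=
    tendsto_natCast_atTop_atTop.atTop_div_const hε
  have h1 := (isLittleO_log_rpow_rpow_atTop (2 + p) (by linarith : 0 < 1 - p)).comp_tendsto ht
  have h2 := (Asymptotics.isBigO_refl (fun n : ℕ => (n : ℝ) ^ (1 + p)) Filter.atTop).mul_isLittleO h1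
  refine ((h2.const_mul_left ((d : ℝ) / ε ^ (7 + 4 * p))).congr_left (f₂ := fun n : ℕ =>
    eigenvectorTime p n d ε) fun n => ?_).trans_isBigO ?_
  · simp only [Function.comp, eigenvectorTime]
    ring
  · refine Asymptotics.IsBigO.of_bound ((ε ^ (1 - p))⁻¹) ?_
    filter_upwards [Filter.eventually_gt_atTop 0] with n hn
    have hn' : (0 : ℝ) < n := by exact_mod_cast hn
    rw [Function.comp, Real.div_rpow hn'.le hε.le, ← mul_div_assoc, ← Real.rpow_add hn',
      show 1 + p + (1 - p) = ((2 : ℕ) : ℝ) by push_cast; ring, Real.rpow_natCast, norm_div,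
      Real.norm_of_nonneg (Real.rpow_nonneg hε.le _), div_eq_inv_mul]

/-- One copy has N ≤ 258 n/ε points and costs O(U) with U = d (n/ε)^(1+p) / ε². There are
O(log(n/ε)) copies per iteration and O(log(n/ε)/ε) iterations. The total d n^(1+p) log(n/ε)² /
ε^(4+p), up to a constant, is smaller than the stated bound. -/
theorem time_le (hp : 0 ≤ p) (hd : 1 ≤ d) (hn : 2 ≤ n) (hε : 0 < ε) (hε' : ε < 1) (C : ℝ) (a N : ℕ)
    (hN : N = ⌈√n / (ε / 256) * √n + n⌉₊) :
    (programTime n d (⌊a * Real.log (n / ε)⌋₊ + 1) (⌊Real.log (n / ε) / (ε / 256)⌋₊ + 1) N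
      ⌊|C| * (d * (N : ℝ) ^ (1 + p) / (ε / 256) ^ 2)⌋₊
      ⌊|C| * (d * (N : ℝ) ^ p / (ε / 256) ^ 2)⌋₊ : ℝ) ≤
    (258 * ((a + 2) * (4248 + 64 * (|C| * 258 ^ (1 + p) * 65536)) + 102) + 220) * 2 ^ p *
      eigenvectorTime p n d ε := by
  have hL := half_le_log hn hε hε'
  have hn' : (2 : ℝ) ≤ n := by exact_mod_cast hn
  have hd' : (1 : ℝ) ≤ d := by exact_mod_cast hd
  have hnν : (n : ℝ) ≤ n / ε := by rw [le_div_iff₀ hε]; nlinarith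
  have hν0 : (0 : ℝ) < n / ε := by positivity
  have hν1 : (1 : ℝ) ≤ n / ε := by linarith
  set ν : ℝ := n / ε with hν
  set L := Real.log ν with hLdef
  have hN' : (N : ℝ) ≤ 258 * ν := by
    have h1 := Nat.ceil_lt_add_one (a := √n / (ε / 256) * √n + n) (by positivity)
    have h2 : √(n : ℝ) / (ε / 256) * √n = 256 * ν := by
      rw [div_mul_eq_mul_div, Real.mul_self_sqrt (by positivity), hν]
      field_simp
    rw [hN]
    linarith
  have hN0 : (0 : ℝ) ≤ N := by positivity
  set U : ℝ := d * ν ^ (1 + p) / ε ^ 2 with hU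
  have hε2 : ε ^ 2 ≤ 1 := by nlinarith
  have hdU : (d : ℝ) * ν ≤ U := by
    rw [hU, le_div_iff₀ (by positivity)]
    have h1 : ν ≤ ν ^ (1 + p) := by
      simpa using Real.rpow_le_rpow_of_exponent_le hν1 (by linarith : (1 : ℝ) ≤ 1 + p)
    calc (d : ℝ) * ν * ε ^ 2 ≤ d * ν * 1 := by gcongr
      _ = d * ν := mul_one _
      _ ≤ _ := by gcongr
  have hnd : (n * d : ℝ) ≤ U := by nlinarith
  have hnU : (n : ℝ) ≤ U := by nlinarith
  have hN1 : (N : ℝ) ^ (1 + p) ≤ 258 ^ (1 + p) * ν ^ (1 + p) := by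
    rw [← Real.mul_rpow (by norm_num) hν0.le]
    exact Real.rpow_le_rpow hN0 hN' (by linarith)
  have hNp : (N : ℝ) ^ p ≤ 258 ^ (1 + p) * ν ^ p := by
    refine (Real.rpow_le_rpow hN0 hN' hp).trans ?_
    rw [Real.mul_rpow (by norm_num) hν0.le]
    gcongr
    · norm_num
    · linarith
  have hcopy := copyTime_le (n := n) (d := d) (N := N)
    (tP := ⌊|C| * (d * (N : ℝ) ^ (1 + p) / (ε / 256) ^ 2)⌋₊)
    (tQ := ⌊|C| * (d * (N : ℝ) ^ p / (ε / 256) ^ 2)⌋₊)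
    (C₁ := |C| * 258 ^ (1 + p) * 65536) (by linarith) hnU hnd (by nlinarith) ?_ ?_
  · refine (programTime_le (a := a) (L := L) (ε := ε) (by linarith) hnU hcopy (by positivity)
      (by positivity) hε hε' hL ?_ ?_).trans ?_
    · push_cast
      have := Nat.floor_le (a := (a : ℝ) * L) (by positivity)
      linarith
    · push_cast
      have h1 := Nat.floor_le (a := L / (ε / 256)) (by positivity)
      have h2 : L / (ε / 256) = 256 * (L / ε) := by field_simp
      have h3 : L ≤ L / ε := by rw [le_div_iff₀ hε]; nlinarith
      linarith
    · rw [mul_assoc _ ((2 : ℝ) ^ p)]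
      refine mul_le_mul_of_nonneg_left ?_ (by positivity)
      -- As L ≥ 1/2, the factor (2L)^p is at least 1; L itself may be below 1.
      have h1 : L ^ 2 ≤ 2 ^ p * L ^ (2 + p) := by
        have hL0 : 0 < L := by linarith
        rw [Real.rpow_add hL0, Real.rpow_two, mul_left_comm, ← Real.mul_rpow (by norm_num) hL0.le]
        exact le_mul_of_one_le_right (by positivity) (Real.one_le_rpow (by linarith) hp)
      -- The exponent of 1/ε reached is 4 + p; it is weakened to 7 + 4p using ε < 1.
      have h2 : U / ε ≤ d * (n : ℝ) ^ (1 + p) / ε ^ (7 + 4 * p) := by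
        rw [hU, hν, Real.div_rpow (by positivity) hε.le, mul_div_assoc', div_div, div_div]
        have e : ε ^ (1 + p) * ε ^ 2 * ε = ε ^ (4 + p) := by
          rw [show 4 + p = (1 + p) + 2 + 1 by ring, Real.rpow_add hε _ 1,
            Real.rpow_add hε _ 2, Real.rpow_one, Real.rpow_two]
        rw [← mul_assoc, e]
        gcongr _ / ?_
        exact Real.rpow_le_rpow_of_exponent_ge hε hε'.le (by linarith)
      calc L ^ 2 * U / ε = L ^ 2 * (U / ε) := by ring
        _ ≤ (2 ^ p * L ^ (2 + p)) * (d * (n : ℝ) ^ (1 + p) / ε ^ (7 + 4 * p)) := by gcongr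
        _ = _ := by unfold eigenvectorTime; ring
  · refine (Nat.floor_le (by positivity)).trans ?_
    calc _ ≤ |C| * (d * (258 ^ (1 + p) * ν ^ (1 + p)) / (ε / 256) ^ 2) := by gcongr
      _ = _ := by rw [hU]; field_simp; norm_num
  · have h1 := Nat.floor_le (a := |C| * (d * (N : ℝ) ^ p / (ε / 256) ^ 2)) (by positivity)
    calc _ ≤ ν * (|C| * (d * (258 ^ (1 + p) * ν ^ p) / (ε / 256) ^ 2)) := by
          refine mul_le_mul hnν (h1.trans ?_) (by positivity) (by positivity)
          gcongr
      _ = _ := by rw [hU, Real.rpow_add hν0 1 p, Real.rpow_one]; field_simp; norm_num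

end

end

theorem mainTheorem3 (D : Set ℕ) (hD : ∀ d ∈ D, 1 ≤ d)
    (k : (d : ℕ) → (Fin d → ℝ) → (Fin d → ℝ) → ℝ) (p : ℝ) (hp : 0 ≤ p)
    (hnice : ∀ d ∈ D, IsNiceKernel (k d)) (hkde : AdmitsFastKDE D k p) :
    (∀ c : ℕ, ∃ (P : RealRAM.Cmd) (C : ℝ),
      ∀ d ∈ D, ∀ (n : ℕ) (x : Fin n → Fin d → ℝ) (ε : ℝ), 2 ≤ n → 0 < ε → ε < 1 →
        P.HaltsIn (inputMem x ε 0) ⌊C * eigenvectorTime p n d ε⌋₊ ∧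
        ENNReal.ofReal (1 - 1 / (n : ℝ) ^ c) ≤
          (P.run ⌊C * eigenvectorTime p n d ε⌋₊ (inputMem x ε 0)).toOuterMeasure
            {M | ‖outputVector n M‖ = 1 ∧
              (1 - ε) * topEigenvalue (kernelMatrix (k d) x) ≤
                (outputVector n M).ofLp ⬝ᵥ
                  (kernelMatrix (k d) x).mulVec (outputVector n M).ofLp}) ∧
    (p < 1 → ∀ (d : ℕ) (ε : ℝ), 0 < ε →
      (fun n : ℕ => eigenvectorTime p n d ε) =o[Filter.atTop] fun n : ℕ => (n : ℝ) ^ 2) := by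
  refine ⟨fun c => ?_, fun hp' d ε hε => eigenvectorTime_isLittleO hp' hε⟩
  obtain ⟨prep, query, C, h⟩ := hkde
  refine ⟨RealRAM.eigenvectorProgram prep query (18 * (c + 12)),
    (258 * (((18 * (c + 12) : ℕ) + 2) * (4248 + 64 * (|C| * 258 ^ (1 + p) * 65536)) + 102) + 220) *
      2 ^ p,
    fun d hd n x ε hn hε hε' => ?_⟩
  exact RealRAM.eigenvectorProgram_correct (by omega) (hD d hd) (hnice d hd) hε hε'
    (estimatesWithin hp (by positivity) (by linarith) _ (h d hd)) (Nat.le_ceil _)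
    (Nat.le_floor (time_le hp (hD d hd) hn hε hε' C _ _ rfl)) (failure_le hn hε hε' c) x
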